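/- A knot projection on the plane $\mathbb{R}^2$ or the sphere $S^2$ is the image of a regularly parametrized closed ($C^1$-immersed) curve that passes at most twice through each point and whose double points, called crossings, are transverse; a knot diagram is a knot projection with over/under information at each crossing. The regions of a diagram or projection $D$ are the connected components of the complement of the curve in the plane or sphere. Let $D$ be a knot diagram or projection on $\mathbb{R}^2$ or $S^2$ with $n$ crossings $x_1,\dots,x_n$, $n\ge 1$. Then $D$ has exactly $n+2$ regions. Let $R_1,\dots,R_{n+2}$ be the regions of $D$, in any order. Let $A_{d1}(D)$ be the $n\times(n+2)$ matrix whose $(i,j)$ entry is $1$ if $x_i\in\partial R_j$ and $0$ otherwise. Let $A_{d2}(D)$ be the $n\times(n+2)$ matrix whose $(i,j)$ entry is $2$ if $R_j$ touches $x_i$ twice (that is, $R_j$ contains two of the four corners at $x_i$), and equals the $(i,j)$ entry of $A_{d1}(D)$ otherwise. 1. For every $\mathbf c\in\mathbb{Z}^n$ there exists $\mathbf u\in\mathbb{Z}^{n+2}$ such that $A_{d1}(D)\mathbf u+\mathbf c=\mathbf 0$. 2. For every $\mathbf c\in\mathbb{Z}^n$ there exists $\mathbf u\in\mathbb{Z}^{n+2}$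 such that $A_{d2}(D)\mathbf u+\mathbf c=\mathbf 0$. -/

import Mathlib

open Filter Topology

/-- The surfaces on which diagrams are drawn: the plane and the 2-sphere. -/
inductive DiagramSurface
  | plane
  | sphere

namespace DiagramSurface

/-- The plane `{(x, y, 0)}`, resp. the unit sphere, in Euclidean 3-space. -/
def carrier : DiagramSurface → Set (EuclideanSpace ℝ (Fin 3))
  | plane => {v | v 2 = 0}
  | sphere => Metric.sphere 0 1

/-- Used to push `p + ε • v`, where `v` is tangent to the surface at `p`, back onto the surface. On
the plane nothing is to be done; on the sphere this is the radial projection. -/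
noncomputable def push : DiagramSurface → EuclideanSpace ℝ (Fin 3) → EuclideanSpace ℝ (Fin 3)
  | plane => fun w => w
  | sphere => fun w => ‖w‖⁻¹ • w

end DiagramSurface

/-- A knot projection on the plane or the sphere: a regular closed curve, given by a 1-periodic `C¹`
parametrization, that passes at most twice through each point, where the two passages through a
double point are transverse. -/
structure KnotProjection (S : DiagramSurface) where
  curve : ℝ → EuclideanSpace ℝ (Fin 3)
  curve_mem : ∀ t, curve t ∈ S.carrier
  periodic : Function.Periodic curve 1
  contDiff : ContDiff ℝ 1 curve
  immersed : ∀ t, deriv curve t ≠ 0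
  atMostDouble : ∀ p, (Set.Ico (0 : ℝ) 1 ∩ curve ⁻¹' {p}).encard ≤ 2
  transverse : ∀ s ∈ Set.Ico (0 : ℝ) 1, ∀ t ∈ Set.Ico (0 : ℝ) 1, s ≠ t → curve s = curve t →
    LinearIndependent ℝ ![deriv curve s, deriv curve t]

namespace KnotProjection

variable {S : DiagramSurface} (P : KnotProjection S)

/-- The crossings: the points through which the curve passes twice. -/
def Crossing : Type :=
  {p : EuclideanSpace ℝ (Fin 3) // ∃ s ∈ Set.Ico (0 : ℝ) 1, ∃ t ∈ Set.Ico (0 : ℝ) 1,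
    s ≠ t ∧ P.curve s = p ∧ P.curve t = p}

/-- The regions: the connected components of the complement of the curve in the surface. -/
def Region : Type :=
  {R : Set (EuclideanSpace ℝ (Fin 3)) // ∃ z ∈ S.carrier \ Set.range P.curve,
    R = connectedComponentIn (S.carrier \ Set.range P.curve) z}

/-- The boundary in the surface of a region, which is an open subset of the surface. -/
def boundary (R : P.Region) : Set (EuclideanSpace ℝ (Fin 3)) :=
  closure R.1 \ R.1

/-- Directions pointing into the four corners at a crossing: if `a` and `b` are the velocities of
the two strands there, these are the four vectors `a + b`, `a - b`, `-a + b`, `-a - b`. -/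
def cornerDirections (x : P.Crossing) : Set (EuclideanSpace ℝ (Fin 3)) :=
  {v | ∃ s ∈ Set.Ico (0 : ℝ) 1, ∃ t ∈ Set.Ico (0 : ℝ) 1,
    s ≠ t ∧ P.curve s = x.1 ∧ P.curve t = x.1 ∧
    ∃ σ ∈ ({1, -1} : Set ℝ), ∃ τ ∈ ({1, -1} : Set ℝ),
      v = σ • deriv P.curve s + τ • deriv P.curve t}

/-- The corners at the crossing `x` (given by their directions) that belong to the region `R`, that
is, in whose direction all points of the surface close enough to `x` lie in `R`. -/
def cornersIn (x : P.Crossing) (R : P.Region) : Set (EuclideanSpace ℝ (Fin 3)) :=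
  {v ∈ P.cornerDirections x | ∀ᶠ ε : ℝ in 𝓝[>] 0, S.push (x.1 + ε • v) ∈ R.1}

/-- The region `R` touches the crossing `x` twice: two of the four corners at `x` belong to it. -/
def TouchesTwice (R : P.Region) (x : P.Crossing) : Prop :=
  (P.cornersIn x R).ncard = 2

open Classical in
/-- The region choice matrix of the single counting rule. -/
noncomputable def matrixD1 {ι κ : Type*} (x : ι → P.Crossing) (R : κ → P.Region) :
    Matrix ι κ ℤ :=
  Matrix.of fun i j => if (x i).1 ∈ P.boundary (R j) then 1 else 0

open Classical in
/-- The region choice matrix of the double counting rule. -/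
noncomputable def matrixD2 {ι κ : Type*} (x : ι → P.Crossing) (R : κ → P.Region) :
    Matrix ι κ ℤ :=
  Matrix.of fun i j => if P.TouchesTwice (R j) (x i) then 2 else P.matrixD1 x R i j

end KnotProjection

/-- A knot diagram: a knot projection with over/under information, that is, for each crossing the
parameter at which the overpassing strand runs through it. -/
structure KnotDiagram (S : DiagramSurface) extends KnotProjection S where
  overParam : toKnotProjection.Crossing → ℝ
  overParam_mem : ∀ x, overParam x ∈ Set.Ico (0 : ℝ) 1
  curve_overParam : ∀ x, curve (overParam x) = x.1

/-- The projection underlying a knot projection or a knot diagram. -/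
def underlyingProjection {S : DiagramSurface} :
    KnotProjection S ⊕ KnotDiagram S → KnotProjection S :=
  Sum.elim id KnotDiagram.toKnotProjection

/-! The curve is carried into the plane, on the sphere by stereographic projection from a point off
the curve. At a crossing `c` the curve returns to its starting point between the two passages, so
this piece is a closed loop. Its winding number is a function `W` of the regions that jumps by one
across the loop and does not change across the rest of the curve. Let `alt` be the alternating sum
over the four corners of a crossing. At a crossing `d ≠ c` each strand lies entirely on or entirely
off the loop, so its jumps before and after `d` cancel and `alt W d = 0`. At `c` only one half of
each strand is on the loop, so `alt W c = ±1`.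

Double counting: the winding number of the whole curve modulo 2 gives a checkerboard colouring `s =
±1`, and the plain corner sum of `s * W` is `± alt W`. Hence every unit vector is hit
(`exists_cornerSum_eq_single`).

Single counting: the corner sum has to be corrected by `doubledSum`, which only concerns crossings
where two opposite corners lie in one region. Such a crossing `c` interlaces with no other crossing
(`Doubled.fst_mem_iff`), so its `W` can be normalized to vanish on both sides of the curve off the
loop (`Doubled.exists_isWinding`). The resulting solution for `c` has errors only at doubled
crossings nested inside the loop, and induction on the parameter length of the loop removes them.
For any other crossing the double counting solution has errors at doubled crossings only, which are
already solved (`cornerSum_sub_doubledSum_surjective`).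

Number of regions: a rational function of the regions is determined by its alternating corner sums,
its jump across the curve at one parameter and its value there. If all alternating sums vanish, the
jump is constant along the curve, and a function without jumps is constant. The loop winding
numbers, the total winding number and the constants show that these `n + 2` data are arbitrary
(`evaluation_injective`, `evaluation_surjective`). -/

/-! ### Plane determinants and local charts spanned by two transverse curves. -/

/-- The determinant of two plane vectors. -/
def planeDet (u v : ℂ) : ℝ := u.re * v.im - u.im * v.re

lemma planeDet_swap (u v : ℂ) : planeDet v u = -planeDet u v := by
  simp only [planeDet]; ring

lemma planeDet_I_mul_pos {u : ℂ} (hu : u ≠ 0) : 0 < planeDet u (Complex.I * u) := by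
  have h : planeDet u (Complex.I * u) = Complex.normSq u := by
    simp [planeDet, Complex.normSq_apply]
  rw [h]
  exact Complex.normSq_pos.2 hu

lemma planeDet_add_right (u v w : ℂ) : planeDet u (v + w) = planeDet u v + planeDet u w := by
  simp [planeDet]; ring

lemma planeDet_add_left (u v w : ℂ) : planeDet (u + v) w = planeDet u w + planeDet v w := by
  simp [planeDet]; ring

lemma planeDet_neg_right (u v : ℂ) : planeDet u (-v) = -planeDet u v := by
  simp [planeDet]; ring

lemma planeDet_neg_left (u v : ℂ) : planeDet (-u) v = -planeDet u v := by
  simp [planeDet]; ring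

lemma planeDet_self (u : ℂ) : planeDet u u = 0 := by
  simp [planeDet]; ring

/-- The linear isomorphism with coordinate axes along two independent plane vectors. -/
noncomputable def planeFrame (u v : ℂ) (h : planeDet u v ≠ 0) : (ℝ × ℝ) ≃L[ℝ] ℂ :=
  LinearEquiv.toContinuousLinearEquiv
    { toFun := fun x => x.1 • u + x.2 • v
      map_add' := fun x y => by simp only [Prod.fst_add, Prod.snd_add, add_smul]; abel
      map_smul' := fun c x => by simp [mul_smul]
      invFun := fun z => (planeDet z v / planeDet u v, planeDet u z / planeDet u v)
      left_inv := fun x => by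
        ext
        · rw [div_eq_iff h]
          simp [planeDet]
          ring
        · rw [div_eq_iff h]
          simp [planeDet]
          ring
      right_inv := fun z => by
        apply Complex.ext
        · simp only [Complex.add_re, Complex.smul_re, smul_eq_mul]
          rw [div_mul_eq_mul_div, div_mul_eq_mul_div, ← add_div, div_eq_iff h]
          simp only [planeDet]
          ring
        · simp only [Complex.add_im, Complex.smul_im, smul_eq_mul]
          rw [div_mul_eq_mul_div, div_mul_eq_mul_div, ← add_div, div_eq_iff h]
          simp only [planeDet]
          ring }

lemma planeFrame_apply (u v : ℂ) (h : planeDet u v ≠ 0) (x : ℝ × ℝ) :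
    planeFrame u v h x = x.1 • u + x.2 • v := rfl

lemma hasStrictFDerivAt_curve_sum {g h : ℝ → ℂ} (hg : ContDiff ℝ 1 g) (hh : ContDiff ℝ 1 h)
    (p : ℂ) (x : ℝ × ℝ) (hx : planeDet (deriv g x.1) (deriv h x.2) ≠ 0) :
    HasStrictFDerivAt (fun x : ℝ × ℝ => g x.1 + h x.2 - p)
      (planeFrame (deriv g x.1) (deriv h x.2) hx : (ℝ × ℝ) →L[ℝ] ℂ) x := by
  have h1 : HasStrictDerivAt g (deriv g x.1) x.1 :=
    hg.contDiffAt.hasStrictDerivAt one_ne_zero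
  have h2 : HasStrictDerivAt h (deriv h x.2) x.2 :=
    hh.contDiffAt.hasStrictDerivAt one_ne_zero
  have h3 := (h1.hasStrictFDerivAt.comp x (hasStrictFDerivAt_fst (𝕜 := ℝ) (p := x))).add
    (h2.hasStrictFDerivAt.comp x (hasStrictFDerivAt_snd (𝕜 := ℝ) (p := x)))
  have h4 := h3.sub_const p
  refine h4.congr_fderiv ?_
  ext <;> simp [planeFrame_apply]

/-- Two curves crossing transversely at a point are the coordinate axes of a local chart. -/
theorem exists_cross_chart {g h : ℝ → ℂ} (hg : ContDiff ℝ 1 g) (hh : ContDiff ℝ 1 h)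
    (p : ℂ) (a b : ℝ) (hab : 0 < planeDet (deriv g a) (deriv h b)) :
    ∃ e : OpenPartialHomeomorph (ℝ × ℝ) ℂ, (∀ x, e x = g x.1 + h x.2 - p) ∧ (a, b) ∈ e.source ∧
      ∀ x ∈ e.source, 0 < planeDet (deriv g x.1) (deriv h x.2) := by
  have hs := hasStrictFDerivAt_curve_sum hg hh p (a, b) hab.ne'
  have ho : IsOpen {x : ℝ × ℝ | 0 < planeDet (deriv g x.1) (deriv h x.2)} := by
    have hg' := hg.continuous_deriv le_rfl
    have hh' := hh.continuous_deriv le_rfl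
    refine isOpen_lt continuous_const ?_
    unfold planeDet
    fun_prop
  -- The chart of the inverse function theorem is shrunk so that the orientation stays positive at
  -- every point, not only at the crossing.
  refine ⟨(hs.toOpenPartialHomeomorph _).restrOpen _ ho, fun x => rfl, ?_, fun x hx => ?_⟩
  · rw [OpenPartialHomeomorph.restrOpen_source]
    exact ⟨hs.mem_toOpenPartialHomeomorph_source, hab⟩
  · rw [OpenPartialHomeomorph.restrOpen_source] at hx
    exact hx.2

lemma HasDerivAt.eventually_pos_right {k : ℝ → ℝ} {d a : ℝ} (h : HasDerivAt k d 0) (hd : 0 < d)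
    (h0 : k 0 = a) : ∀ᶠ ε in 𝓝[>] (0 : ℝ), a < k ε := by
  subst h0
  have h1 := (hasDerivAt_iff_tendsto_slope.1 h).mono_left
    (nhdsWithin_mono (0 : ℝ) (fun x (hx : 0 < x) => ne_of_gt hx))
  filter_upwards [h1.eventually (lt_mem_nhds hd), self_mem_nhdsWithin] with ε h2 h3
  have h3' : 0 < ε := h3
  rw [slope_def_field, sub_zero] at h2
  have := (div_pos_iff_of_pos_right h3').1 h2
  linarith

lemma HasDerivAt.eventually_neg_right {k : ℝ → ℝ} {d a : ℝ} (h : HasDerivAt k d 0) (hd : d < 0)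
    (h0 : k 0 = a) : ∀ᶠ ε in 𝓝[>] (0 : ℝ), k ε < a := by
  have := h.neg.eventually_pos_right (neg_pos.2 hd) (a := -a) (by simp [h0])
  filter_upwards [this] with ε hε
  simpa using hε

section CrossChart

variable {g h : ℝ → ℂ} (hg : ContDiff ℝ 1 g) (hh : ContDiff ℝ 1 h) {p : ℂ}
  {e : OpenPartialHomeomorph (ℝ × ℝ) ℂ} (he : ∀ x, e x = g x.1 + h x.2 - p)
  (hpos : ∀ x ∈ e.source, 0 < planeDet (deriv g x.1) (deriv h x.2))
  {x : ℝ × ℝ} (hx : x ∈ e.source) {c : ℝ → ℂ} {v : ℂ} (hc0 : c 0 = e x) (hc : HasDerivAt c v 0)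
include hg hh he hpos hx hc0 hc

/-- Cramer's rule for the inverse of `planeFrame`. The signs of the two determinants decide on which
side of each coordinate line a curve leaves. -/
lemma hasDerivAt_cross_chart_symm :
    HasDerivAt (fun ε => e.symm (c ε)) (planeDet v (deriv h x.2) / planeDet (deriv g x.1)
      (deriv h x.2), planeDet (deriv g x.1) v / planeDet (deriv g x.1) (deriv h x.2)) 0 := by
  have h1 := hasStrictFDerivAt_curve_sum hg hh p x (hpos x hx).ne'
  have h2 : HasFDerivAt e (planeFrame (deriv g x.1) (deriv h x.2) (hpos x hx).ne' :
      (ℝ × ℝ) →L[ℝ] ℂ) (e.symm (e x)) := by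
    rw [e.left_inv hx]
    exact h1.hasFDerivAt.congr_of_eventuallyEq (Eventually.of_forall he)
  have h3 := e.hasFDerivAt_symm (e.map_source hx) h2
  rw [← hc0] at h3
  exact h3.comp_hasDerivAt 0 hc

lemma eventually_fst_gt (hv : 0 < planeDet v (deriv h x.2)) :
    ∀ᶠ ε in 𝓝[>] (0 : ℝ), x.1 < (e.symm (c ε)).1 :=
  HasDerivAt.eventually_pos_right
    (hasFDerivAt_fst.comp_hasDerivAt 0 (hasDerivAt_cross_chart_symm hg hh he hpos hx hc0 hc))
    (div_pos hv (hpos x hx)) (by simp [hc0, e.left_inv hx])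

lemma eventually_fst_lt (hv : planeDet v (deriv h x.2) < 0) :
    ∀ᶠ ε in 𝓝[>] (0 : ℝ), (e.symm (c ε)).1 < x.1 :=
  HasDerivAt.eventually_neg_right
    (hasFDerivAt_fst.comp_hasDerivAt 0 (hasDerivAt_cross_chart_symm hg hh he hpos hx hc0 hc))
    (div_neg_of_neg_of_pos hv (hpos x hx)) (by simp [hc0, e.left_inv hx])

lemma eventually_snd_gt (hv : 0 < planeDet (deriv g x.1) v) :
    ∀ᶠ ε in 𝓝[>] (0 : ℝ), x.2 < (e.symm (c ε)).2 :=
  HasDerivAt.eventually_pos_right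
    (hasFDerivAt_snd.comp_hasDerivAt 0 (hasDerivAt_cross_chart_symm hg hh he hpos hx hc0 hc))
    (div_pos hv (hpos x hx)) (by simp [hc0, e.left_inv hx])

lemma eventually_snd_lt (hv : planeDet (deriv g x.1) v < 0) :
    ∀ᶠ ε in 𝓝[>] (0 : ℝ), (e.symm (c ε)).2 < x.2 :=
  HasDerivAt.eventually_neg_right
    (hasFDerivAt_snd.comp_hasDerivAt 0 (hasDerivAt_cross_chart_symm hg hh he hpos hx hc0 hc))
    (div_neg_of_neg_of_pos hv (hpos x hx)) (by simp [hc0, e.left_inv hx])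

omit hg hh he hpos in
lemma eventually_mem_cross_chart {O : Set (ℝ × ℝ)} (hO : IsOpen O) (hxO : x ∈ O) :
    ∀ᶠ ε in 𝓝[>] (0 : ℝ), c ε ∈ e.target ∧ e.symm (c ε) ∈ O := by
  have h1 : Tendsto c (𝓝[>] 0) (𝓝 (e x)) := by
    rw [← hc0]
    exact hc.continuousAt.tendsto.mono_left nhdsWithin_le_nhds
  have h2 : ∀ᶠ z in 𝓝 (e x), z ∈ e.target ∧ e.symm z ∈ O := by
    refine Filter.Eventually.and (e.open_target.mem_nhds (e.map_source hx)) ?_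
    have := (e.continuousAt_symm (e.map_source hx)).tendsto
    rw [e.left_inv hx] at this
    exact this (hO.mem_nhds hxO)
  exact h1 h2

end CrossChart

/-! ### Locally constant functions off a set and their germs in a direction. -/

/-- `f` is locally constant on the complement of the closed set `K`. -/
def LocallyConstOff {X α : Type*} [TopologicalSpace X] (K : Set X) (f : X → α) : Prop :=
  ∀ z, z ∉ K → ∀ᶠ w in 𝓝 z, f w = f z

lemma IsPreconnected.eq_of_eventually_eq {X α : Type*} [TopologicalSpace X] {s : Set X}
    (hs : IsPreconnected s) {f : X → α} (hf : ∀ z ∈ s, ∀ᶠ w in 𝓝[s] z, f w = f z) {x y : X}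
    (hx : x ∈ s) (hy : y ∈ s) : f x = f y := by
  have : PreconnectedSpace s := isPreconnected_iff_preconnectedSpace.1 hs
  have h : IsLocallyConstant (fun z : s => f z) := by
    rw [IsLocallyConstant.iff_eventually_eq]
    exact fun z => (tendsto_nhdsWithin_iff.2 ⟨continuous_subtype_val.continuousAt,
      Eventually.of_forall fun w => w.2⟩).eventually (hf z z.2)
  exact h.apply_eq_of_preconnectedSpace (⟨x, hx⟩ : s) ⟨y, hy⟩

/-- A function on a dense subset of a connected open set that is constant near every point is
constant. -/
lemma IsPreconnected.eq_of_locally_const_dense {X α : Type*} [TopologicalSpace X] {s U : Set X}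
    (hs : IsPreconnected s) (hso : IsOpen s) (hU : Dense U) {f : X → α}
    (hf : ∀ x ∈ s, ∃ y, ∀ᶠ z in 𝓝 x, z ∈ U → f z = y) {x y : X} (hx : x ∈ s ∩ U)
    (hy : y ∈ s ∩ U) : f x = f y := by
  have : Nonempty α := ⟨f x⟩
  have hf' : ∀ x, ∃ y, x ∈ s → ∀ᶠ z in 𝓝 x, z ∈ U → f z = y := fun x => by
    by_cases h : x ∈ s
    · obtain ⟨y, hy⟩ := hf x h
      exact ⟨y, fun _ => hy⟩
    · exact ⟨Classical.arbitrary α, fun h' => absurd h' h⟩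
  choose F hF using hf'
  have hFU : ∀ x ∈ s ∩ U, f x = F x := fun x hx => (hF x hx.1).self_of_nhds hx.2
  rw [hFU x hx, hFU y hy]
  refine hs.eq_of_eventually_eq (fun z hz => mem_nhdsWithin_of_mem_nhds ?_) hx.1 hy.1
  filter_upwards [(hF z hz).eventually_nhds, hso.mem_nhds hz] with w hw hws
  -- The local values at `z` and at a nearby `w` are both attained at a common point of the dense
  -- set close to `w`.
  obtain ⟨u, hu, hu1, hu2⟩ := ((mem_closure_iff_frequently.1 (hU w)).and_eventually
    (hw.and (hF w hws))).exists
  rw [← hu1 hu, ← hu2 hu]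

/-- Along every curve leaving `p` in the direction `v`, the function `f` is at first equal to `y`
(and the curve at first avoids `K`). -/
def HasGerm {α : Type*} (K : Set ℂ) (f : ℂ → α) (p v : ℂ) (y : α) : Prop :=
  ∀ c : ℝ → ℂ, c 0 = p → HasDerivAt c v 0 → ∀ᶠ ε in 𝓝[>] (0 : ℝ), c ε ∉ K ∧ f (c ε) = y

lemma hasDerivAt_line (p v : ℂ) : HasDerivAt (fun ε : ℝ => p + ε • v) v 0 := by
  simpa using ((hasDerivAt_id (0 : ℝ)).smul_const v).const_add p

lemma HasGerm.line {α : Type*} {K : Set ℂ} {f : ℂ → α} {p v : ℂ} {y : α} (h : HasGerm K f p v y) :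
    ∀ᶠ ε : ℝ in 𝓝[>] (0 : ℝ), p + ε • v ∉ K ∧ f (p + ε • v) = y :=
  h _ (by simp) (hasDerivAt_line p v)

lemma HasGerm.unique {α : Type*} {K : Set ℂ} {f : ℂ → α} {p v : ℂ} {y y' : α}
    (h : HasGerm K f p v y) (h' : HasGerm K f p v y') : y = y' := by
  obtain ⟨ε, h1, h2⟩ := (h.line.and h'.line).exists
  rw [← h1.2, ← h2.2]

lemma HasGerm.mem_closure {α : Type*} {K : Set ℂ} {f : ℂ → α} {p v : ℂ} {y : α}
    (h : HasGerm K f p v y) : p ∈ closure Kᶜ := by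
  have h1 : Tendsto (fun ε : ℝ => p + ε • v) (𝓝[>] 0) (𝓝 p) := by
    have := (hasDerivAt_line p v).continuousAt.tendsto
    simp only [zero_smul, add_zero] at this
    exact this.mono_left nhdsWithin_le_nhds
  exact mem_closure_of_tendsto h1 (h.line.mono fun _ hx => hx.1)

lemma exists_const_on_image {α : Type*} {K : Set ℂ} {f : ℂ → α} (hf : LocallyConstOff K f)
    (e : OpenPartialHomeomorph (ℝ × ℝ) ℂ) {Q : Set (ℝ × ℝ)} (hQ : Convex ℝ Q)
    (hQe : Q ⊆ e.source) (hQK : ∀ x ∈ Q, e x ∉ K) : ∃ y, ∀ x ∈ Q, e x ∉ K ∧ f (e x) = y := by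
  rcases Q.eq_empty_or_nonempty with rfl | ⟨x₀, hx₀⟩
  · exact ⟨f 0, by simp⟩
  · refine ⟨f (e x₀), fun x hx => ⟨hQK x hx, ?_⟩⟩
    have h1 : IsPreconnected (e '' Q) := hQ.isPreconnected.image _ (e.continuousOn.mono hQe)
    refine h1.eq_of_eventually_eq ?_ ⟨x, hx, rfl⟩ ⟨x₀, hx₀, rfl⟩
    rintro _ ⟨z, hz, rfl⟩
    exact mem_nhdsWithin_of_mem_nhds (hf _ (hQK z hz))

/-- Germs are tested on all differentiable curves, not just on segments, because a segment pushed
onto the surface becomes a curve in the plane chart. -/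
lemma hasGerm_of_chart {α : Type*} {K : Set ℂ} {f : ℂ → α}
    {e : OpenPartialHomeomorph (ℝ × ℝ) ℂ} {Q : Set (ℝ × ℝ)} {y : α}
    (hQ : ∀ x ∈ Q, e x ∉ K ∧ f (e x) = y) {p v : ℂ}
    (hev : ∀ c : ℝ → ℂ, c 0 = p → HasDerivAt c v 0 → ∀ᶠ ε in 𝓝[>] (0 : ℝ),
      c ε ∈ e.target ∧ e.symm (c ε) ∈ Q) : HasGerm K f p v y := by
  intro c h0 hc
  filter_upwards [hev c h0 hc] with ε hε
  have := hQ _ hε.2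
  rwa [e.right_inv hε.1] at this

/-! ### Local structure of a plane loop at simple points and at crossings. -/

/-- A regular closed plane curve with at most double, transverse self-intersections. -/
structure PlanarLoop where
  γ : ℝ → ℂ
  periodic : Function.Periodic γ 1
  contDiff : ContDiff ℝ 1 γ
  immersed : ∀ t, deriv γ t ≠ 0
  atMostDouble : ∀ r s t, γ r = γ s → γ s = γ t →
    (∃ k : ℤ, r = s + k) ∨ (∃ k : ℤ, s = t + k) ∨ (∃ k : ℤ, r = t + k)
  transverse : ∀ s t, γ s = γ t → (∀ k : ℤ, s ≠ t + k) → planeDet (deriv γ s) (deriv γ t) ≠ 0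

namespace PlanarLoop

variable (Γ : PlanarLoop)

/-- The image of the curve. -/
def image : Set ℂ := Set.range Γ.γ

/-- The parameters of the points that are not crossings. -/
def simpleParams : Set ℝ := {t | ∀ r, Γ.γ r = Γ.γ t → ∃ k : ℤ, r = t + k}

lemma apply_add_int (t : ℝ) (k : ℤ) : Γ.γ (t + k) = Γ.γ t := by
  simpa using Γ.periodic.int_mul k t

lemma apply_sub_int (t : ℝ) (k : ℤ) : Γ.γ (t - k) = Γ.γ t := by
  simpa using Γ.periodic.sub_int_mul_eq k (x := t)

lemma deriv_add_int (t : ℝ) (k : ℤ) : deriv Γ.γ (t + k) = deriv Γ.γ t := by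
  rw [← deriv_comp_add_const]
  congr 1
  ext t
  exact Γ.apply_add_int t k

/-- By compactness: the parameters in `[0, 1]` at distance at least `δ` from all preimages of `p`
have a closed image, which misses `p`. -/
lemma eventually_near_params (p : ℂ) {δ : ℝ} (hδ : 0 < δ) :
    ∀ᶠ z in 𝓝 p, ∀ t, Γ.γ t = z → ∃ t', Γ.γ t' = p ∧ |t - t'| < δ := by
  set A : Set ℝ := Set.Icc 0 1 ∩ ⋂ t' ∈ {t' | Γ.γ t' = p}, {t | δ ≤ |t - t'|} with hA
  have hAc : IsCompact A := by
    refine isCompact_Icc.inter_right (isClosed_biInter fun t' _ => ?_)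
    exact isClosed_le continuous_const (by fun_prop)
  have hp : p ∉ Γ.γ '' A := by
    rintro ⟨t, ht, rfl⟩
    have := Set.mem_iInter₂.1 ht.2 t rfl
    simp only [Set.mem_ofPred_eq, sub_self, abs_zero] at this
    linarith
  have hcl := (hAc.image Γ.contDiff.continuous).isClosed
  filter_upwards [hcl.isOpen_compl.mem_nhds hp] with z hz t ht
  by_contra! hcon
  refine hz ⟨Int.fract t, ⟨⟨Int.fract_nonneg t, (Int.fract_lt_one t).le⟩, ?_⟩, ?_⟩
  · refine Set.mem_iInter₂.2 fun t' ht' => ?_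
    have h1 := hcon (t' + ⌊t⌋) (by rw [Γ.apply_add_int]; exact ht')
    have h2 : t - (t' + ⌊t⌋) = Int.fract t - t' := by rw [← Int.self_sub_floor]; ring
    rwa [h2] at h1
  · rw [← Int.self_sub_floor, Γ.apply_sub_int, ht]

/-- This excludes stray strands in a small box. A passage `t` through the box is close to a preimage
`t'` of the centre, so the shift `t - t'` along either axis stays in the source, where injectivity
of `e` can be applied. -/
lemma exists_box {e : OpenPartialHomeomorph (ℝ × ℝ) ℂ} {a b : ℝ} (hab : (a, b) ∈ e.source) :
    ∃ δ > 0, Set.Ioo (a - δ) (a + δ) ×ˢ Set.Ioo (b - δ) (b + δ) ⊆ e.source ∧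
      ∀ x ∈ Set.Ioo (a - δ) (a + δ) ×ˢ Set.Ioo (b - δ) (b + δ),
        ∀ t, Γ.γ t = e x → ∃ t', Γ.γ t' = e (a, b) ∧
          (t - t' + a, b) ∈ e.source ∧ (a, t - t' + b) ∈ e.source := by
  have key : ∀ N ∈ 𝓝 (a, b), ∃ δ > 0,
      Set.Ioo (a - δ) (a + δ) ×ˢ Set.Ioo (b - δ) (b + δ) ⊆ N := by
    intro N hN
    obtain ⟨δ, h1, h2⟩ := Metric.mem_nhds_iff.1 hN
    refine ⟨δ, h1, ?_⟩
    rwa [← Real.ball_eq_Ioo, ← Real.ball_eq_Ioo, ball_prod_same]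
  obtain ⟨δ, hδ, hδe⟩ := key _ (e.open_source.mem_nhds hab)
  have h1 := (e.continuousAt hab).eventually (Γ.eventually_near_params (e (a, b)) hδ)
  obtain ⟨δ', hδ', h2⟩ := key _ (Filter.inter_mem (e.open_source.mem_nhds hab) h1)
  refine ⟨δ', hδ', fun x hx => (h2 hx).1, fun x hx t ht => ?_⟩
  obtain ⟨t', h3, h4⟩ := (h2 hx).2 t ht
  rw [abs_lt] at h4
  refine ⟨t', h3, hδe ⟨⟨?_, ?_⟩, ⟨?_, ?_⟩⟩, hδe ⟨⟨?_, ?_⟩, ⟨?_, ?_⟩⟩⟩ <;> simp only <;> linarith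

/-- The structure of a locally constant function on the complement of the curve near a point that
is not a crossing. -/
theorem exists_sides {α : Type*} {f : ℂ → α} (hf : LocallyConstOff Γ.image f) {t : ℝ}
    (ht : t ∈ Γ.simpleParams) : ∃ yl yr : α,
    (∀ᶠ a in 𝓝 t, a ∈ Γ.simpleParams ∧
      HasGerm Γ.image f (Γ.γ a) (Complex.I * deriv Γ.γ a) yl ∧
      HasGerm Γ.image f (Γ.γ a) (-(Complex.I * deriv Γ.γ a)) yr) ∧
    ∀ᶠ z in 𝓝 (Γ.γ t), z ∉ Γ.image → f z = yl ∨ f z = yr := by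
  -- At a simple point there is no second strand, so the normal line serves as the second axis.
  set h : ℝ → ℂ := fun b => Γ.γ t + b • (Complex.I * deriv Γ.γ t) with hh
  have hhd : ∀ b, deriv h b = Complex.I * deriv Γ.γ t := fun b => by
    have := ((hasDerivAt_id b).smul_const (Complex.I * deriv Γ.γ t)).const_add (Γ.γ t)
    exact this.deriv.trans (one_smul ℝ _)
  have hhc : ContDiff ℝ 1 h := by fun_prop
  obtain ⟨e, he, hst, hpos⟩ := exists_cross_chart Γ.contDiff hhc (Γ.γ t) t 0
    (by rw [hhd]; exact planeDet_I_mul_pos (Γ.immersed t))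
  have he0 : ∀ a, e (a, 0) = Γ.γ a := fun a => by rw [he]; simp [hh]
  obtain ⟨δ, hδ, hB, hnear⟩ := Γ.exists_box hst
  set B := Set.Ioo (t - δ) (t + δ) ×ˢ Set.Ioo (0 - δ) (0 + δ) with hBdef
  have hBo : IsOpen B := isOpen_Ioo.prod isOpen_Ioo
  have hBc : Convex ℝ B := (convex_Ioo _ _).prod (convex_Ioo _ _)
  have hax : ∀ x ∈ B, ∀ r, Γ.γ r = e x → x.2 = 0 ∧ ∃ k : ℤ, r = x.1 + k := by
    intro x hx r hr
    obtain ⟨t', h1, h2, -⟩ := hnear x hx r hr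
    rw [he0] at h1
    obtain ⟨k, rfl⟩ := ht t' h1
    have h3 : e (r - (t + k) + t, 0) = e x := by
      rw [he0, ← hr, show r - (t + k) + t = r - k by ring, Γ.apply_sub_int]
    have h4 := e.injOn h2 (hB hx) h3
    exact ⟨by rw [← h4], k, by rw [← h4]; ring⟩
  have hup : Convex ℝ (B ∩ {x | 0 < x.2}) :=
    hBc.inter (convex_halfSpace_gt (LinearMap.snd ℝ ℝ ℝ).isLinear 0)
  have hdown : Convex ℝ (B ∩ {x | x.2 < 0}) :=
    hBc.inter (convex_halfSpace_lt (LinearMap.snd ℝ ℝ ℝ).isLinear 0)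
  obtain ⟨yl, hyl⟩ := exists_const_on_image hf e hup (fun x hx => hB hx.1)
    (fun x hx ⟨r, hr⟩ => hx.2.ne' (hax x hx.1 r hr).1)
  obtain ⟨yr, hyr⟩ := exists_const_on_image hf e hdown (fun x hx => hB hx.1)
    (fun x hx ⟨r, hr⟩ => hx.2.ne (hax x hx.1 r hr).1)
  refine ⟨yl, yr, ?_, ?_⟩
  · filter_upwards [Ioo_mem_nhds (sub_lt_self t hδ) (lt_add_of_pos_right t hδ)] with a ha
    have haB : (a, (0 : ℝ)) ∈ B := ⟨ha, by constructor <;> simp [hδ]⟩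
    refine ⟨fun r hr => ?_, ?_, ?_⟩
    · rw [← he0 a] at hr
      exact (hax _ haB r hr).2
    · refine hasGerm_of_chart hyl fun c h0 hc => ?_
      rw [← he0] at h0
      filter_upwards [eventually_mem_cross_chart (hB haB) h0 hc hBo haB,
        eventually_snd_gt Γ.contDiff hhc he hpos (hB haB) h0 hc
          (planeDet_I_mul_pos (Γ.immersed a))] with ε h1 h2
      exact ⟨h1.1, h1.2, h2⟩
    · refine hasGerm_of_chart hyr fun c h0 hc => ?_
      rw [← he0] at h0
      filter_upwards [eventually_mem_cross_chart (hB haB) h0 hc hBo haB,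
        eventually_snd_lt Γ.contDiff hhc he hpos (hB haB) h0 hc
          (by rw [planeDet_neg_right]; exact neg_neg_of_pos (planeDet_I_mul_pos (Γ.immersed a)))]
        with ε h1 h2
      exact ⟨h1.1, h1.2, h2⟩
  · have hBt : (t, (0 : ℝ)) ∈ B := by constructor <;> constructor <;> simp [hδ]
    have := e.image_mem_nhds (hB hBt) (hBo.mem_nhds hBt)
    rw [he0] at this
    filter_upwards [this]
    rintro _ ⟨x, hx, rfl⟩ hxK
    rcases lt_trichotomy x.2 0 with h1 | h1 | h1
    · exact Or.inr (hyr x ⟨hx, h1⟩).2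
    · refine absurd ⟨x.1, ?_⟩ hxK
      rw [← he0, ← h1]
    · exact Or.inl (hyl x ⟨hx, h1⟩).2

/-- The structure of a locally constant function on the complement of the curve near a crossing:
its values in the four corners, and the corners on both sides of the four half strands. -/
theorem exists_corners {α : Type*} {f : ℂ → α} (hf : LocallyConstOff Γ.image f) {s t : ℝ}
    (hst : Γ.γ s = Γ.γ t) (hdet : 0 < planeDet (deriv Γ.γ s) (deriv Γ.γ t)) :
    ∃ ypp ypm ymp ymm : α,
    (∀ᶠ a in 𝓝[>] s, a ∈ Γ.simpleParams ∧
      HasGerm Γ.image f (Γ.γ a) (Complex.I * deriv Γ.γ a) ypp ∧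
      HasGerm Γ.image f (Γ.γ a) (-(Complex.I * deriv Γ.γ a)) ypm) ∧
    (∀ᶠ a in 𝓝[<] s, a ∈ Γ.simpleParams ∧
      HasGerm Γ.image f (Γ.γ a) (Complex.I * deriv Γ.γ a) ymp ∧
      HasGerm Γ.image f (Γ.γ a) (-(Complex.I * deriv Γ.γ a)) ymm) ∧
    (∀ᶠ a in 𝓝[>] t, a ∈ Γ.simpleParams ∧
      HasGerm Γ.image f (Γ.γ a) (Complex.I * deriv Γ.γ a) ymp ∧
      HasGerm Γ.image f (Γ.γ a) (-(Complex.I * deriv Γ.γ a)) ypp) ∧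
    (∀ᶠ a in 𝓝[<] t, a ∈ Γ.simpleParams ∧
      HasGerm Γ.image f (Γ.γ a) (Complex.I * deriv Γ.γ a) ymm ∧
      HasGerm Γ.image f (Γ.γ a) (-(Complex.I * deriv Γ.γ a)) ypm) ∧
    HasGerm Γ.image f (Γ.γ s) (deriv Γ.γ s + deriv Γ.γ t) ypp ∧
    HasGerm Γ.image f (Γ.γ s) (deriv Γ.γ s - deriv Γ.γ t) ypm ∧
    HasGerm Γ.image f (Γ.γ s) (-deriv Γ.γ s + deriv Γ.γ t) ymp ∧
    HasGerm Γ.image f (Γ.γ s) (-deriv Γ.γ s - deriv Γ.γ t) ymm ∧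
    ∀ᶠ z in 𝓝 (Γ.γ s), z ∉ Γ.image → f z = ypp ∨ f z = ypm ∨ f z = ymp ∨ f z = ymm := by
  have hne : ∀ k : ℤ, s ≠ t + k := by
    rintro k rfl
    rw [Γ.deriv_add_int, planeDet_self] at hdet
    exact lt_irrefl _ hdet
  obtain ⟨e, he, hste, hpos⟩ := exists_cross_chart Γ.contDiff Γ.contDiff (Γ.γ s) s t hdet
  have he1 : ∀ a, e (a, t) = Γ.γ a := fun a => by rw [he, hst]; simp
  have he2 : ∀ a, e (s, a) = Γ.γ a := fun a => by rw [he]; simp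
  obtain ⟨δ, hδ, hB, hnear⟩ := Γ.exists_box hste
  set B := Set.Ioo (s - δ) (s + δ) ×ˢ Set.Ioo (t - δ) (t + δ) with hBdef
  have hBo : IsOpen B := isOpen_Ioo.prod isOpen_Ioo
  have hBc : Convex ℝ B := (convex_Ioo _ _).prod (convex_Ioo _ _)
  have hax : ∀ x ∈ B, ∀ r, Γ.γ r = e x →
      (x.2 = t ∧ ∃ k : ℤ, r = x.1 + k) ∨ (x.1 = s ∧ ∃ k : ℤ, r = x.2 + k) := by
    intro x hx r hr
    obtain ⟨t', h1, h2, h2'⟩ := hnear x hx r hr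
    rw [he1] at h1
    -- A nearby passage belongs to one of the two strands, and injectivity of the chart puts the
    -- point on the corresponding axis.
    rcases Γ.atMostDouble t' s t h1 hst with ⟨k, rfl⟩ | ⟨k, hk⟩ | ⟨k, rfl⟩
    · have h3 : e (r - (s + k) + s, t) = e x := by
        rw [he1, ← hr, show r - (s + k) + s = r - k by ring, Γ.apply_sub_int]
      have h4 := e.injOn h2 (hB hx) h3
      exact Or.inl ⟨by rw [← h4], k, by rw [← h4]; ring⟩
    · exact absurd hk (hne k)
    · have h3 : e (s, r - (t + k) + t) = e x := by
        rw [he2, ← hr, show r - (t + k) + t = r - k by ring, Γ.apply_sub_int]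
      have h4 := e.injOn h2' (hB hx) h3
      exact Or.inr ⟨by rw [← h4], k, by rw [← h4]; ring⟩
  have hc1 : Convex ℝ {x : ℝ × ℝ | s < x.1} :=
    convex_halfSpace_gt (LinearMap.fst ℝ ℝ ℝ).isLinear s
  have hc2 : Convex ℝ {x : ℝ × ℝ | x.1 < s} :=
    convex_halfSpace_lt (LinearMap.fst ℝ ℝ ℝ).isLinear s
  have hc3 : Convex ℝ {x : ℝ × ℝ | t < x.2} :=
    convex_halfSpace_gt (LinearMap.snd ℝ ℝ ℝ).isLinear t
  have hc4 : Convex ℝ {x : ℝ × ℝ | x.2 < t} :=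
    convex_halfSpace_lt (LinearMap.snd ℝ ℝ ℝ).isLinear t
  have ho1 : IsOpen (B ∩ {x : ℝ × ℝ | s < x.1}) :=
    hBo.inter (isOpen_lt continuous_const continuous_fst)
  have ho2 : IsOpen (B ∩ {x : ℝ × ℝ | x.1 < s}) :=
    hBo.inter (isOpen_lt continuous_fst continuous_const)
  have ho3 : IsOpen (B ∩ {x : ℝ × ℝ | t < x.2}) :=
    hBo.inter (isOpen_lt continuous_const continuous_snd)
  have ho4 : IsOpen (B ∩ {x : ℝ × ℝ | x.2 < t}) :=
    hBo.inter (isOpen_lt continuous_snd continuous_const)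
  have hoff : ∀ x ∈ B, x.1 ≠ s → x.2 ≠ t → e x ∉ Γ.image := by
    rintro x hx h1 h2 ⟨r, hr⟩
    rcases hax x hx r hr with h | h
    exacts [h2 h.1, h1 h.1]
  obtain ⟨ypp, hpp⟩ := exists_const_on_image hf e ((hBc.inter hc1).inter hc3)
    (fun x hx => hB hx.1.1) (fun x hx => hoff x hx.1.1 hx.1.2.ne' hx.2.ne')
  obtain ⟨ypm, hpm⟩ := exists_const_on_image hf e ((hBc.inter hc1).inter hc4)
    (fun x hx => hB hx.1.1) (fun x hx => hoff x hx.1.1 hx.1.2.ne' hx.2.ne)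
  obtain ⟨ymp, hmp⟩ := exists_const_on_image hf e ((hBc.inter hc2).inter hc3)
    (fun x hx => hB hx.1.1) (fun x hx => hoff x hx.1.1 hx.1.2.ne hx.2.ne')
  obtain ⟨ymm, hmm⟩ := exists_const_on_image hf e ((hBc.inter hc2).inter hc4)
    (fun x hx => hB hx.1.1) (fun x hx => hoff x hx.1.1 hx.1.2.ne hx.2.ne)
  have hI : ∀ a, 0 < planeDet (deriv Γ.γ a) (Complex.I * deriv Γ.γ a) := fun a =>
    planeDet_I_mul_pos (Γ.immersed a)
  have hI' : ∀ a, planeDet (deriv Γ.γ a) (-(Complex.I * deriv Γ.γ a)) < 0 := fun a => by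
    rw [planeDet_neg_right]; exact neg_neg_of_pos (hI a)
  have hJ : ∀ a, planeDet (Complex.I * deriv Γ.γ a) (deriv Γ.γ a) < 0 := fun a => by
    rw [planeDet_swap]; exact neg_neg_of_pos (hI a)
  have hJ' : ∀ a, 0 < planeDet (-(Complex.I * deriv Γ.γ a)) (deriv Γ.γ a) := fun a => by
    rw [planeDet_neg_left]; exact neg_pos.2 (hJ a)
  have hsB : ∀ a ∈ Set.Ioo (s - δ) (s + δ), (a, t) ∈ B := fun a ha =>
    ⟨ha, by constructor <;> simp [hδ]⟩
  have htB : ∀ a ∈ Set.Ioo (t - δ) (t + δ), (s, a) ∈ B := fun a ha =>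
    ⟨by constructor <;> simp [hδ], ha⟩
  have hBst : (s, t) ∈ B := hsB s (by constructor <;> simp [hδ])
  have hs1 : ∀ a, (a, t) ∈ B → a ≠ s → a ∈ Γ.simpleParams := fun a ha h r hr => by
    rw [← he1 a] at hr
    rcases hax _ ha r hr with h' | h'
    exacts [h'.2, absurd h'.1 h]
  have hs2 : ∀ a, (s, a) ∈ B → a ≠ t → a ∈ Γ.simpleParams := fun a ha h r hr => by
    rw [← he2 a] at hr
    rcases hax _ ha r hr with h' | h'
    exacts [absurd h'.1 h, h'.2]
  refine ⟨ypp, ypm, ymp, ymm, ?_, ?_, ?_, ?_, ?_, ?_, ?_, ?_, ?_⟩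
  · filter_upwards [Ioo_mem_nhdsGT (lt_add_of_pos_right s hδ)] with a ha
    have haB := hsB a ⟨by linarith [ha.1], ha.2⟩
    refine ⟨hs1 a haB ha.1.ne', ?_, ?_⟩
    · refine hasGerm_of_chart hpp fun c h0 hc => ?_
      rw [← he1] at h0
      filter_upwards [eventually_mem_cross_chart (hB haB) h0 hc ho1 ⟨haB, ha.1⟩,
        eventually_snd_gt Γ.contDiff Γ.contDiff he hpos (hB haB) h0 hc (hI a)] with ε h1 h2
      exact ⟨h1.1, h1.2, h2⟩
    · refine hasGerm_of_chart hpm fun c h0 hc => ?_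
      rw [← he1] at h0
      filter_upwards [eventually_mem_cross_chart (hB haB) h0 hc ho1 ⟨haB, ha.1⟩,
        eventually_snd_lt Γ.contDiff Γ.contDiff he hpos (hB haB) h0 hc (hI' a)] with ε h1 h2
      exact ⟨h1.1, h1.2, h2⟩
  · filter_upwards [Ioo_mem_nhdsLT (sub_lt_self s hδ)] with a ha
    have haB := hsB a ⟨ha.1, by linarith [ha.2]⟩
    refine ⟨hs1 a haB ha.2.ne, ?_, ?_⟩
    · refine hasGerm_of_chart hmp fun c h0 hc => ?_
      rw [← he1] at h0
      filter_upwards [eventually_mem_cross_chart (hB haB) h0 hc ho2 ⟨haB, ha.2⟩,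
        eventually_snd_gt Γ.contDiff Γ.contDiff he hpos (hB haB) h0 hc (hI a)] with ε h1 h2
      exact ⟨h1.1, h1.2, h2⟩
    · refine hasGerm_of_chart hmm fun c h0 hc => ?_
      rw [← he1] at h0
      filter_upwards [eventually_mem_cross_chart (hB haB) h0 hc ho2 ⟨haB, ha.2⟩,
        eventually_snd_lt Γ.contDiff Γ.contDiff he hpos (hB haB) h0 hc (hI' a)] with ε h1 h2
      exact ⟨h1.1, h1.2, h2⟩
  · filter_upwards [Ioo_mem_nhdsGT (lt_add_of_pos_right t hδ)] with a ha
    have haB := htB a ⟨by linarith [ha.1], ha.2⟩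
    refine ⟨hs2 a haB ha.1.ne', ?_, ?_⟩
    · refine hasGerm_of_chart hmp fun c h0 hc => ?_
      rw [← he2] at h0
      filter_upwards [eventually_mem_cross_chart (hB haB) h0 hc ho3 ⟨haB, ha.1⟩,
        eventually_fst_lt Γ.contDiff Γ.contDiff he hpos (hB haB) h0 hc (hJ a)] with ε h1 h2
      exact ⟨h1.1, ⟨h1.2.1, h2⟩, h1.2.2⟩
    · refine hasGerm_of_chart hpp fun c h0 hc => ?_
      rw [← he2] at h0
      filter_upwards [eventually_mem_cross_chart (hB haB) h0 hc ho3 ⟨haB, ha.1⟩,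
        eventually_fst_gt Γ.contDiff Γ.contDiff he hpos (hB haB) h0 hc (hJ' a)] with ε h1 h2
      exact ⟨h1.1, ⟨h1.2.1, h2⟩, h1.2.2⟩
  · filter_upwards [Ioo_mem_nhdsLT (sub_lt_self t hδ)] with a ha
    have haB := htB a ⟨ha.1, by linarith [ha.2]⟩
    refine ⟨hs2 a haB ha.2.ne, ?_, ?_⟩
    · refine hasGerm_of_chart hmm fun c h0 hc => ?_
      rw [← he2] at h0
      filter_upwards [eventually_mem_cross_chart (hB haB) h0 hc ho4 ⟨haB, ha.2⟩,
        eventually_fst_lt Γ.contDiff Γ.contDiff he hpos (hB haB) h0 hc (hJ a)] with ε h1 h2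
      exact ⟨h1.1, ⟨h1.2.1, h2⟩, h1.2.2⟩
    · refine hasGerm_of_chart hpm fun c h0 hc => ?_
      rw [← he2] at h0
      filter_upwards [eventually_mem_cross_chart (hB haB) h0 hc ho4 ⟨haB, ha.2⟩,
        eventually_fst_gt Γ.contDiff Γ.contDiff he hpos (hB haB) h0 hc (hJ' a)] with ε h1 h2
      exact ⟨h1.1, ⟨h1.2.1, h2⟩, h1.2.2⟩
  · refine hasGerm_of_chart hpp fun c h0 hc => ?_
    rw [← he1] at h0
    filter_upwards [eventually_mem_cross_chart (hB hBst) h0 hc hBo hBst,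
      eventually_fst_gt Γ.contDiff Γ.contDiff he hpos (hB hBst) h0 hc
        (by simpa [planeDet_add_left, planeDet_self] using hdet),
      eventually_snd_gt Γ.contDiff Γ.contDiff he hpos (hB hBst) h0 hc
        (by simpa [planeDet_add_right, planeDet_self] using hdet)] with ε h1 h2 h3
    exact ⟨h1.1, ⟨h1.2, h2⟩, h3⟩
  · refine hasGerm_of_chart hpm fun c h0 hc => ?_
    rw [← he1] at h0
    filter_upwards [eventually_mem_cross_chart (hB hBst) h0 hc hBo hBst,
      eventually_fst_gt Γ.contDiff Γ.contDiff he hpos (hB hBst) h0 hc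
        (by simpa [sub_eq_add_neg, planeDet_add_left, planeDet_neg_left, planeDet_self] using hdet),
      eventually_snd_lt Γ.contDiff Γ.contDiff he hpos (hB hBst) h0 hc
        (by simpa [sub_eq_add_neg, planeDet_add_right, planeDet_neg_right, planeDet_self]
          using hdet)] with ε h1 h2 h3
    exact ⟨h1.1, ⟨h1.2, h2⟩, h3⟩
  · refine hasGerm_of_chart hmp fun c h0 hc => ?_
    rw [← he1] at h0
    filter_upwards [eventually_mem_cross_chart (hB hBst) h0 hc hBo hBst,
      eventually_fst_lt Γ.contDiff Γ.contDiff he hpos (hB hBst) h0 hc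
        (by simpa [planeDet_add_left, planeDet_neg_left, planeDet_self] using hdet),
      eventually_snd_gt Γ.contDiff Γ.contDiff he hpos (hB hBst) h0 hc
        (by simpa [planeDet_add_right, planeDet_neg_right, planeDet_self]
          using hdet)] with ε h1 h2 h3
    exact ⟨h1.1, ⟨h1.2, h2⟩, h3⟩
  · refine hasGerm_of_chart hmm fun c h0 hc => ?_
    rw [← he1] at h0
    filter_upwards [eventually_mem_cross_chart (hB hBst) h0 hc hBo hBst,
      eventually_fst_lt Γ.contDiff Γ.contDiff he hpos (hB hBst) h0 hc
        (by simpa [sub_eq_add_neg, planeDet_add_left, planeDet_neg_left, planeDet_self] using hdet),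
      eventually_snd_lt Γ.contDiff Γ.contDiff he hpos (hB hBst) h0 hc
        (by simpa [sub_eq_add_neg, planeDet_add_right, planeDet_neg_right, planeDet_self]
          using hdet)] with ε h1 h2 h3
    exact ⟨h1.1, ⟨h1.2, h2⟩, h3⟩
  · have := e.image_mem_nhds (hB hBst) (hBo.mem_nhds hBst)
    rw [he1] at this
    filter_upwards [this]
    rintro _ ⟨x, hx, rfl⟩ hxK
    rcases lt_trichotomy x.1 s with h1 | h1 | h1
    · rcases lt_trichotomy x.2 t with h2 | h2 | h2
      · exact Or.inr (Or.inr (Or.inr (hmm x ⟨⟨hx, h1⟩, h2⟩).2))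
      · refine absurd ⟨x.1, ?_⟩ hxK
        rw [← he1, ← h2]
      · exact Or.inr (Or.inr (Or.inl (hmp x ⟨⟨hx, h1⟩, h2⟩).2))
    · refine absurd ⟨x.2, ?_⟩ hxK
      rw [← he2, ← h1]
    · rcases lt_trichotomy x.2 t with h2 | h2 | h2
      · exact Or.inr (Or.inl (hpm x ⟨⟨hx, h1⟩, h2⟩).2)
      · refine absurd ⟨x.1, ?_⟩ hxK
        rw [← he1, ← h2]
      · exact Or.inl (hpp x ⟨⟨hx, h1⟩, h2⟩).2

end PlanarLoop

/-! ### Winding numbers and their jump across the curve. -/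

/-- The integral of `dw / (w - z)` along a piece of the curve `γ`. -/
noncomputable def cauchyIntegral (γ : ℝ → ℂ) (s t : ℝ) (z : ℂ) : ℂ :=
  ∫ r in s..t, deriv γ r / (γ r - z)

/-- The winding number around `z` of a closed piece of the curve `γ`. -/
noncomputable def windingNumber (γ : ℝ → ℂ) (s t : ℝ) (z : ℂ) : ℤ :=
  round (cauchyIntegral γ s t z / (2 * Real.pi * Complex.I)).re

section Winding

variable {γ : ℝ → ℂ} (hγ : ContDiff ℝ 1 γ)
include hγ

lemma continuousOn_cauchy_integrand {s t : ℝ} {z : ℂ} (hz : z ∉ γ '' Set.Icc s t) :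
    ContinuousOn (fun r => deriv γ r / (γ r - z)) (Set.Icc s t) := by
  refine (hγ.continuous_deriv le_rfl).continuousOn.div
    (hγ.continuous.sub continuous_const).continuousOn fun r hr h => hz ⟨r, hr, ?_⟩
  rwa [sub_eq_zero] at h

lemma intervalIntegrable_cauchy_integrand {s t : ℝ} (hst : s ≤ t) {z : ℂ}
    (hz : z ∉ γ '' Set.Icc s t) :
    IntervalIntegrable (fun r => deriv γ r / (γ r - z)) MeasureTheory.volume s t :=
  (continuousOn_cauchy_integrand hγ hz).intervalIntegrable_of_Icc hst

/-- The product of `γ r - z` with the exponential of minus the integral up to `r` has derivative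
zero. -/
lemma exp_cauchyIntegral {s t : ℝ} (hst : s ≤ t) {z : ℂ} (hz : z ∉ γ '' Set.Icc s t) :
    Complex.exp (cauchyIntegral γ s t z) = (γ t - z) / (γ s - z) := by
  have hne : ∀ r ∈ Set.Icc s t, γ r - z ≠ 0 := fun r hr h => hz ⟨r, hr, sub_eq_zero.1 h⟩
  -- Extending the integrand by its end values makes it continuous on all of `ℝ`, so its integral is
  -- differentiable everywhere.
  set G : ℝ → ℂ := Set.IccExtend hst
    (fun r : Set.Icc s t => deriv γ r / (γ r - z)) with hG
  have hGc : Continuous G := by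
    refine Continuous.Icc_extend' ?_
    exact continuousOn_iff_continuous_domRestrict.1 (continuousOn_cauchy_integrand hγ hz)
  have hGr : ∀ r ∈ Set.Icc s t, G r = deriv γ r / (γ r - z) := fun r hr => by
    rw [hG, Set.IccExtend_of_mem hst _ hr]
  have hint : cauchyIntegral γ s t z = ∫ r in s..t, G r := by
    refine intervalIntegral.integral_congr fun r hr => ?_
    rw [Set.uIcc_of_le hst] at hr
    exact (hGr r hr).symm
  set F : ℝ → ℂ := fun r => Complex.exp (-∫ x in s..r, G x) * (γ r - z) with hF
  have hFd : ∀ r, HasDerivAt F (Complex.exp (-∫ x in s..r, G x) * (-G r) * (γ r - z) +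
      Complex.exp (-∫ x in s..r, G x) * deriv γ r) r := fun r => by
    have h1 : HasDerivAt (fun r => ∫ x in s..r, G x) (G r) r :=
      (hGc.integral_hasStrictDerivAt s r).hasDerivAt
    have h2 : HasDerivAt γ (deriv γ r) r := (hγ.differentiable one_ne_zero r).hasDerivAt
    exact h1.neg.cexp.mul (h2.sub_const z)
  have hconst := constant_of_has_deriv_right_zero (f := F) (a := s) (b := t)
    (fun r _ => (hFd r).continuousAt.continuousWithinAt) (fun r hr => by
      have h0 := hne r ⟨hr.1, hr.2.le⟩
      have h1 := (hFd r).hasDerivWithinAt (s := Set.Ici r)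
      rw [hGr r ⟨hr.1, hr.2.le⟩] at h1
      convert h1 using 1
      field_simp
      ring)
  have h1 := hconst t ⟨hst, le_rfl⟩
  simp only [hF, intervalIntegral.integral_same, neg_zero, Complex.exp_zero, one_mul] at h1
  rw [hint, eq_div_iff (hne s ⟨le_rfl, hst⟩), ← h1, ← mul_assoc, ← Complex.exp_add]
  simp

/-- On a closed piece the exponential of the integral is `1`, so the quotient by `2πi` is an integer
and the rounding in `windingNumber` is exact. -/
lemma cauchyIntegral_eq {s t : ℝ} (hst : s ≤ t) (hcl : γ s = γ t) {z : ℂ}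
    (hz : z ∉ γ '' Set.Icc s t) :
    cauchyIntegral γ s t z = windingNumber γ s t z * (2 * Real.pi * Complex.I) := by
  have h1 := exp_cauchyIntegral hγ hst hz
  have hne : γ s - z ≠ 0 := fun h => hz ⟨s, ⟨le_rfl, hst⟩, sub_eq_zero.1 h⟩
  rw [← hcl, div_self hne, Complex.exp_eq_one_iff] at h1
  obtain ⟨n, hn⟩ := h1
  have : windingNumber γ s t z = n := by
    rw [windingNumber, hn, mul_div_assoc, div_self Complex.two_pi_I_ne_zero, mul_one]
    simp
  rw [this, hn]

lemma continuousAt_cauchyIntegral {s t : ℝ} (hst : s ≤ t) {z : ℂ} (hz : z ∉ γ '' Set.Icc s t) :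
    ContinuousAt (cauchyIntegral γ s t) z := by
  have hC : IsCompact (γ '' Set.Icc s t) := isCompact_Icc.image hγ.continuous
  obtain ⟨d, hd, hball⟩ := Metric.isOpen_iff.1 hC.isClosed.isOpen_compl z hz
  obtain ⟨M, hM⟩ := isCompact_Icc.exists_bound_of_continuousOn (s := Set.Icc s t)
    (hγ.continuous_deriv le_rfl).continuousOn
  have hM0 : 0 ≤ M := (norm_nonneg _).trans (hM s ⟨le_rfl, hst⟩)
  refine intervalIntegral.continuousAt_of_dominated_interval (bound := fun _ => M / (d / 2))
    ?_ ?_ intervalIntegrable_const ?_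
  · filter_upwards [hC.isClosed.isOpen_compl.mem_nhds hz] with w hw
    exact (intervalIntegrable_cauchy_integrand hγ hst hw).aestronglyMeasurable_restrict_uIoc
  · filter_upwards [Metric.ball_mem_nhds z (half_pos hd)] with w hw
    refine Eventually.of_forall fun r hr => ?_
    rw [Set.uIoc_of_le hst] at hr
    have hr' : r ∈ Set.Icc s t := ⟨hr.1.le, hr.2⟩
    have h1 : d ≤ ‖γ r - z‖ := by
      by_contra! h
      exact hball (by rwa [Metric.mem_ball, dist_eq_norm]) ⟨r, hr', rfl⟩
    have h2 : ‖w - z‖ < d / 2 := by rwa [← dist_eq_norm]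
    have h3 : d / 2 ≤ ‖γ r - w‖ := by
      have := norm_sub_le_norm_sub_add_norm_sub (γ r) w z
      linarith
    rw [norm_div]
    exact div_le_div₀ hM0 (hM r hr') (half_pos hd) h3
  · refine Eventually.of_forall fun r hr => ?_
    rw [Set.uIoc_of_le hst] at hr
    refine ContinuousAt.div continuousAt_const (by fun_prop) fun h => ?_
    exact hz ⟨r, ⟨hr.1.le, hr.2⟩, sub_eq_zero.1 h⟩

/-- The integral is continuous in `z` and takes values in the multiples of `2πi`; a variation below
`1` leaves no room for a change. -/
lemma locallyConstOff_windingNumber {s t : ℝ} (hst : s ≤ t) (hcl : γ s = γ t) :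
    LocallyConstOff (γ '' Set.Icc s t) (windingNumber γ s t) := by
  intro z hz
  have hC : IsCompact (γ '' Set.Icc s t) := isCompact_Icc.image hγ.continuous
  have h1 := Metric.tendsto_nhds.1 (continuousAt_cauchyIntegral hγ hst hz) 1 one_pos
  filter_upwards [h1, hC.isClosed.isOpen_compl.mem_nhds hz] with w hw hwC
  rw [cauchyIntegral_eq hγ hst hcl hz, cauchyIntegral_eq hγ hst hcl hwC, dist_eq_norm,
    ← sub_mul, norm_mul, ← Int.cast_sub, Complex.norm_intCast] at hw
  have hpi : ‖(2 * Real.pi * Complex.I : ℂ)‖ = 2 * Real.pi := by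
    simp [abs_of_pos Real.pi_pos]
  rw [hpi] at hw
  by_contra hne
  have h2 : (1 : ℝ) ≤ |((windingNumber γ s t w - windingNumber γ s t z : ℤ) : ℝ)| := by
    exact_mod_cast Int.one_le_abs (sub_ne_zero.2 hne)
  nlinarith [Real.pi_gt_three]

lemma exists_windingNumber_eq_zero {s t : ℝ} (hst : s ≤ t) (hcl : γ s = γ t) :
    ∃ R : ℝ, ∀ z, R < ‖z‖ → windingNumber γ s t z = 0 := by
  obtain ⟨M, hM⟩ := isCompact_Icc.exists_bound_of_continuousOn (s := Set.Icc s t)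
    (hγ.continuous_deriv le_rfl).continuousOn
  obtain ⟨N, hN⟩ := isCompact_Icc.exists_bound_of_continuousOn (s := Set.Icc s t)
    hγ.continuous.continuousOn
  have hM0 : 0 ≤ M := (norm_nonneg _).trans (hM s ⟨le_rfl, hst⟩)
  -- Beyond this radius the distance to the curve is at least `M * (t - s) + 1`, so the integral has
  -- norm below `1`, hence below `2π`.
  refine ⟨N + (M * (t - s) + 1), fun z hz => ?_⟩
  have hpos : 0 < M * (t - s) + 1 := by nlinarith
  have hfar : ∀ r ∈ Set.Icc s t, M * (t - s) + 1 ≤ ‖γ r - z‖ := fun r hr => by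
    have := norm_sub_norm_le z (γ r)
    rw [norm_sub_rev] at this
    linarith [hN r hr]
  have hzC : z ∉ γ '' Set.Icc s t := by
    rintro ⟨r, hr, rfl⟩
    have := hfar r hr
    simp only [sub_self, norm_zero] at this
    linarith
  have h1 : ‖cauchyIntegral γ s t z‖ ≤ M / (M * (t - s) + 1) * |t - s| := by
    refine intervalIntegral.norm_integral_le_of_norm_le_const fun r hr => ?_
    rw [Set.uIoc_of_le hst] at hr
    have hr' : r ∈ Set.Icc s t := ⟨hr.1.le, hr.2⟩
    rw [norm_div]
    exact div_le_div₀ hM0 (hM r hr') hpos (hfar r hr')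
  rw [abs_of_nonneg (sub_nonneg.2 hst), div_mul_eq_mul_div] at h1
  have h2 : M * (t - s) / (M * (t - s) + 1) < 1 := by rw [div_lt_one hpos]; linarith
  rw [cauchyIntegral_eq hγ hst hcl hzC, norm_mul, Complex.norm_intCast] at h1
  have hpi : ‖(2 * Real.pi * Complex.I : ℂ)‖ = 2 * Real.pi := by
    simp [abs_of_pos Real.pi_pos]
  rw [hpi] at h1
  by_contra hne
  have h3 : (1 : ℝ) ≤ |(windingNumber γ s t z : ℝ)| := by
    exact_mod_cast Int.one_le_abs hne
  nlinarith [Real.pi_gt_three]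

omit hγ in
-- The half turn from `-(I * z)` to `I * z` counts as `+π` or `-π` according to the side of the
-- branch cut. The difference of the two cases produces the jump `2πi`.
lemma log_I_mul_sub_log_neg {z : ℂ} (hz : 0 < z.re) :
    Complex.log (Complex.I * z) - Complex.log (-(Complex.I * z)) = Real.pi * Complex.I := by
  have h : 0 < (Complex.I * z).im := by simpa using hz
  rw [Complex.log, Complex.log, norm_neg, Complex.arg_neg_eq_arg_sub_pi_of_im_pos h]
  push_cast
  ring

omit hγ in
lemma log_I_mul_sub_log_neg' {z : ℂ} (hz : z.re < 0) :
    Complex.log (Complex.I * z) - Complex.log (-(Complex.I * z)) = -(Real.pi * Complex.I) := by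
  have h : (Complex.I * z).im < 0 := by simpa using hz
  rw [Complex.log, Complex.log, norm_neg, Complex.arg_neg_eq_arg_add_pi_of_im_neg h]
  push_cast
  ring

/-- The Cauchy integral along a short arc through `γ r`, seen from a point on one side (`j = I`) or
the other (`j = -I`). -/
lemma cauchyIntegral_short_arc {a b r : ℝ} (hab : a ≤ b) (hr : deriv γ r ≠ 0)
    {j : ℂ} (hj : j = Complex.I ∨ j = -Complex.I)
    (hre : ∀ x ∈ Set.Icc a b, x ≠ r → ((γ x - γ r) / deriv γ r).re ≠ 0) {ε : ℝ} (hε : 0 < ε) :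
    cauchyIntegral γ a b (γ r + ε • (j * deriv γ r)) =
      Complex.log (j * ((γ b - γ r) / deriv γ r) + ε) -
      Complex.log (j * ((γ a - γ r) / deriv γ r) + ε) := by
  have hjj : j * j = -1 := by rcases hj with rfl | rfl <;> simp
  have hjre : ∀ z : ℂ, (j * z).im = z.re ∨ (j * z).im = -z.re := fun z => by
    rcases hj with rfl | rfl <;> simp
  -- Away from `r` the imaginary part is plus or minus the nonzero real part in `hre`; at `r` the
  -- value is `ε > 0`. The branch cut is thus avoided.
  have hslit : ∀ x ∈ Set.Icc a b, j * ((γ x - γ r) / deriv γ r) + ε ∈ Complex.slitPlane := by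
    intro x hx
    rw [Complex.mem_slitPlane_iff]
    by_cases hxr : x = r
    · left
      simp [hxr, hε]
    · right
      have := hre x hx hxr
      simp only [Complex.add_im, Complex.ofReal_im, add_zero]
      rcases hjre ((γ x - γ r) / deriv γ r) with h | h <;> rw [h]
      exacts [this, neg_ne_zero.2 this]
  -- Because `j * j = -1`, the argument of the logarithm is a constant multiple of `γ x - z`, so the
  -- logarithm is a primitive of the integrand.
  have hzr : ∀ x, j * ((γ x - γ r) / deriv γ r) + ε =
      j / deriv γ r * (γ x - (γ r + ε • (j * deriv γ r))) := fun x => by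
    rw [Complex.real_smul]
    field_simp
    linear_combination (ε : ℂ) * deriv γ r * hjj
  have hj0 : j ≠ 0 := by rintro rfl; simp at hjj
  have hz : γ r + ε • (j * deriv γ r) ∉ γ '' Set.Icc a b := by
    rintro ⟨x, hx, hxe⟩
    have h1 := hslit x hx
    rw [hzr, hxe, sub_self, mul_zero] at h1
    exact Complex.zero_notMem_slitPlane h1
  refine intervalIntegral.integral_eq_sub_of_hasDerivAt
    (f := fun x => Complex.log (j * ((γ x - γ r) / deriv γ r) + ε)) ?_
    (intervalIntegrable_cauchy_integrand hγ hab hz)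
  intro x hx
  rw [Set.uIcc_of_le hab] at hx
  have h1 : HasDerivAt γ (deriv γ x) x := (hγ.differentiable one_ne_zero x).hasDerivAt
  have h2 := ((((h1.sub_const (γ r)).div_const (deriv γ r)).const_mul j).add_const
    (ε : ℂ)).clog_real (hslit x hx)
  have h3 : γ x - (γ r + ε • (j * deriv γ r)) ≠ 0 := fun h => hz ⟨x, hx, sub_eq_zero.1 h⟩
  refine h2.congr_deriv ?_
  rw [hzr]
  field_simp

lemma cauchyIntegral_split {s a b t : ℝ} (hsa : s ≤ a) (hab : a ≤ b) (hbt : b ≤ t) {z : ℂ}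
    (hz : z ∉ γ '' Set.Icc s t) : cauchyIntegral γ s t z =
      cauchyIntegral γ s a z + cauchyIntegral γ a b z + cauchyIntegral γ b t z := by
  have h : ∀ {u v : ℝ}, s ≤ u → u ≤ v → v ≤ t →
      IntervalIntegrable (fun r => deriv γ r / (γ r - z)) MeasureTheory.volume u v :=
    fun hu huv hv => intervalIntegrable_cauchy_integrand hγ huv
      fun h => hz (Set.image_mono (Set.Icc_subset_Icc hu hv) h)
  unfold cauchyIntegral
  rw [intervalIntegral.integral_add_adjacent_intervals (h le_rfl hsa (hab.trans hbt))
    (h hsa hab hbt), intervalIntegral.integral_add_adjacent_intervals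
    (h le_rfl (hsa.trans hab) hbt) (h (hsa.trans hab) hbt le_rfl)]

/-- The winding number jumps by one when the curve is crossed from right to left. -/
theorem windingNumber_jump {s t r : ℝ} (hcl : γ s = γ t) (hr : r ∈ Set.Ioo s t)
    (hd : deriv γ r ≠ 0) (hinj : ∀ x ∈ Set.Icc s t, γ x = γ r → x = r) :
    ∀ᶠ ε : ℝ in 𝓝[>] 0, γ r + ε • (Complex.I * deriv γ r) ∉ γ '' Set.Icc s t →
      γ r + ε • (-(Complex.I * deriv γ r)) ∉ γ '' Set.Icc s t →
      windingNumber γ s t (γ r + ε • (Complex.I * deriv γ r)) =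
        windingNumber γ s t (γ r + ε • (-(Complex.I * deriv γ r))) + 1 := by
  have hst : s ≤ t := (hr.1.trans hr.2).le
  set h : ℝ → ℂ := fun x => (γ x - γ r) / deriv γ r with hh
  have hhd : HasDerivAt h 1 r := by
    have := ((hγ.differentiable one_ne_zero r).hasDerivAt.sub_const (γ r)).div_const (deriv γ r)
    rwa [div_self hd] at this
  -- Since `h` has derivative `1` at `r`, its real part has the sign of `x - r` nearby. This
  -- provides the arc `[a, b]` for `cauchyIntegral_short_arc`.
  have hre : ∀ᶠ x in 𝓝 r, |(h x).re - (x - r)| ≤ 1 / 2 * |x - r| := by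
    have h1 := (hasDerivAt_iff_isLittleO.1 hhd).def (c := 1 / 2) (by norm_num)
    filter_upwards [h1] with x hx
    have h2 : h x - h r - (x - r) • (1 : ℂ) = h x - ((x - r : ℝ) : ℂ) := by simp [hh]
    rw [h2] at hx
    refine le_trans ?_ hx
    have := Complex.abs_re_le_norm (h x - ((x - r : ℝ) : ℂ))
    rwa [Complex.sub_re, Complex.ofReal_re] at this
  obtain ⟨δ, hδ, hball⟩ := Metric.mem_nhds_iff.1 (hre.and (Ioo_mem_nhds hr.1 hr.2))
  set a := r - δ / 2 with ha
  set b := r + δ / 2 with hb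
  have hmem : ∀ x ∈ Set.Icc a b, |(h x).re - (x - r)| ≤ 1 / 2 * |x - r| ∧ x ∈ Set.Ioo s t :=
    fun x hx => hball (by
      rw [Metric.mem_ball, Real.dist_eq, abs_lt]
      constructor <;> linarith [hx.1, hx.2])
  have hab : a < b := by linarith
  have hsa : s ≤ a := (hmem a ⟨le_rfl, hab.le⟩).2.1.le
  have hbt : b ≤ t := (hmem b ⟨hab.le, le_rfl⟩).2.2.le
  have hre0 : ∀ x ∈ Set.Icc a b, x ≠ r → (h x).re ≠ 0 := by
    intro x hx hxr h0
    have h1 := (hmem x hx).1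
    rw [h0, zero_sub, abs_neg] at h1
    have := abs_pos.2 (sub_ne_zero.2 hxr)
    linarith
  have hbre : 0 < (h b).re := by
    have h1 := (hmem b ⟨hab.le, le_rfl⟩).1
    rw [show b - r = δ / 2 by rw [hb]; ring, abs_of_pos (half_pos hδ), abs_le] at h1
    linarith [h1.1]
  have hare : (h a).re < 0 := by
    have h1 := (hmem a ⟨le_rfl, hab.le⟩).1
    rw [show a - r = -(δ / 2) by rw [ha]; ring, abs_neg, abs_of_pos (half_pos hδ), abs_le] at h1
    linarith [h1.2]
  have hpa : γ r ∉ γ '' Set.Icc s a := by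
    rintro ⟨x, hx, hxe⟩
    have := hinj x ⟨hx.1, by linarith [hx.2]⟩ hxe
    linarith [hx.2]
  have hpb : γ r ∉ γ '' Set.Icc b t := by
    rintro ⟨x, hx, hxe⟩
    have := hinj x ⟨by linarith [hx.1], hx.2⟩ hxe
    linarith [hx.1]
  have hline : ∀ v : ℂ, Tendsto (fun ε : ℝ => γ r + ε • v) (𝓝[>] 0) (𝓝 (γ r)) := fun v => by
    have := (hasDerivAt_line (γ r) v).continuousAt.tendsto
    simp only [zero_smul, add_zero] at this
    exact this.mono_left nhdsWithin_le_nhds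
  -- The rest of the curve stays away from `γ r`, so its contributions from the two sides have the
  -- same limit; the whole jump comes from the short arc.
  have hfar : ∀ {u v : ℝ}, u ≤ v → γ r ∉ γ '' Set.Icc u v → Tendsto (fun ε : ℝ =>
      cauchyIntegral γ u v (γ r + ε • (Complex.I * deriv γ r)) -
      cauchyIntegral γ u v (γ r + ε • (-Complex.I * deriv γ r))) (𝓝[>] 0) (𝓝 0) := by
    intro u v huv hp
    have hc := continuousAt_cauchyIntegral hγ huv hp
    have := (hc.tendsto.comp (hline (Complex.I * deriv γ r))).sub
      (hc.tendsto.comp (hline (-Complex.I * deriv γ r)))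
    rwa [sub_self] at this
  have hlog : ∀ z : ℂ, z.im ≠ 0 →
      Tendsto (fun ε : ℝ => Complex.log (z + ε)) (𝓝[>] 0) (𝓝 (Complex.log z)) := by
    intro z hz
    have h1 : Tendsto (fun ε : ℝ => z + (ε : ℂ)) (𝓝[>] 0) (𝓝 z) := by
      have : Continuous (fun ε : ℝ => z + (ε : ℂ)) := by fun_prop
      have := this.tendsto 0
      simp only [Complex.ofReal_zero, add_zero] at this
      exact this.mono_left nhdsWithin_le_nhds
    exact (continuousAt_clog (Complex.mem_slitPlane_iff.2 (Or.inr hz))).tendsto.comp h1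
  have hnear : Tendsto (fun ε : ℝ =>
      cauchyIntegral γ a b (γ r + ε • (Complex.I * deriv γ r)) -
      cauchyIntegral γ a b (γ r + ε • (-Complex.I * deriv γ r))) (𝓝[>] 0)
      (𝓝 (2 * Real.pi * Complex.I)) := by
    have hlim := (((hlog (Complex.I * h b) (by simpa using hbre.ne')).sub
      (hlog (Complex.I * h a) (by simpa using hare.ne))).sub
      ((hlog (-Complex.I * h b) (by simpa using hbre.ne')).sub
      (hlog (-Complex.I * h a) (by simpa using hare.ne))))
    have hval : Complex.log (Complex.I * h b) - Complex.log (Complex.I * h a) -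
        (Complex.log (-Complex.I * h b) - Complex.log (-Complex.I * h a)) =
        2 * Real.pi * Complex.I := by
      rw [neg_mul, neg_mul]
      linear_combination log_I_mul_sub_log_neg hbre - log_I_mul_sub_log_neg' hare
    rw [hval] at hlim
    refine hlim.congr' ?_
    filter_upwards [self_mem_nhdsWithin] with ε hε
    rw [cauchyIntegral_short_arc hγ hab.le hd (Or.inl rfl) hre0 hε,
      cauchyIntegral_short_arc hγ hab.le hd (Or.inr rfl) hre0 hε]
  have htot := ((hfar hsa hpa).add hnear).add (hfar hbt hpb)
  rw [zero_add, add_zero] at htot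
  filter_upwards [Metric.tendsto_nhds.1 htot 1 one_pos] with ε hε h1 h2
  rw [← neg_mul] at h2 ⊢
  set z₁ := γ r + ε • (Complex.I * deriv γ r)
  set z₂ := γ r + ε • (-Complex.I * deriv γ r)
  have h3 : cauchyIntegral γ s a z₁ - cauchyIntegral γ s a z₂ +
      (cauchyIntegral γ a b z₁ - cauchyIntegral γ a b z₂) +
      (cauchyIntegral γ b t z₁ - cauchyIntegral γ b t z₂) =
      cauchyIntegral γ s t z₁ - cauchyIntegral γ s t z₂ := by
    rw [cauchyIntegral_split hγ hsa hab.le hbt h1, cauchyIntegral_split hγ hsa hab.le hbt h2]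
    ring
  rw [h3, cauchyIntegral_eq hγ hst hcl h1, cauchyIntegral_eq hγ hst hcl h2, dist_eq_norm] at hε
  have h4 : (windingNumber γ s t z₁ : ℂ) * (2 * Real.pi * Complex.I) -
      windingNumber γ s t z₂ * (2 * Real.pi * Complex.I) - 2 * Real.pi * Complex.I =
      ((windingNumber γ s t z₁ - (windingNumber γ s t z₂ + 1) : ℤ) : ℂ) *
        (2 * Real.pi * Complex.I) := by
    push_cast
    ring
  have hpi : ‖(2 * Real.pi * Complex.I : ℂ)‖ = 2 * Real.pi := by
    simp [abs_of_pos Real.pi_pos]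
  rw [h4, norm_mul, Complex.norm_intCast, hpi] at hε
  -- The norm is below `1`, whereas a nonzero integer multiple of `2πi` has norm at least `2π`.
  by_contra hne
  have h5 : (1 : ℝ) ≤ |((windingNumber γ s t z₁ - (windingNumber γ s t z₂ + 1) : ℤ) : ℝ)| := by
    exact_mod_cast Int.one_le_abs (sub_ne_zero.2 hne)
  nlinarith [Real.pi_gt_three]

end Winding

/-! ### Plane charts of the two surfaces. -/

/-- A plane chart of the surface covering the curve: it covers the surface except for at most one
point, which is then the limit at infinity. -/
structure KnotChart {S : DiagramSurface} (P : KnotProjection S) where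
  φ : EuclideanSpace ℝ (Fin 3) → ℂ
  ψ : ℂ → EuclideanSpace ℝ (Fin 3)
  ψ_mem : ∀ z, ψ z ∈ S.carrier
  ψ_contDiff : ContDiff ℝ 1 ψ
  φ_ψ : ∀ z, φ (ψ z) = z
  φ_contDiffAt : ∀ z, ContDiffAt ℝ 1 φ (ψ z)
  curve_mem : ∀ t, P.curve t ∈ Set.range ψ
  eventually_mem : ∀ z, ∀ᶠ x in 𝓝 (ψ z), x ∈ S.carrier → x ∈ Set.range ψ
  tendsto_infty : ∀ x ∈ S.carrier, x ∉ Set.range ψ → Tendsto (fun r : ℝ => ψ r) atTop (𝓝 x)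

/-- The chart of the plane. -/
noncomputable def KnotChart.plane (P : KnotProjection DiagramSurface.plane) : KnotChart P := by
  have hr : ∀ x ∈ DiagramSurface.plane.carrier,
      x ∈ Set.range (fun z : ℂ => (!₂[z.re, z.im, 0] : EuclideanSpace ℝ (Fin 3))) := by
    intro x hx
    refine ⟨⟨x 0, x 1⟩, ?_⟩
    have hx' : x 2 = 0 := hx
    ext i
    fin_cases i <;> simp [hx']
  exact
  { φ := fun v => Complex.equivRealProdCLM.symm (v 0, v 1)
    ψ := fun z => !₂[z.re, z.im, 0]
    ψ_mem := fun z => by simp [DiagramSurface.carrier]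
    ψ_contDiff := by
      rw [contDiff_euclidean]
      intro i
      fin_cases i
      · exact Complex.reCLM.contDiff
      · exact Complex.imCLM.contDiff
      · exact contDiff_const
    φ_ψ := fun z => by
      apply Complex.ext <;> simp [Complex.equivRealProdCLM_symm_apply]
    φ_contDiffAt := fun z => by
      refine ContDiff.contDiffAt ?_
      exact Complex.equivRealProdCLM.symm.contDiff.comp (by fun_prop)
    curve_mem := fun t => hr _ (P.curve_mem t)
    eventually_mem := fun z => Eventually.of_forall fun x hx => hr x hx
    tendsto_infty := fun x hx h => absurd (hr x hx) h }

/-- The cone over the curve is a `C¹` image of `ℝ²` and cannot fill `ℝ³`; a vector outside it is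
nonzero and is scaled to the sphere. -/
lemma KnotProjection.exists_notMem_range (P : KnotProjection DiagramSurface.sphere) :
    ∃ N : EuclideanSpace ℝ (Fin 3), ‖N‖ = 1 ∧ N ∉ Set.range P.curve := by
  have hc : ContDiff ℝ 1 (fun x : ℝ × ℝ => x.2 • P.curve x.1) :=
    contDiff_snd.smul (P.contDiff.comp contDiff_fst)
  have hd := hc.dense_compl_range_of_finrank_lt_finrank (by simp)
  obtain ⟨w, hw⟩ := hd.nonempty
  have hw0 : w ≠ 0 := by
    rintro rfl
    exact hw ⟨(0, 0), by simp⟩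
  refine ⟨‖w‖⁻¹ • w, by rw [norm_smul, norm_inv, norm_norm, inv_mul_cancel₀ (norm_ne_zero_iff.2 hw0)], ?_⟩
  rintro ⟨t, ht⟩
  refine hw ⟨(t, ‖w‖), ?_⟩
  simp only
  rw [ht, smul_smul, mul_inv_cancel₀ (norm_ne_zero_iff.2 hw0), one_smul]

lemma tendsto_stereoInvFunAux {E : Type*} [NormedAddCommGroup E] [InnerProductSpace ℝ E] (N : E)
    {w : E} (hw : w ≠ 0) :
    Tendsto (fun r : ℝ => stereoInvFunAux N (r • w)) atTop (𝓝 N) := by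
  set m := ‖w‖ ^ 2 with hm
  have hm0 : 0 < m := by positivity
  have h1 : Tendsto (fun r : ℝ => 4 * (r * m + 4 / r)⁻¹) atTop (𝓝 (4 * 0)) := by
    refine Tendsto.const_mul _ (tendsto_inv_atTop_zero.comp ?_)
    exact (tendsto_id.atTop_mul_const hm0).atTop_add (tendsto_const_nhds.div_atTop tendsto_id)
  have h2 : Tendsto (fun r : ℝ => 1 - 8 * (r ^ 2 * m + 4)⁻¹) atTop (𝓝 (1 - 8 * 0)) := by
    refine tendsto_const_nhds.sub (Tendsto.const_mul _ (tendsto_inv_atTop_zero.comp ?_))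
    exact ((tendsto_pow_atTop two_ne_zero).atTop_mul_const hm0).atTop_add tendsto_const_nhds
  have h3 := (h1.smul_const w).add (h2.smul_const N)
  simp only [mul_zero, zero_smul, sub_zero, one_smul, zero_add] at h3
  refine h3.congr' ?_
  filter_upwards [eventually_gt_atTop 0] with r hr
  have hp : r ^ 2 * m + 4 ≠ 0 := by positivity
  rw [stereoInvFunAux_apply, norm_smul, mul_pow, Real.norm_eq_abs, sq_abs, ← hm, smul_add,
    smul_smul, smul_smul, smul_smul]
  congr 2
  · have : r * m + 4 / r = (r ^ 2 * m + 4) / r := by field_simp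
    rw [this]
    field_simp
  · field_simp
    ring

/-- Stereographic projection from a point off the curve. -/
lemma KnotProjection.nonempty_chart_sphere (P : KnotProjection DiagramSurface.sphere) :
    Nonempty (KnotChart P) := by
  obtain ⟨N, hN, hNP⟩ := P.exists_notMem_range
  have hN0 : N ≠ 0 := by rintro rfl; simp at hN
  have hfin : Module.finrank ℝ (ℝ ∙ N)ᗮ = Module.finrank ℝ ℂ := by
    have : Fact (Module.finrank ℝ (EuclideanSpace ℝ (Fin 3)) = 2 + 1) := ⟨by simp⟩
    rw [Submodule.finrank_orthogonal_span_singleton (n := 2) hN0, Complex.finrank_real_complex]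
  let L : (ℝ ∙ N)ᗮ ≃L[ℝ] ℂ := ContinuousLinearEquiv.ofFinrankEq hfin
  have hmem : ∀ w : (ℝ ∙ N)ᗮ, stereoInvFunAux N (w : EuclideanSpace ℝ (Fin 3)) ∈
      Metric.sphere (0 : EuclideanSpace ℝ (Fin 3)) 1 := fun w => stereoInvFunAux_mem hN w.2
  have hne : ∀ w : (ℝ ∙ N)ᗮ, stereoInvFunAux N (w : EuclideanSpace ℝ (Fin 3)) ≠ N := fun w h =>
    stereoInvFun_ne_north_pole hN w (Subtype.ext h)
  have hr : ∀ x ∈ Metric.sphere (0 : EuclideanSpace ℝ (Fin 3)) 1, x ≠ N → x ∈ Set.range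
      (fun z : ℂ => stereoInvFunAux N ((L.symm z : (ℝ ∙ N)ᗮ) : EuclideanSpace ℝ (Fin 3))) := by
    intro x hx hxN
    refine ⟨L (stereoToFun N x), ?_⟩
    have := stereo_left_inv hN (x := ⟨x, hx⟩) hxN
    simp only [ContinuousLinearEquiv.symm_apply_apply]
    exact congrArg Subtype.val this
  exact ⟨
  { φ := fun x => L (stereoToFun N x)
    ψ := fun z => stereoInvFunAux N ((L.symm z : (ℝ ∙ N)ᗮ) : EuclideanSpace ℝ (Fin 3))
    ψ_mem := fun z => hmem _
    ψ_contDiff := contDiff_stereoInvFunAux.comp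
      ((ℝ ∙ N)ᗮ.subtypeL.contDiff.comp L.symm.contDiff)
    φ_ψ := fun z => by
      have := stereo_right_inv hN (L.symm z)
      rw [show stereoInvFunAux N ((L.symm z : (ℝ ∙ N)ᗮ) : EuclideanSpace ℝ (Fin 3)) =
        stereoInvFun hN (L.symm z) from rfl, this]
      simp
    φ_contDiffAt := fun z => by
      have ho : IsOpen {x : EuclideanSpace ℝ (Fin 3) | innerSL ℝ N x ≠ (1 : ℝ)} :=
        isOpen_ne_fun (innerSL ℝ N).continuous continuous_const
      have hx : innerSL ℝ N
          (stereoInvFunAux N ((L.symm z : (ℝ ∙ N)ᗮ) : EuclideanSpace ℝ (Fin 3))) ≠ (1 : ℝ) := by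
        intro h
        have h2 := hmem (L.symm z)
        rw [mem_sphere_zero_iff_norm] at h2
        exact hne (L.symm z) ((inner_eq_one_iff_of_norm_eq_one hN h2).1 h).symm
      exact L.contDiff.contDiffAt.comp _
        (contDiffOn_stereoToFun.contDiffAt (ho.mem_nhds hx))
    curve_mem := fun t => hr _ (P.curve_mem t) fun h => hNP ⟨t, h⟩
    eventually_mem := fun z => by
      filter_upwards [isOpen_ne.mem_nhds (hne (L.symm z))] with x hx hxS
      exact hr x hxS hx
    tendsto_infty := fun x hx h => by
      have hxN : x = N := by
        by_contra hne'
        exact h (hr x hx hne')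
      subst hxN
      have h1 : ((L.symm 1 : (ℝ ∙ x)ᗮ) : EuclideanSpace ℝ (Fin 3)) ≠ 0 := by simp
      refine (tendsto_stereoInvFunAux x h1).congr fun r => ?_
      have h2 : L.symm (r : ℂ) = r • L.symm 1 := by
        rw [← map_smul]
        simp
      rw [h2]
      rfl }⟩

theorem KnotProjection.nonempty_chart {S : DiagramSurface} (P : KnotProjection S) :
    Nonempty (KnotChart P) := by
  cases S
  · exact ⟨KnotChart.plane P⟩
  · exact P.nonempty_chart_sphere

/-! ### The curve read in a chart. -/

/-- A zero determinant yields linear relations between `u` and `v` with their coordinates as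
coefficients; `D` carries these to `a` and `b`, whose independence kills the coefficients. It
transfers transversality to the chart. -/
lemma eq_zero_of_planeDet_eq_zero {V : Type*} [AddCommGroup V] [Module ℝ V] {a b : V}
    (hab : LinearIndependent ℝ ![a, b]) (D : ℂ →ₗ[ℝ] V) {u v : ℂ} (hu : D u = a) (hv : D v = b)
    (hdet : planeDet u v = 0) : u = 0 := by
  rw [LinearIndependent.pair_iff] at hab
  have h1 : v.re • u + (-u.re) • v = 0 := by
    apply Complex.ext <;> simp only [planeDet] at hdet <;> simp <;> linarith
  have h2 : v.im • u + (-u.im) • v = 0 := by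
    apply Complex.ext <;> simp only [planeDet] at hdet <;> simp <;> linarith
  have h3 := congrArg D h1
  have h4 := congrArg D h2
  simp only [map_add, map_smul, map_zero, hu, hv] at h3 h4
  apply Complex.ext
  · simpa using (hab _ _ h3).2
  · simpa using (hab _ _ h4).2

namespace KnotChart

variable {S : DiagramSurface} {P : KnotProjection S} (C : KnotChart P)

lemma ψ_φ {x : EuclideanSpace ℝ (Fin 3)} (hx : x ∈ Set.range C.ψ) : C.ψ (C.φ x) = x := by
  obtain ⟨z, rfl⟩ := hx
  rw [C.φ_ψ]

lemma φ_contDiffAt' {x : EuclideanSpace ℝ (Fin 3)} (hx : x ∈ Set.range C.ψ) :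
    ContDiffAt ℝ 1 C.φ x := by
  obtain ⟨z, rfl⟩ := hx
  exact C.φ_contDiffAt z

lemma ψ_φ_curve (t : ℝ) : C.ψ (C.φ (P.curve t)) = P.curve t := C.ψ_φ (C.curve_mem t)

lemma φ_curve_eq_iff {s t : ℝ} : C.φ (P.curve s) = C.φ (P.curve t) ↔ P.curve s = P.curve t :=
  ⟨fun h => by rw [← C.ψ_φ_curve s, h, C.ψ_φ_curve], fun h => by rw [h]⟩

lemma contDiff_φ_curve : ContDiff ℝ 1 (fun t => C.φ (P.curve t)) :=
  contDiff_iff_contDiffAt.2 fun t =>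
    (C.φ_contDiffAt' (C.curve_mem t)).comp t P.contDiff.contDiffAt

lemma deriv_curve (t : ℝ) : deriv P.curve t =
    fderiv ℝ C.ψ (C.φ (P.curve t)) (deriv (fun t => C.φ (P.curve t)) t) := by
  have h1 : HasDerivAt (fun t => C.φ (P.curve t)) (deriv (fun t => C.φ (P.curve t)) t) t :=
    (C.contDiff_φ_curve.differentiable one_ne_zero t).hasDerivAt
  have h2 := (C.ψ_contDiff.differentiable one_ne_zero (C.φ (P.curve t))).hasFDerivAt
  have h3 := h2.comp_hasDerivAt t h1
  rw [← h3.deriv]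
  congr 1
  ext1 t
  exact (C.ψ_φ_curve t).symm

lemma deriv_φ_curve (t : ℝ) : deriv (fun t => C.φ (P.curve t)) t =
    fderiv ℝ C.φ (P.curve t) (deriv P.curve t) := by
  have h1 : HasDerivAt P.curve (deriv P.curve t) t :=
    (P.contDiff.differentiable one_ne_zero t).hasDerivAt
  have h2 := ((C.φ_contDiffAt' (C.curve_mem t)).differentiableAt one_ne_zero).hasFDerivAt
  exact (h2.comp_hasDerivAt t h1).deriv

end KnotChart

lemma KnotProjection.curve_fract {S : DiagramSurface} (P : KnotProjection S) (t : ℝ) :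
    P.curve (Int.fract t) = P.curve t := by
  rw [← Int.self_sub_floor]
  simpa using P.periodic.sub_int_mul_eq ⌊t⌋ (x := t)

lemma KnotProjection.deriv_fract {S : DiagramSurface} (P : KnotProjection S) (t : ℝ) :
    deriv P.curve (Int.fract t) = deriv P.curve t := by
  rw [← Int.self_sub_floor, sub_eq_add_neg, ← deriv_comp_add_const]
  congr 1
  ext1 t
  simpa [sub_eq_add_neg] using P.periodic.sub_int_mul_eq ⌊_⌋ (x := t)

lemma KnotProjection.fract_mem {S : DiagramSurface} (P : KnotProjection S)
    {t : ℝ} {p : EuclideanSpace ℝ (Fin 3)} (h : P.curve t = p) :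
    Int.fract t ∈ Set.Ico (0 : ℝ) 1 ∩ P.curve ⁻¹' {p} :=
  ⟨⟨Int.fract_nonneg t, Int.fract_lt_one t⟩, by rw [Set.mem_preimage, P.curve_fract, h]; rfl⟩

lemma exists_int_of_fract_eq {s t : ℝ} (h : Int.fract s = Int.fract t) : ∃ k : ℤ, s = t + k := by
  obtain ⟨k, hk⟩ := Int.fract_eq_fract.1 h
  exact ⟨k, by rw [← hk]; ring⟩

/-- The curve in the chart. -/
noncomputable def KnotChart.loop {S : DiagramSurface} {P : KnotProjection S} (C : KnotChart P) :
    PlanarLoop where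
  γ := fun t => C.φ (P.curve t)
  periodic := fun t => congrArg C.φ (P.periodic t)
  contDiff := C.contDiff_φ_curve
  immersed := fun t h => P.immersed t (by rw [C.deriv_curve, h, map_zero])
  atMostDouble := fun r s t hrs hst => by
    rw [C.φ_curve_eq_iff] at hrs hst
    have h1 := P.fract_mem (hrs.trans hst)
    have h2 := P.fract_mem hst
    have h3 := P.fract_mem (rfl : P.curve t = P.curve t)
    by_contra! hcon
    have hrs' : Int.fract r ≠ Int.fract s := fun h =>
      (exists_int_of_fract_eq h).elim fun k hk => hcon.1 k hk
    have hst' : Int.fract s ≠ Int.fract t := fun h =>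
      (exists_int_of_fract_eq h).elim fun k hk => hcon.2.1 k hk
    have hrt' : Int.fract r ≠ Int.fract t := fun h =>
      (exists_int_of_fract_eq h).elim fun k hk => hcon.2.2 k hk
    have h4 : ({Int.fract r, Int.fract s, Int.fract t} : Set ℝ).encard ≤ 2 :=
      (Set.encard_le_encard (Set.insert_subset h1 (Set.insert_subset h2
        (Set.singleton_subset_iff.2 h3)))).trans (P.atMostDouble (P.curve t))
    rw [Set.encard_eq_three.2 ⟨_, _, _, hrs', hrt', hst', rfl⟩] at h4
    exact absurd h4 (by decide)
  transverse := fun s t hst hne hdet => by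
    rw [C.φ_curve_eq_iff] at hst
    have h1 := P.transverse _ (P.fract_mem rfl).1 _ (P.fract_mem rfl).1
      (fun h => (exists_int_of_fract_eq h).elim fun k hk => hne k hk)
      (by rw [P.curve_fract, P.curve_fract, hst])
    rw [P.deriv_fract, P.deriv_fract] at h1
    have h2 := eq_zero_of_planeDet_eq_zero h1 (fderiv ℝ C.ψ (C.φ (P.curve s))).toLinearMap
      (C.deriv_curve s).symm (by rw [hst]; exact (C.deriv_curve t).symm) hdet
    exact P.immersed s (by rw [C.deriv_curve, h2, map_zero])

lemma PlanarLoop.isCompact_image (Γ : PlanarLoop) : IsCompact Γ.image := by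
  have h : Γ.image = Γ.γ '' Set.Icc 0 (0 + 1) := by
    rw [Γ.periodic.image_Icc one_pos]
    rfl
  rw [h]
  exact isCompact_Icc.image Γ.contDiff.continuous

/-! ### Regions, sides and corners seen in a chart. -/

/-- The value of a germ, if there is one. -/
noncomputable def germValue {α : Type*} [Nonempty α] (K : Set ℂ) (f : ℂ → α) (p v : ℂ) : α :=
  Classical.epsilon (HasGerm K f p v)

lemma HasGerm.germValue_eq {α : Type*} [Nonempty α] {K : Set ℂ} {f : ℂ → α} {p v : ℂ} {y : α}
    (h : HasGerm K f p v y) : germValue K f p v = y :=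
  (Classical.epsilon_spec (p := HasGerm K f p v) ⟨y, h⟩).unique h

namespace KnotChart

variable {S : DiagramSurface} {P : KnotProjection S} (C : KnotChart P)

lemma ψ_mem_compl_iff {z : ℂ} :
    C.ψ z ∈ S.carrier \ Set.range P.curve ↔ z ∉ C.loop.image := by
  constructor
  · rintro ⟨-, h⟩ ⟨t, rfl⟩
    exact h ⟨t, (C.ψ_φ_curve t).symm⟩
  · intro h
    refine ⟨C.ψ_mem z, ?_⟩
    rintro ⟨t, ht⟩
    refine h ⟨t, ?_⟩
    change C.φ (P.curve t) = z
    rw [ht, C.φ_ψ]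

lemma exists_radius : ∃ R : ℝ, ∀ z, R < ‖z‖ → z ∉ C.loop.image := by
  obtain ⟨R, hR⟩ := C.loop.isCompact_image.isBounded.exists_norm_le
  exact ⟨R, fun z hz h => absurd (hR z h) (not_le.2 hz)⟩

include C in
lemma nonempty_region : Nonempty P.Region := by
  obtain ⟨R, hR⟩ := C.exists_radius
  have h : C.ψ ((|R| + 1 : ℝ) : ℂ) ∈ S.carrier \ Set.range P.curve := by
    rw [C.ψ_mem_compl_iff]
    refine hR _ ?_
    rw [Complex.norm_real, Real.norm_eq_abs, abs_of_pos (by positivity)]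
    linarith [le_abs_self R]
  exact ⟨⟨_, _, h, rfl⟩⟩

/-- The region containing the point `ψ z` of the complement of the curve. -/
def regionOf {z : ℂ} (h : z ∉ C.loop.image) : P.Region :=
  ⟨_, C.ψ z, C.ψ_mem_compl_iff.2 h, rfl⟩

open Classical in
/-- The region containing a point of the chart that is not on the curve. -/
noncomputable def regionAt (z : ℂ) : P.Region :=
  if h : z ∉ C.loop.image then C.regionOf h
  else Classical.choice C.nonempty_region

lemma regionAt_val {z : ℂ} (hz : z ∉ C.loop.image) :
    (C.regionAt z).1 = connectedComponentIn (S.carrier \ Set.range P.curve) (C.ψ z) := by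
  rw [regionAt, dif_pos hz, regionOf]

lemma ψ_mem_regionAt {z : ℂ} (hz : z ∉ C.loop.image) : C.ψ z ∈ (C.regionAt z).1 := by
  rw [C.regionAt_val hz]
  exact mem_connectedComponentIn (C.ψ_mem_compl_iff.2 hz)

lemma ψ_mem_region_iff {z : ℂ} (hz : z ∉ C.loop.image) {R : P.Region} :
    C.ψ z ∈ R.1 ↔ C.regionAt z = R := by
  constructor
  · intro h
    apply Subtype.ext
    rw [C.regionAt_val hz]
    obtain ⟨y, hy, hR⟩ := R.2
    rw [hR] at h ⊢
    exact (connectedComponentIn_eq h).symm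
  · rintro rfl
    exact C.ψ_mem_regionAt hz

lemma region_subset (R : P.Region) : R.1 ⊆ S.carrier \ Set.range P.curve := by
  obtain ⟨y, hy, hR⟩ := R.2
  rw [hR]
  exact connectedComponentIn_subset _ _

lemma regionAt_eq_of_isPreconnected {s : Set ℂ} (hs : IsPreconnected s)
    (hsK : ∀ z ∈ s, z ∉ C.loop.image) {z w : ℂ} (hz : z ∈ s) (hw : w ∈ s) :
    C.regionAt z = C.regionAt w := by
  rw [← C.ψ_mem_region_iff (hsK z hz), C.regionAt_val (hsK w hw)]
  refine (hs.image C.ψ C.ψ_contDiff.continuous.continuousOn).subset_connectedComponentIn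
    ⟨w, hw, rfl⟩ ?_ ⟨z, hz, rfl⟩
  rintro _ ⟨u, hu, rfl⟩
  exact C.ψ_mem_compl_iff.2 (hsK u hu)

lemma locallyConstOff_regionAt : LocallyConstOff C.loop.image C.regionAt := by
  intro z hz
  obtain ⟨d, hd, hball⟩ := Metric.isOpen_iff.1 C.loop.isCompact_image.isClosed.isOpen_compl z hz
  filter_upwards [Metric.ball_mem_nhds z hd] with w hw
  exact C.regionAt_eq_of_isPreconnected (convex_ball z d).isPreconnected
    (fun u hu => hball hu) hw (Metric.mem_ball_self hd)

/-- The only issue is a surface point outside the chart. It is the limit of a ray to infinity, whose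
far part avoids the curve and lies in the same region. -/
lemma exists_regionAt_eq (R : P.Region) : ∃ z, z ∉ C.loop.image ∧ C.regionAt z = R := by
  obtain ⟨x, hx, hR⟩ := R.2
  by_cases hxr : x ∈ Set.range C.ψ
  · obtain ⟨z, rfl⟩ := hxr
    have hz := C.ψ_mem_compl_iff.1 hx
    exact ⟨z, hz, Subtype.ext (by rw [C.regionAt_val hz, hR])⟩
  · have hlim := C.tendsto_infty x hx.1 hxr
    obtain ⟨B, hB⟩ := C.exists_radius
    set s : Set (EuclideanSpace ℝ (Fin 3)) :=
      (fun r : ℝ => C.ψ r) '' Set.Ici (|B| + 1) with hs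
    have hsX : s ⊆ S.carrier \ Set.range P.curve := by
      rintro _ ⟨r, hr, rfl⟩
      refine C.ψ_mem_compl_iff.2 (hB _ ?_)
      rw [Complex.norm_real, Real.norm_eq_abs]
      have h1 : |B| + 1 ≤ r := hr
      linarith [le_abs_self B, le_abs_self r]
    have hsc : IsPreconnected s := isPreconnected_Ici.image _
      (C.ψ_contDiff.continuous.comp Complex.continuous_ofReal).continuousOn
    have hxs : x ∈ closure s := mem_closure_of_tendsto hlim
      ((eventually_ge_atTop _).mono fun r hr => ⟨r, hr, rfl⟩)
    have hins : IsPreconnected (insert x s) := hsc.subset_closure (Set.subset_insert x s)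
      (Set.insert_subset hxs subset_closure)
    have hmem : C.ψ ((|B| + 1 : ℝ) : ℂ) ∈ s := ⟨_, Set.mem_Ici.2 le_rfl, rfl⟩
    have hz := C.ψ_mem_compl_iff.1 (hsX hmem)
    refine ⟨_, hz, (C.ψ_mem_region_iff hz).1 ?_⟩
    rw [hR]
    exact hins.subset_connectedComponentIn (Set.mem_insert x s)
      (Set.insert_subset hx hsX) (Set.mem_insert_of_mem x hmem)

/-- A constant value near infinity extends the function over a possible missing point of the
surface, so it is locally constant off the curve there and constant on each region. -/
lemma exists_region_function {β : Type*} {w : ℂ → β} (hw : LocallyConstOff C.loop.image w)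
    {B : ℝ} {b : β} (hb : ∀ z, B < ‖z‖ → w z = b) :
    ∃ W : P.Region → β, ∀ z, z ∉ C.loop.image → W (C.regionAt z) = w z := by
  classical
  set F : EuclideanSpace ℝ (Fin 3) → β := fun x => if x ∈ Set.range C.ψ then w (C.φ x) else b
    with hF
  have hFψ : ∀ z, F (C.ψ z) = w z := fun z => by
    simp only [hF]
    rw [if_pos ⟨z, rfl⟩, C.φ_ψ]
  have hFl : ∀ x ∈ S.carrier \ Set.range P.curve, ∀ᶠ y in 𝓝 x, y ∈ S.carrier → F y = F x := by
    intro x hx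
    by_cases hxr : x ∈ Set.range C.ψ
    · obtain ⟨z, rfl⟩ := hxr
      have h1 := (C.φ_contDiffAt z).continuousAt.tendsto
      rw [C.φ_ψ] at h1
      filter_upwards [C.eventually_mem z, h1.eventually (hw z (C.ψ_mem_compl_iff.1 hx))]
        with y hy1 hy2 hyS
      obtain ⟨u, rfl⟩ := hy1 hyS
      rw [hFψ, hFψ]
      rwa [C.φ_ψ] at hy2
    · have hc : IsClosed (C.ψ '' Metric.closedBall 0 B) :=
        ((isCompact_closedBall 0 B).image C.ψ_contDiff.continuous).isClosed
      have hxc : x ∉ C.ψ '' Metric.closedBall 0 B := fun ⟨z, _, hz⟩ => hxr ⟨z, hz⟩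
      filter_upwards [hc.isOpen_compl.mem_nhds hxc] with y hy _
      have hFx : F x = b := if_neg hxr
      rw [hFx]
      by_cases hyr : y ∈ Set.range C.ψ
      · obtain ⟨z, rfl⟩ := hyr
        rw [hFψ]
        refine hb z (not_le.1 fun h => hy ⟨z, ?_, rfl⟩)
        rwa [mem_closedBall_zero_iff]
      · exact if_neg hyr
  choose p hp hpR using C.exists_regionAt_eq
  refine ⟨fun R => w (p R), fun z hz => ?_⟩
  change w (p (C.regionAt z)) = w z
  rw [← hFψ, ← hFψ z]
  have hpre : IsPreconnected (C.regionAt z).1 := by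
    rw [C.regionAt_val hz]
    exact isPreconnected_connectedComponentIn
  refine hpre.eq_of_eventually_eq (f := F) (fun x hx => ?_)
    ((C.ψ_mem_region_iff (hp _)).2 (hpR _)) (C.ψ_mem_regionAt hz)
  have hx' := region_subset _ hx
  filter_upwards [mem_nhdsWithin_of_mem_nhds (hFl x hx'), self_mem_nhdsWithin] with y hy hyR
  exact hy (region_subset _ hyR).1

/-- Transversality makes the determinant nonzero, and naming the two strands in the right order
makes it positive. -/
lemma exists_crossing_params (x : P.Crossing) : ∃ s ∈ Set.Ico (0 : ℝ) 1, ∃ t ∈ Set.Ico (0 : ℝ) 1,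
    P.curve s = x.1 ∧ P.curve t = x.1 ∧
      0 < planeDet (deriv C.loop.γ s) (deriv C.loop.γ t) := by
  obtain ⟨s, hs, t, ht, hst, hsx, htx⟩ := x.2
  have hne : ∀ k : ℤ, s ≠ t + k := by
    rintro k rfl
    refine hst ?_
    have h1 : (k : ℝ) < 1 := by linarith [hs.2, ht.1]
    have h2 : (-1 : ℝ) < k := by linarith [hs.1, ht.2]
    have h3 : k = 0 := by
      have : k < 1 := by exact_mod_cast h1
      have : -1 < k := by exact_mod_cast h2
      omega
    simp [h3]
  have hγ : C.loop.γ s = C.loop.γ t := C.φ_curve_eq_iff.2 (hsx.trans htx.symm)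
  rcases lt_or_gt_of_ne (C.loop.transverse s t hγ hne) with h | h
  · refine ⟨t, ht, s, hs, htx, hsx, ?_⟩
    rw [planeDet_swap]
    exact neg_pos.2 h
  · exact ⟨s, hs, t, ht, hsx, htx, h⟩

/-- The parameter of the strand at a crossing that the other strand crosses from its right to its
left. -/
noncomputable def fst (x : P.Crossing) : ℝ := (C.exists_crossing_params x).choose

/-- The parameter of the strand at a crossing that the other strand crosses from its left to its
right. -/
noncomputable def snd (x : P.Crossing) : ℝ :=
  (C.exists_crossing_params x).choose_spec.2.choose

lemma fst_mem (x : P.Crossing) : C.fst x ∈ Set.Ico (0 : ℝ) 1 :=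
  (C.exists_crossing_params x).choose_spec.1

lemma snd_mem (x : P.Crossing) : C.snd x ∈ Set.Ico (0 : ℝ) 1 :=
  (C.exists_crossing_params x).choose_spec.2.choose_spec.1

lemma curve_fst (x : P.Crossing) : P.curve (C.fst x) = x.1 :=
  (C.exists_crossing_params x).choose_spec.2.choose_spec.2.1

lemma curve_snd (x : P.Crossing) : P.curve (C.snd x) = x.1 :=
  (C.exists_crossing_params x).choose_spec.2.choose_spec.2.2.1

lemma planeDet_pos (x : P.Crossing) :
    0 < planeDet (deriv C.loop.γ (C.fst x)) (deriv C.loop.γ (C.snd x)) :=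
  (C.exists_crossing_params x).choose_spec.2.choose_spec.2.2.2

lemma γ_fst_eq_γ_snd (x : P.Crossing) : C.loop.γ (C.fst x) = C.loop.γ (C.snd x) :=
  C.φ_curve_eq_iff.2 ((C.curve_fst x).trans (C.curve_snd x).symm)

lemma fst_ne_snd_add (x : P.Crossing) (k : ℤ) : C.fst x ≠ C.snd x + k := by
  intro h
  have := C.planeDet_pos x
  rw [h, C.loop.deriv_add_int, planeDet_self] at this
  exact lt_irrefl _ this

lemma eq_of_curve_eq {x y : P.Crossing} {s t : ℝ} (hs : P.curve s = x.1) (ht : P.curve t = y.1)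
    (h : s = t) : x = y :=
  Subtype.ext (by rw [← hs, ← ht, h])

lemma simple_or_crossing (t : ℝ) : t ∈ C.loop.simpleParams ∨
    ∃ (x : P.Crossing) (k : ℤ), t = C.fst x + k ∨ t = C.snd x + k := by
  by_cases ht : t ∈ C.loop.simpleParams
  · exact Or.inl ht
  right
  have ht' : ∃ r, C.loop.γ r = C.loop.γ t ∧ ∀ k : ℤ, r ≠ t + k := by
    by_contra! hcon
    exact ht hcon
  obtain ⟨r, hr, hrt⟩ := ht'
  let x : P.Crossing := ⟨P.curve t, Int.fract r, (P.fract_mem rfl).1, Int.fract t,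
    (P.fract_mem rfl).1, fun h => (exists_int_of_fract_eq h).elim fun k hk => hrt k hk,
    by rw [P.curve_fract, C.φ_curve_eq_iff.1 hr], P.curve_fract t⟩
  have h1 : C.loop.γ t = C.loop.γ (C.fst x) := C.φ_curve_eq_iff.2 (C.curve_fst x).symm
  rcases C.loop.atMostDouble t _ _ h1 (C.γ_fst_eq_γ_snd x) with ⟨k, hk⟩ | ⟨k, hk⟩ | ⟨k, hk⟩
  · exact ⟨x, k, Or.inl hk⟩
  · exact absurd hk (C.fst_ne_snd_add x k)
  · exact ⟨x, k, Or.inr hk⟩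

/-- The region at a point of the chart in a given direction. -/
noncomputable def regionGerm (p v : ℂ) : P.Region :=
  haveI := C.nonempty_region
  germValue C.loop.image C.regionAt p v

lemma _root_.HasGerm.regionGerm_eq {C : KnotChart P} {p v : ℂ} {R : P.Region}
    (h : HasGerm C.loop.image C.regionAt p v R) : C.regionGerm p v = R :=
  haveI := C.nonempty_region
  h.germValue_eq

/-- The region to the left of the curve at a parameter. -/
noncomputable def left (t : ℝ) : P.Region :=
  C.regionGerm (C.loop.γ t) (Complex.I * deriv C.loop.γ t)

/-- The region to the right of the curve at a parameter. -/
noncomputable def right (t : ℝ) : P.Region :=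
  C.regionGerm (C.loop.γ t) (-(Complex.I * deriv C.loop.γ t))

lemma hasGerm_sides {t : ℝ} (ht : t ∈ C.loop.simpleParams) :
    HasGerm C.loop.image C.regionAt (C.loop.γ t) (Complex.I * deriv C.loop.γ t) (C.left t) ∧
    HasGerm C.loop.image C.regionAt (C.loop.γ t) (-(Complex.I * deriv C.loop.γ t)) (C.right t) := by
  obtain ⟨yl, yr, h, -⟩ := C.loop.exists_sides C.locallyConstOff_regionAt ht
  obtain ⟨-, h1, h2⟩ := h.self_of_nhds
  have e1 : C.left t = yl := h1.regionGerm_eq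
  have e2 : C.right t = yr := h2.regionGerm_eq
  rw [e1, e2]
  exact ⟨h1, h2⟩

lemma eventually_sides {t : ℝ} (ht : t ∈ C.loop.simpleParams) :
    (∀ᶠ a in 𝓝 t, a ∈ C.loop.simpleParams ∧ C.left a = C.left t ∧ C.right a = C.right t) ∧
    ∀ᶠ z in 𝓝 (C.loop.γ t), z ∉ C.loop.image →
      C.regionAt z = C.left t ∨ C.regionAt z = C.right t := by
  obtain ⟨yl, yr, h, h'⟩ := C.loop.exists_sides C.locallyConstOff_regionAt ht
  obtain ⟨-, h1, h2⟩ := h.self_of_nhds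
  have e1 : C.left t = yl := h1.regionGerm_eq
  have e2 : C.right t = yr := h2.regionGerm_eq
  rw [e1, e2]
  exact ⟨h.mono fun a ha => ⟨ha.1, ha.2.1.regionGerm_eq, ha.2.2.regionGerm_eq⟩, h'⟩

/-- A corner at a crossing, forward (P) or backward (M) along the two strands. -/
noncomputable def cornerPP (x : P.Crossing) : P.Region :=
  C.regionGerm (C.loop.γ (C.fst x)) (deriv C.loop.γ (C.fst x) + deriv C.loop.γ (C.snd x))

/-- A corner at a crossing, forward (P) or backward (M) along the two strands. -/
noncomputable def cornerPM (x : P.Crossing) : P.Region :=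
  C.regionGerm (C.loop.γ (C.fst x)) (deriv C.loop.γ (C.fst x) - deriv C.loop.γ (C.snd x))

/-- A corner at a crossing, forward (P) or backward (M) along the two strands. -/
noncomputable def cornerMP (x : P.Crossing) : P.Region :=
  C.regionGerm (C.loop.γ (C.fst x)) (-deriv C.loop.γ (C.fst x) + deriv C.loop.γ (C.snd x))

/-- A corner at a crossing, forward (P) or backward (M) along the two strands. -/
noncomputable def cornerMM (x : P.Crossing) : P.Region :=
  C.regionGerm (C.loop.γ (C.fst x)) (-deriv C.loop.γ (C.fst x) - deriv C.loop.γ (C.snd x))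

/-- Uniqueness of germs identifies the four local values of `exists_corners` with the corner
regions, and the values beside each half strand with `left` and `right`. -/
lemma corners_spec (x : P.Crossing) :
    (∀ᶠ a in 𝓝[>] (C.fst x), a ∈ C.loop.simpleParams ∧
      C.left a = C.cornerPP x ∧ C.right a = C.cornerPM x) ∧
    (∀ᶠ a in 𝓝[<] (C.fst x), a ∈ C.loop.simpleParams ∧
      C.left a = C.cornerMP x ∧ C.right a = C.cornerMM x) ∧
    (∀ᶠ a in 𝓝[>] (C.snd x), a ∈ C.loop.simpleParams ∧
      C.left a = C.cornerMP x ∧ C.right a = C.cornerPP x) ∧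
    (∀ᶠ a in 𝓝[<] (C.snd x), a ∈ C.loop.simpleParams ∧
      C.left a = C.cornerMM x ∧ C.right a = C.cornerPM x) ∧
    HasGerm C.loop.image C.regionAt (C.loop.γ (C.fst x))
      (deriv C.loop.γ (C.fst x) + deriv C.loop.γ (C.snd x)) (C.cornerPP x) ∧
    HasGerm C.loop.image C.regionAt (C.loop.γ (C.fst x))
      (deriv C.loop.γ (C.fst x) - deriv C.loop.γ (C.snd x)) (C.cornerPM x) ∧
    HasGerm C.loop.image C.regionAt (C.loop.γ (C.fst x))
      (-deriv C.loop.γ (C.fst x) + deriv C.loop.γ (C.snd x)) (C.cornerMP x) ∧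
    HasGerm C.loop.image C.regionAt (C.loop.γ (C.fst x))
      (-deriv C.loop.γ (C.fst x) - deriv C.loop.γ (C.snd x)) (C.cornerMM x) ∧
    ∀ᶠ z in 𝓝 (C.loop.γ (C.fst x)), z ∉ C.loop.image →
      C.regionAt z = C.cornerPP x ∨ C.regionAt z = C.cornerPM x ∨
      C.regionAt z = C.cornerMP x ∨ C.regionAt z = C.cornerMM x := by
  obtain ⟨ypp, ypm, ymp, ymm, h1, h2, h3, h4, g1, g2, g3, g4, h5⟩ :=
    C.loop.exists_corners C.locallyConstOff_regionAt (C.γ_fst_eq_γ_snd x) (C.planeDet_pos x)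
  have e1 : C.cornerPP x = ypp := g1.regionGerm_eq
  have e2 : C.cornerPM x = ypm := g2.regionGerm_eq
  have e3 : C.cornerMP x = ymp := g3.regionGerm_eq
  have e4 : C.cornerMM x = ymm := g4.regionGerm_eq
  rw [e1, e2, e3, e4]
  exact ⟨h1.mono fun a ha => ⟨ha.1, ha.2.1.regionGerm_eq, ha.2.2.regionGerm_eq⟩,
    h2.mono fun a ha => ⟨ha.1, ha.2.1.regionGerm_eq, ha.2.2.regionGerm_eq⟩,
    h3.mono fun a ha => ⟨ha.1, ha.2.1.regionGerm_eq, ha.2.2.regionGerm_eq⟩,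
    h4.mono fun a ha => ⟨ha.1, ha.2.1.regionGerm_eq, ha.2.2.regionGerm_eq⟩,
    g1, g2, g3, g4, h5⟩

lemma simpleParams_add_int {t : ℝ} (ht : t ∈ C.loop.simpleParams) (k : ℤ) :
    t + k ∈ C.loop.simpleParams := by
  intro r hr
  rw [C.loop.apply_add_int] at hr
  obtain ⟨l, rfl⟩ := ht r hr
  exact ⟨l - k, by push_cast; ring⟩

lemma left_add_int (t : ℝ) (k : ℤ) : C.left (t + k) = C.left t := by
  rw [left, left, C.loop.apply_add_int, C.loop.deriv_add_int]

lemma right_add_int (t : ℝ) (k : ℤ) : C.right (t + k) = C.right t := by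
  rw [right, right, C.loop.apply_add_int, C.loop.deriv_add_int]

lemma dense_compl_image : Dense (C.loop.imageᶜ) := by
  intro z
  by_cases hz : z ∈ C.loop.image
  · obtain ⟨t, rfl⟩ := hz
    rcases C.simple_or_crossing t with h | ⟨x, k, h⟩
    · exact (C.hasGerm_sides h).1.mem_closure
    · have h1 := (C.corners_spec x).2.2.2.2.1.mem_closure
      rcases h with rfl | rfl
      · rwa [C.loop.apply_add_int]
      · rwa [C.loop.apply_add_int, ← C.γ_fst_eq_γ_snd]
  · exact subset_closure hz

/-- A function of the regions that takes the same value on both sides of the curve is constant. -/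
lemma const_of_left_eq_right {β : Type*} {F : P.Region → β}
    (hF : ∀ t ∈ C.loop.simpleParams, F (C.left t) = F (C.right t)) (R R' : P.Region) :
    F R = F R' := by
  obtain ⟨z, hz, rfl⟩ := C.exists_regionAt_eq R
  obtain ⟨z', hz', rfl⟩ := C.exists_regionAt_eq R'
  refine isPreconnected_univ.eq_of_locally_const_dense isOpen_univ C.dense_compl_image
    (f := fun z => F (C.regionAt z)) (fun u _ => ?_) ⟨trivial, hz⟩ ⟨trivial, hz'⟩
  by_cases hu : u ∈ C.loop.image
  · obtain ⟨t, rfl⟩ := hu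
    rcases C.simple_or_crossing t with h | ⟨x, k, h⟩
    · refine ⟨F (C.left t), ?_⟩
      filter_upwards [(C.eventually_sides h).2] with w hw hwK
      rcases hw hwK with h1 | h1
      · rw [h1]
      · rw [h1, hF t h]
    -- Crossing three of the four half strands already links all four corners.
    · obtain ⟨h1, h2, h3, -, -, -, -, -, h5⟩ := C.corners_spec x
      have e1 : F (C.cornerPP x) = F (C.cornerPM x) := by
        obtain ⟨a, ha, hl, hr⟩ := h1.exists
        rw [← hl, ← hr, hF a ha]
      have e2 : F (C.cornerMP x) = F (C.cornerMM x) := by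
        obtain ⟨a, ha, hl, hr⟩ := h2.exists
        rw [← hl, ← hr, hF a ha]
      have e3 : F (C.cornerMP x) = F (C.cornerPP x) := by
        obtain ⟨a, ha, hl, hr⟩ := h3.exists
        rw [← hl, ← hr, hF a ha]
      have e4 : C.loop.γ t = C.loop.γ (C.fst x) := by
        rcases h with rfl | rfl
        · rw [C.loop.apply_add_int]
        · rw [C.loop.apply_add_int, C.γ_fst_eq_γ_snd]
      rw [e4]
      refine ⟨F (C.cornerPP x), ?_⟩
      filter_upwards [h5] with w hw hwK
      rcases hw hwK with h6 | h6 | h6 | h6 <;> rw [h6]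
      · exact e1.symm
      · exact e3
      · exact e2.symm.trans e3
  · refine ⟨F (C.regionAt u), ?_⟩
    filter_upwards [C.locallyConstOff_regionAt u hu] with w hw _
    rw [hw]

/-- The winding number of a closed piece of the curve, as a function of the regions. -/
lemma exists_region_winding {s t : ℝ} (hst : s < t) (hts : t ≤ s + 1)
    (hcl : C.loop.γ s = C.loop.γ t) : ∃ W : P.Region → ℤ,
    (∀ r ∈ C.loop.simpleParams, r ∈ Set.Ioo s t → W (C.left r) = W (C.right r) + 1) ∧
    (∀ r ∈ C.loop.simpleParams, (∀ k : ℤ, r + k ∉ Set.Icc s t) → W (C.left r) = W (C.right r)) := by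
  have hlc := locallyConstOff_windingNumber C.loop.contDiff hst.le hcl
  obtain ⟨B, hB⟩ := exists_windingNumber_eq_zero C.loop.contDiff hst.le hcl
  have hsub : C.loop.γ '' Set.Icc s t ⊆ C.loop.image := Set.image_subset_range _ _
  obtain ⟨W, hW⟩ := C.exists_region_function (fun z hz => hlc z fun h => hz (hsub h)) hB
  refine ⟨W, fun r hr hrst => ?_, fun r hr hrst => ?_⟩
  -- As `t ≤ s + 1` and `r` is interior, no nonzero integer translate of `r` lies in `[s, t]`; the
  -- loop passes `γ r` only once.
  · have hinj : ∀ x ∈ Set.Icc s t, C.loop.γ x = C.loop.γ r → x = r := by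
      intro x hx hxr
      obtain ⟨k, rfl⟩ := hr x hxr
      have h1 : (k : ℝ) < 1 := by linarith [hx.2, hrst.1]
      have h2 : (-1 : ℝ) < k := by linarith [hx.1, hrst.2]
      have h3 : k = 0 := by
        have : k < 1 := by exact_mod_cast h1
        have : -1 < k := by exact_mod_cast h2
        omega
      simp [h3]
    have hj := windingNumber_jump C.loop.contDiff hcl hrst (C.loop.immersed r) hinj
    obtain ⟨ε, h1, h2, h3⟩ :=
      ((C.hasGerm_sides hr).1.line.and ((C.hasGerm_sides hr).2.line.and hj)).exists
    rw [← h1.2, ← h2.2, hW _ h1.1, hW _ h2.1]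
    exact h3 (fun h => h1.1 (hsub h)) (fun h => h2.1 (hsub h))
  · have hp : C.loop.γ r ∉ C.loop.γ '' Set.Icc s t := by
      rintro ⟨x, hx, hxr⟩
      obtain ⟨k, rfl⟩ := hr x hxr
      exact hrst k hx
    have hev : ∀ v : ℂ, ∀ᶠ ε : ℝ in 𝓝[>] 0, windingNumber C.loop.γ s t (C.loop.γ r + ε • v) =
        windingNumber C.loop.γ s t (C.loop.γ r) := fun v => by
      have := (hasDerivAt_line (C.loop.γ r) v).continuousAt.tendsto
      simp only [zero_smul, add_zero] at this
      exact (this.mono_left nhdsWithin_le_nhds) (hlc _ hp)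
    obtain ⟨ε, h1, h2, h3, h4⟩ := ((C.hasGerm_sides hr).1.line.and
      ((C.hasGerm_sides hr).2.line.and ((hev _).and (hev _)))).exists
    rw [← h1.2, ← h2.2, hW _ h1.1, hW _ h2.1, h3, h4]

end KnotChart

/-! ### The combinatorics of regions, crossings and winding functions. -/

/-- The combinatorial data of a knot projection: the regions to the left and to the right of the
curve at each simple parameter, the parameters `fst` and `snd` of the two strands at each crossing,
and the regions at its four corners. -/
structure RegionSystem (ι 𝓡 : Type*) where
  simple : Set ℝ
  left : ℝ → 𝓡
  right : ℝ → 𝓡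
  fst : ι → ℝ
  snd : ι → ℝ
  pp : ι → 𝓡
  pm : ι → 𝓡
  mp : ι → 𝓡
  mm : ι → 𝓡
  fst_mem : ∀ c, fst c ∈ Set.Ico (0 : ℝ) 1
  snd_mem : ∀ c, snd c ∈ Set.Ico (0 : ℝ) 1
  fst_ne_snd : ∀ c d, fst c ≠ snd d
  fst_injective : Function.Injective fst
  snd_injective : Function.Injective snd
  simple_add_int : ∀ t ∈ simple, ∀ k : ℤ, t + k ∈ simple
  left_add_int : ∀ (t : ℝ) (k : ℤ), left (t + k) = left t
  right_add_int : ∀ (t : ℝ) (k : ℤ), right (t + k) = right t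
  eventually_simple : ∀ t ∈ simple, ∀ᶠ a in 𝓝 t, a ∈ simple ∧ left a = left t ∧ right a = right t
  simple_or_crossing : ∀ t, t ∈ simple ∨ ∃ (c : ι) (k : ℤ), t = fst c + k ∨ t = snd c + k
  fst_right : ∀ c, ∀ᶠ a in 𝓝[>] (fst c), a ∈ simple ∧ left a = pp c ∧ right a = pm c
  fst_left : ∀ c, ∀ᶠ a in 𝓝[<] (fst c), a ∈ simple ∧ left a = mp c ∧ right a = mm c
  snd_right : ∀ c, ∀ᶠ a in 𝓝[>] (snd c), a ∈ simple ∧ left a = mp c ∧ right a = pp c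
  snd_left : ∀ c, ∀ᶠ a in 𝓝[<] (snd c), a ∈ simple ∧ left a = mm c ∧ right a = pm c
  -- This encodes connectedness of the surface; the winding fields that follow are the input from
  -- plane topology.
  const : ∀ F : 𝓡 → ℚ, (∀ t ∈ simple, F (left t) = F (right t)) → ∀ R R', F R = F R'
  winding : ∀ c, ∃ W : 𝓡 → ℤ,
    (∀ r ∈ simple, r ∈ Set.Ioo (min (fst c) (snd c)) (max (fst c) (snd c)) →
      W (left r) = W (right r) + 1) ∧
    (∀ r ∈ simple, (∀ k : ℤ, r + k ∉ Set.Icc (min (fst c) (snd c)) (max (fst c) (snd c))) →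
      W (left r) = W (right r))
  winding_total : ∃ W : 𝓡 → ℤ, ∀ r ∈ simple, r ∈ Set.Ioo (0 : ℝ) 1 → W (left r) = W (right r) + 1

namespace RegionSystem

variable {ι 𝓡 : Type*} (T : RegionSystem ι 𝓡)

/-- The first passage through a crossing. -/
noncomputable def lo (c : ι) : ℝ := min (T.fst c) (T.snd c)

/-- The second passage through a crossing. -/
noncomputable def hi (c : ι) : ℝ := max (T.fst c) (T.snd c)

lemma lo_hi (c : ι) : (T.lo c = T.fst c ∧ T.hi c = T.snd c) ∨
    (T.lo c = T.snd c ∧ T.hi c = T.fst c) := by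
  rcases le_total (T.fst c) (T.snd c) with h | h
  · exact Or.inl ⟨min_eq_left h, max_eq_right h⟩
  · exact Or.inr ⟨min_eq_right h, max_eq_left h⟩

lemma lo_lt_hi (c : ι) : T.lo c < T.hi c := min_lt_max.2 (T.fst_ne_snd c c)

lemma lo_nonneg (c : ι) : 0 ≤ T.lo c := le_min (T.fst_mem c).1 (T.snd_mem c).1

lemma hi_lt_one (c : ι) : T.hi c < 1 := max_lt (T.fst_mem c).2 (T.snd_mem c).2

/-- Parameters (mod 1) off the loop at a crossing. -/
def outside (c : ι) : Set ℝ := {r | ∀ k : ℤ, r + k ∉ Set.Icc (T.lo c) (T.hi c)}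

lemma mem_outside {c : ι} {r : ℝ}
    (h : r ∈ Set.Ioo (T.hi c - 1) (T.lo c) ∨ r ∈ Set.Ioo (T.hi c) (T.lo c + 1)) :
    r ∈ T.outside c := by
  intro k hk
  have h0 := T.lo_lt_hi c
  have key : ∀ n : ℤ, (0 : ℤ) ≤ n ∨ n + 1 ≤ 0 := fun n => by omega
  rcases h with h | h
  · rcases key (k - 1) with h1 | h1
    · have : (1 : ℝ) ≤ k := by exact_mod_cast (by omega : (1 : ℤ) ≤ k)
      linarith [hk.2, h.1]
    · have : (k : ℝ) ≤ 0 := by exact_mod_cast (by omega : k ≤ 0)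
      linarith [hk.1, h.2]
  · rcases key k with h1 | h1
    · have : (0 : ℝ) ≤ k := by exact_mod_cast h1
      linarith [hk.2, h.1]
    · have : (k : ℝ) + 1 ≤ 0 := by exact_mod_cast h1
      linarith [hk.1, h.2]

lemma eventually_outside {c : ι} {x : ℝ} (hx : x ∈ Set.Ico (0 : ℝ) 1)
    (hx' : x ∉ Set.Icc (T.lo c) (T.hi c)) : ∀ᶠ a in 𝓝 x, a ∈ T.outside c := by
  have h0 := T.lo_nonneg c
  have h1 := T.hi_lt_one c
  rcases lt_or_ge x (T.lo c) with h | h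
  · filter_upwards [Ioo_mem_nhds (by linarith [hx.1] : T.hi c - 1 < x) h] with a ha
    exact T.mem_outside (Or.inl ha)
  · have h2 : T.hi c < x := not_le.1 fun h3 => hx' ⟨h, h3⟩
    filter_upwards [Ioo_mem_nhds h2 (by linarith [hx.2] : x < T.lo c + 1)] with a ha
    exact T.mem_outside (Or.inr ha)

lemma eventually_outside_lo (c : ι) : ∀ᶠ a in 𝓝[<] (T.lo c), a ∈ T.outside c := by
  filter_upwards [Ioo_mem_nhdsLT
    (by linarith [T.lo_nonneg c, T.hi_lt_one c] : T.hi c - 1 < T.lo c)] with a ha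
  exact T.mem_outside (Or.inl ha)

/-- `W` jumps by one across the loop at the crossing `c` and is continuous across the rest of the
curve. -/
def IsWinding (c : ι) (W : 𝓡 → ℤ) : Prop :=
  (∀ r ∈ T.simple, r ∈ Set.Ioo (T.lo c) (T.hi c) → W (T.left r) = W (T.right r) + 1) ∧
  (∀ r ∈ T.simple, r ∈ T.outside c → W (T.left r) = W (T.right r))

lemma exists_isWinding (c : ι) : ∃ W, T.IsWinding c W := T.winding c

variable {T}

/-- The filter will be a one-sided neighbourhood of a crossing parameter: one sample parameter
carries the jump over to the adjacent corners. -/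
lemma IsWinding.jump_in {c : ι} {W : 𝓡 → ℤ} (hW : T.IsWinding c W) {l : Filter ℝ} [l.NeBot]
    {A B : 𝓡} (h : ∀ᶠ a in l, a ∈ T.simple ∧ T.left a = A ∧ T.right a = B)
    (h' : ∀ᶠ a in l, a ∈ Set.Ioo (T.lo c) (T.hi c)) : W A = W B + 1 := by
  obtain ⟨a, ⟨h1, h2, h3⟩, h4⟩ := (h.and h').exists
  rw [← h2, ← h3, hW.1 a h1 h4]

lemma IsWinding.jump_out {c : ι} {W : 𝓡 → ℤ} (hW : T.IsWinding c W) {l : Filter ℝ} [l.NeBot]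
    {A B : 𝓡} (h : ∀ᶠ a in l, a ∈ T.simple ∧ T.left a = A ∧ T.right a = B)
    (h' : ∀ᶠ a in l, a ∈ T.outside c) : W A = W B := by
  obtain ⟨a, ⟨h1, h2, h3⟩, h4⟩ := (h.and h').exists
  rw [← h2, ← h3, hW.2 a h1 h4]

lemma IsWinding.fst_in {c d : ι} {W : 𝓡 → ℤ} (hW : T.IsWinding c W)
    (h : T.fst d ∈ Set.Ioo (T.lo c) (T.hi c)) :
    W (T.pp d) = W (T.pm d) + 1 ∧ W (T.mp d) = W (T.mm d) + 1 :=
  ⟨hW.jump_in (T.fst_right d) (mem_nhdsWithin_of_mem_nhds (Ioo_mem_nhds h.1 h.2)),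
    hW.jump_in (T.fst_left d) (mem_nhdsWithin_of_mem_nhds (Ioo_mem_nhds h.1 h.2))⟩

lemma IsWinding.snd_in {c d : ι} {W : 𝓡 → ℤ} (hW : T.IsWinding c W)
    (h : T.snd d ∈ Set.Ioo (T.lo c) (T.hi c)) :
    W (T.mp d) = W (T.pp d) + 1 ∧ W (T.mm d) = W (T.pm d) + 1 :=
  ⟨hW.jump_in (T.snd_right d) (mem_nhdsWithin_of_mem_nhds (Ioo_mem_nhds h.1 h.2)),
    hW.jump_in (T.snd_left d) (mem_nhdsWithin_of_mem_nhds (Ioo_mem_nhds h.1 h.2))⟩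

lemma IsWinding.fst_out {c d : ι} {W : 𝓡 → ℤ} (hW : T.IsWinding c W)
    (h : T.fst d ∉ Set.Icc (T.lo c) (T.hi c)) :
    W (T.pp d) = W (T.pm d) ∧ W (T.mp d) = W (T.mm d) :=
  ⟨hW.jump_out (T.fst_right d) (mem_nhdsWithin_of_mem_nhds (T.eventually_outside (T.fst_mem d) h)),
    hW.jump_out (T.fst_left d) (mem_nhdsWithin_of_mem_nhds (T.eventually_outside (T.fst_mem d) h))⟩

lemma IsWinding.snd_out {c d : ι} {W : 𝓡 → ℤ} (hW : T.IsWinding c W)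
    (h : T.snd d ∉ Set.Icc (T.lo c) (T.hi c)) :
    W (T.mp d) = W (T.pp d) ∧ W (T.mm d) = W (T.pm d) :=
  ⟨hW.jump_out (T.snd_right d) (mem_nhdsWithin_of_mem_nhds (T.eventually_outside (T.snd_mem d) h)),
    hW.jump_out (T.snd_left d) (mem_nhdsWithin_of_mem_nhds (T.eventually_outside (T.snd_mem d) h))⟩

variable (T)

lemma fst_ne {c d : ι} (hdc : d ≠ c) : T.fst d ≠ T.lo c ∧ T.fst d ≠ T.hi c := by
  have h1 : T.fst d ≠ T.fst c := fun h => hdc (T.fst_injective h)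
  have h2 := T.fst_ne_snd d c
  rcases T.lo_hi c with ⟨h, h'⟩ | ⟨h, h'⟩ <;> rw [h, h']
  exacts [⟨h1, h2⟩, ⟨h2, h1⟩]

lemma snd_ne {c d : ι} (hdc : d ≠ c) : T.snd d ≠ T.lo c ∧ T.snd d ≠ T.hi c := by
  have h1 : T.snd d ≠ T.snd c := fun h => hdc (T.snd_injective h)
  have h2 := (T.fst_ne_snd c d).symm
  rcases T.lo_hi c with ⟨h, h'⟩ | ⟨h, h'⟩ <;> rw [h, h']
  exacts [⟨h2, h1⟩, ⟨h1, h2⟩]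

lemma mem_Ioo_or_notMem_Icc {a b x : ℝ} (ha : x ≠ a) (hb : x ≠ b) :
    x ∈ Set.Ioo a b ∨ x ∉ Set.Icc a b := by
  by_cases h : x ∈ Set.Icc a b
  · exact Or.inl ⟨lt_of_le_of_ne h.1 ha.symm, lt_of_le_of_ne h.2 hb⟩
  · exact Or.inr h

/-- The alternating sum of the values in the four corners at a crossing. -/
def alt {M : Type*} [AddCommGroup M] (F : 𝓡 → M) (d : ι) : M :=
  F (T.pp d) - F (T.pm d) + F (T.mm d) - F (T.mp d)

variable {T}

/-- A strand through `d` is on the loop, or off it, both before and after `d`, so its two jumps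
agree and cancel in the alternating sum. -/
lemma IsWinding.alt_eq_zero {c d : ι} {W : 𝓡 → ℤ} (hW : T.IsWinding c W) (hdc : d ≠ c) :
    T.alt W d = 0 := by
  unfold alt
  rcases mem_Ioo_or_notMem_Icc (T.fst_ne hdc).1 (T.fst_ne hdc).2 with h | h
  · have := hW.fst_in h
    omega
  · have := hW.fst_out h
    omega

/-- The loop starts at `T.lo c`: the strand is on the loop just after this parameter and off it just
before, so exactly one of the two jumps is `1`. -/
lemma IsWinding.alt_self {c : ι} {W : 𝓡 → ℤ} (hW : T.IsWinding c W) :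
    T.alt W c = 1 ∨ T.alt W c = -1 := by
  unfold alt
  have hlo := T.eventually_outside_lo c
  have hlt := T.lo_lt_hi c
  have hin : ∀ᶠ a in 𝓝[>] (T.lo c), a ∈ Set.Ioo (T.lo c) (T.hi c) := Ioo_mem_nhdsGT hlt
  rcases T.lo_hi c with ⟨h1, h2⟩ | ⟨h1, h2⟩
  · rw [h1] at hlo
    rw [show 𝓝[>] (T.lo c) = 𝓝[>] (T.fst c) by rw [h1]] at hin
    have := hW.jump_in (T.fst_right c) hin
    have := hW.jump_out (T.fst_left c) hlo
    omega
  · rw [h1] at hlo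
    rw [show 𝓝[>] (T.lo c) = 𝓝[>] (T.snd c) by rw [h1]] at hin
    have := hW.jump_in (T.snd_right c) hin
    have := hW.jump_out (T.snd_left c) hlo
    omega

variable (T)

/-- The crossings that are touched twice by a region. -/
def Doubled (c : ι) : Prop := T.pp c = T.mm c ∨ T.pm c = T.mp c

variable {T}

/-- A crossing touched twice by a region does not interlace with any other crossing. -/
lemma Doubled.fst_mem_iff {c d : ι} (hc : T.Doubled c) (hdc : d ≠ c) :
    T.fst d ∈ Set.Ioo (T.lo c) (T.hi c) ↔ T.snd d ∈ Set.Ioo (T.lo c) (T.hi c) := by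
  obtain ⟨W, hW⟩ := T.exists_isWinding d
  -- The roles are exchanged: if the loop at `d` contained just one of the passages through `c`, its
  -- winding function would differ by one between opposite corners of `c`. Interlacing being
  -- symmetric, the claim follows by comparing the orders.
  have key : T.fst c ∈ Set.Ioo (T.lo d) (T.hi d) ↔ T.snd c ∈ Set.Ioo (T.lo d) (T.hi d) := by
    rcases mem_Ioo_or_notMem_Icc (T.fst_ne hdc.symm).1 (T.fst_ne hdc.symm).2 with h | h <;>
      rcases mem_Ioo_or_notMem_Icc (T.snd_ne hdc.symm).1 (T.snd_ne hdc.symm).2 with h' | h'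
    · exact ⟨fun _ => h', fun _ => h⟩
    · exfalso
      have h1 := hW.fst_in h
      have h2 := hW.snd_out h'
      rcases hc with h3 | h3
      · rw [h3] at h1 h2
        omega
      · rw [h3] at h1 h2
        omega
    · exfalso
      have h1 := hW.fst_out h
      have h2 := hW.snd_in h'
      rcases hc with h3 | h3
      · rw [h3] at h1 h2
        omega
      · rw [h3] at h1 h2
        omega
    · exact ⟨fun h1 => absurd (Set.Ioo_subset_Icc_self h1) h,
        fun h1 => absurd (Set.Ioo_subset_Icc_self h1) h'⟩
  have n1 := T.fst_ne hdc
  have n2 := T.snd_ne hdc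
  have l1 := T.lo_lt_hi c
  have l2 := T.lo_lt_hi d
  simp only [Set.mem_Ioo] at key ⊢
  rcases T.lo_hi c with ⟨e1, e2⟩ | ⟨e1, e2⟩ <;> rcases T.lo_hi d with ⟨e3, e4⟩ | ⟨e3, e4⟩ <;>
    rw [e1, e2] at n1 n2 l1 ⊢ <;> rw [e3, e4] at l2 key <;> grind

variable (T)

lemma eventually_translate_right {s : ℝ} (k : ℤ) {A B : 𝓡}
    (h : ∀ᶠ a in 𝓝[>] s, a ∈ T.simple ∧ T.left a = A ∧ T.right a = B) :
    ∀ᶠ a in 𝓝[>] (s + k), a ∈ T.simple ∧ T.left a = A ∧ T.right a = B := by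
  have ht : Tendsto (fun a : ℝ => a - k) (𝓝[>] (s + k)) (𝓝[>] s) := by
    refine tendsto_nhdsWithin_iff.2 ⟨?_, ?_⟩
    · have : Continuous (fun a : ℝ => a - k) := by fun_prop
      have := this.tendsto (s + k)
      rw [add_sub_cancel_right] at this
      exact this.mono_left nhdsWithin_le_nhds
    · filter_upwards [self_mem_nhdsWithin] with a ha
      exact lt_sub_iff_add_lt.2 (Set.mem_Ioi.1 ha)
  filter_upwards [ht.eventually h] with a ha
  have h1 := T.simple_add_int _ ha.1 k
  have h2 := T.left_add_int (a - k) k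
  have h3 := T.right_add_int (a - k) k
  rw [sub_add_cancel] at h1 h2 h3
  exact ⟨h1, h2.trans ha.2.1, h3.trans ha.2.2⟩

lemma eventually_translate_left {s : ℝ} (k : ℤ) {A B : 𝓡}
    (h : ∀ᶠ a in 𝓝[<] s, a ∈ T.simple ∧ T.left a = A ∧ T.right a = B) :
    ∀ᶠ a in 𝓝[<] (s + k), a ∈ T.simple ∧ T.left a = A ∧ T.right a = B := by
  have ht : Tendsto (fun a : ℝ => a - k) (𝓝[<] (s + k)) (𝓝[<] s) := by
    refine tendsto_nhdsWithin_iff.2 ⟨?_, ?_⟩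
    · have : Continuous (fun a : ℝ => a - k) := by fun_prop
      have := this.tendsto (s + k)
      rw [add_sub_cancel_right] at this
      exact this.mono_left nhdsWithin_le_nhds
    · filter_upwards [self_mem_nhdsWithin] with a ha
      exact sub_lt_iff_lt_add.2 (Set.mem_Iio.1 ha)
  filter_upwards [ht.eventually h] with a ha
  have h1 := T.simple_add_int _ ha.1 k
  have h2 := T.left_add_int (a - k) k
  have h3 := T.right_add_int (a - k) k
  rw [sub_add_cancel] at h1 h2 h3
  exact ⟨h1, h2.trans ha.2.1, h3.trans ha.2.2⟩

lemma eventually_fst (c : ι) (k : ℤ) : ∀ᶠ a in 𝓝[≠] (T.fst c + k), a ∈ T.simple ∧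
    ((T.left a = T.pp c ∧ T.right a = T.pm c) ∨ (T.left a = T.mp c ∧ T.right a = T.mm c)) := by
  rw [← nhdsLT_sup_nhdsGT, eventually_sup]
  exact ⟨(T.eventually_translate_left k (T.fst_left c)).mono fun a h => ⟨h.1, Or.inr h.2⟩,
    (T.eventually_translate_right k (T.fst_right c)).mono fun a h => ⟨h.1, Or.inl h.2⟩⟩

lemma eventually_snd (c : ι) (k : ℤ) : ∀ᶠ a in 𝓝[≠] (T.snd c + k), a ∈ T.simple ∧
    ((T.left a = T.mp c ∧ T.right a = T.pp c) ∨ (T.left a = T.mm c ∧ T.right a = T.pm c)) := by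
  rw [← nhdsLT_sup_nhdsGT, eventually_sup]
  exact ⟨(T.eventually_translate_left k (T.snd_left c)).mono fun a h => ⟨h.1, Or.inr h.2⟩,
    (T.eventually_translate_right k (T.snd_right c)).mono fun a h => ⟨h.1, Or.inl h.2⟩⟩

lemma dense_simple : Dense T.simple := by
  intro x
  have : ∀ᶠ a in 𝓝[≠] x, a ∈ T.simple := by
    rcases T.simple_or_crossing x with h | ⟨c, k, rfl | rfl⟩
    · exact mem_nhdsWithin_of_mem_nhds ((T.eventually_simple x h).mono fun a ha => ha.1)
    · exact (T.eventually_fst c k).mono fun a ha => ha.1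
    · exact (T.eventually_snd c k).mono fun a ha => ha.1
  rw [mem_closure_iff_frequently]
  exact this.frequently.filter_mono nhdsWithin_le_nhds

/-- A function of the two sides of the curve that takes the same value before and after each
crossing is constant. -/
lemma eq_of_eq_through_crossings {β : Type*} (f : 𝓡 → 𝓡 → β) {I : Set ℝ} (hI : IsPreconnected I)
    (hIo : IsOpen I)
    (h1 : ∀ c, (∃ k : ℤ, T.fst c + k ∈ I) → f (T.pp c) (T.pm c) = f (T.mp c) (T.mm c))
    (h2 : ∀ c, (∃ k : ℤ, T.snd c + k ∈ I) → f (T.mp c) (T.pp c) = f (T.mm c) (T.pm c))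
    {r r' : ℝ} (hr : r ∈ I ∩ T.simple) (hr' : r' ∈ I ∩ T.simple) :
    f (T.left r) (T.right r) = f (T.left r') (T.right r') := by
  refine hI.eq_of_locally_const_dense hIo T.dense_simple
    (f := fun r => f (T.left r) (T.right r)) (fun x hx => ?_) hr hr'
  by_cases hxs : x ∈ T.simple
  · refine ⟨f (T.left x) (T.right x), ?_⟩
    filter_upwards [T.eventually_simple x hxs] with a ha _
    rw [ha.2.1, ha.2.2]
  · rcases T.simple_or_crossing x with h | ⟨c, k, rfl | rfl⟩
    · exact absurd h hxs
    · refine ⟨f (T.pp c) (T.pm c), ?_⟩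
      filter_upwards [eventually_nhdsWithin_iff.1 (T.eventually_fst c k)] with a ha has
      obtain ⟨-, h | h⟩ := ha (by rintro rfl; exact hxs has)
      · rw [h.1, h.2]
      · rw [h.1, h.2, h1 c ⟨k, hx⟩]
    · refine ⟨f (T.mp c) (T.pp c), ?_⟩
      filter_upwards [eventually_nhdsWithin_iff.1 (T.eventually_snd c k)] with a ha has
      obtain ⟨-, h | h⟩ := ha (by rintro rfl; exact hxs has)
      · rw [h.1, h.2]
      · rw [h.1, h.2, h2 c ⟨k, hx⟩]

variable {T}

/-- At a crossing touched twice by a region, the winding function of the loop can be normalized to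
vanish along the other loop. -/
lemma Doubled.exists_isWinding {c : ι} (hc : T.Doubled c) : ∃ W, T.IsWinding c W ∧
    ∀ r ∈ T.simple, r ∈ T.outside c → W (T.left r) = 0 ∧ W (T.right r) = 0 := by
  obtain ⟨W, hW⟩ := T.exists_isWinding c
  have hlt : T.hi c < T.lo c + 1 := by linarith [T.lo_nonneg c, T.hi_lt_one c]
  -- Without interlacing, a crossing with one passage off the loop has both off it, so `W` does not
  -- jump across either strand.
  have hcross : ∀ d, (T.fst d ∉ Set.Icc (T.lo c) (T.hi c) ∨ T.snd d ∉ Set.Icc (T.lo c) (T.hi c)) →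
      d ≠ c → W (T.pp d) = W (T.mp d) ∧ W (T.mp d) = W (T.mm d) := by
    intro d hd hdc
    have h := hc.fst_mem_iff hdc
    have h1 : T.fst d ∉ Set.Icc (T.lo c) (T.hi c) := by
      rcases mem_Ioo_or_notMem_Icc (T.fst_ne hdc).1 (T.fst_ne hdc).2 with h' | h'
      · exact hd.elim id fun h'' => absurd (Set.Ioo_subset_Icc_self (h.1 h')) h''
      · exact h'
    have h2 : T.snd d ∉ Set.Icc (T.lo c) (T.hi c) := by
      rcases mem_Ioo_or_notMem_Icc (T.snd_ne hdc).1 (T.snd_ne hdc).2 with h' | h'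
      · exact absurd (Set.Ioo_subset_Icc_self (h.2 h')) h1
      · exact h'
    exact ⟨(hW.snd_out h2).1.symm, (hW.fst_out h1).2⟩
  have hI : ∀ x ∈ Set.Ico (0 : ℝ) 1, ∀ k : ℤ, x + k ∈ Set.Ioo (T.hi c) (T.lo c + 1) →
      x ∉ Set.Icc (T.lo c) (T.hi c) := by
    intro x _ k hk
    have := T.mem_outside (Or.inr hk) (-k)
    rwa [Int.cast_neg, add_neg_cancel_right] at this
  have hself : ∀ x, x = T.lo c ∨ x = T.hi c → x ∈ Set.Icc (T.lo c) (T.hi c) := by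
    rintro x (rfl | rfl)
    exacts [⟨le_rfl, (T.lo_lt_hi c).le⟩, ⟨(T.lo_lt_hi c).le, le_rfl⟩]
  have hfst : T.fst c ∈ Set.Icc (T.lo c) (T.hi c) := hself _ (by
    rcases T.lo_hi c with h | h
    exacts [Or.inl h.1.symm, Or.inr h.2.symm])
  have hsnd : T.snd c ∈ Set.Icc (T.lo c) (T.hi c) := hself _ (by
    rcases T.lo_hi c with h | h
    exacts [Or.inr h.2.symm, Or.inl h.1.symm])
  have hconst : ∀ r ∈ Set.Ioo (T.hi c) (T.lo c + 1) ∩ T.simple,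
      ∀ r' ∈ Set.Ioo (T.hi c) (T.lo c + 1) ∩ T.simple, W (T.left r) = W (T.left r') := by
    intro r hr r' hr'
    refine T.eq_of_eq_through_crossings (fun A _ => W A) isPreconnected_Ioo isOpen_Ioo ?_ ?_ hr hr'
    · rintro d ⟨k, hk⟩
      have h1 := hI _ (T.fst_mem d) k hk
      exact (hcross d (Or.inl h1) (by rintro rfl; exact h1 hfst)).1
    · rintro d ⟨k, hk⟩
      have h1 := hI _ (T.snd_mem d) k hk
      exact (hcross d (Or.inr h1) (by rintro rfl; exact h1 hsnd)).2
  obtain ⟨r₀, hr₀, hr₀I⟩ := T.dense_simple.exists_mem_open isOpen_Ioo (Set.nonempty_Ioo.2 hlt)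
  -- Subtracting a constant preserves all jumps; the new function need not vanish at infinity.
  refine ⟨fun R => W R - W (T.left r₀), ⟨fun r hr hrI => ?_, fun r hr hrI => ?_⟩, ?_⟩
  · simp only
    rw [hW.1 r hr hrI]
    ring
  · simp only
    rw [hW.2 r hr hrI]
  · intro r hr hro
    have h1 : W (T.left r) = W (T.left r₀) := by
      -- The shift moves `r` into `[lo, lo + 1)`, and being off the loop then leaves only `(hi, lo +
      -- 1)`.
      rw [← T.left_add_int r (-⌊r - T.lo c⌋)]
      refine hconst _ ⟨?_, T.simple_add_int r hr _⟩ _ ⟨hr₀I, hr₀⟩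
      have h2 := hro (-⌊r - T.lo c⌋)
      have h3 := Int.fract_nonneg (r - T.lo c)
      have h4 := Int.fract_lt_one (r - T.lo c)
      rw [← Int.self_sub_floor] at h3 h4
      rw [Int.cast_neg] at h2 ⊢
      refine ⟨not_le.1 fun h5 => h2 ⟨by linarith, h5⟩, by linarith⟩
    simp only
    rw [← hW.2 r hr hro, h1, sub_self]
    exact ⟨rfl, rfl⟩

variable (T)

lemma exists_winding_total : ∃ W : 𝓡 → ℤ, ∀ r ∈ T.simple, W (T.left r) = W (T.right r) + 1 := by
  obtain ⟨W, hW⟩ := T.winding_total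
  refine ⟨W, fun r hr => ?_⟩
  -- Moving slightly to the right covers integer `r`, which no translation brings into the open
  -- interval `(0, 1)`.
  obtain ⟨a, ⟨h1, h2, h3⟩, h4⟩ := (((T.eventually_simple r hr).filter_mono
    nhdsWithin_le_nhds).and (Ioo_mem_nhdsGT (Int.lt_floor_add_one r))).exists
  have h5 := hW _ (T.simple_add_int a h1 (-⌊r⌋)) (by
    rw [Int.cast_neg]
    have := Int.floor_le r
    exact ⟨by linarith [h4.1], by linarith [h4.2]⟩)
  rwa [T.left_add_int, T.right_add_int, h2, h3] at h5

lemma corners_of_sides {q : 𝓡 → 𝓡 → Prop} (h : ∀ r ∈ T.simple, q (T.left r) (T.right r)) (c : ι) :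
    q (T.pp c) (T.pm c) ∧ q (T.mp c) (T.mm c) ∧ q (T.mp c) (T.pp c) ∧ q (T.mm c) (T.pm c) := by
  have key : ∀ {l : Filter ℝ} [l.NeBot] {A B : 𝓡},
      (∀ᶠ a in l, a ∈ T.simple ∧ T.left a = A ∧ T.right a = B) → q A B := by
    intro l _ A B hl
    obtain ⟨a, h1, h2, h3⟩ := hl.exists
    rw [← h2, ← h3]
    exact h a h1
  exact ⟨key (T.fst_right c), key (T.fst_left c), key (T.snd_right c), key (T.snd_left c)⟩

end RegionSystem

/-! ### Integral surjectivity of the two counting rules. -/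

lemma Submodule.mem_of_single_mem {ι R : Type*} [Finite ι] [DecidableEq ι] [CommRing R]
    {p : Submodule R (ι → R)} {f : ι → R} (h : ∀ d, f d ≠ 0 → Pi.single d 1 ∈ p) : f ∈ p := by
  have := Fintype.ofFinite ι
  rw [← Finset.univ_sum_single f]
  refine Submodule.sum_mem _ fun d _ => ?_
  by_cases hd : f d = 0
  · rw [hd, Pi.single_zero]
    exact p.zero_mem
  · have h1 : Pi.single d (f d) = f d • (Pi.single d 1 : ι → R) := by
      rw [← Pi.single_smul, smul_eq_mul, mul_one]
    rw [h1]
    exact p.smul_mem _ (h d hd)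

namespace RegionSystem

variable {ι 𝓡 : Type*} (T : RegionSystem ι 𝓡)

/-- The sum of the values in the four corners at each crossing. -/
def cornerSum : (𝓡 → ℤ) →ₗ[ℤ] (ι → ℤ) where
  toFun u d := u (T.pp d) + u (T.pm d) + u (T.mp d) + u (T.mm d)
  map_add' u v := by
    ext d
    simp only [Pi.add_apply]
    ring
  map_smul' k u := by
    ext d
    simp only [Pi.smul_apply, smul_eq_mul, RingHom.id_apply]
    ring

open Classical in
/-- The contribution of the regions that touch a crossing twice. -/
noncomputable def doubledSum : (𝓡 → ℤ) →ₗ[ℤ] (ι → ℤ) where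
  toFun u d := (if T.pp d = T.mm d then u (T.pp d) else 0) +
    (if T.pm d = T.mp d then u (T.pm d) else 0)
  map_add' u v := by
    ext d
    simp only [Pi.add_apply]
    split_ifs <;> ring
  map_smul' k u := by
    ext d
    simp only [Pi.smul_apply, smul_eq_mul, RingHom.id_apply]
    split_ifs <;> ring

/-- There is a checkerboard colouring of the regions. -/
lemma exists_coloring : ∃ s : 𝓡 → ℤ, (∀ R, s R = 1 ∨ s R = -1) ∧
    ∀ r ∈ T.simple, s (T.left r) = -s (T.right r) := by
  obtain ⟨W, hW⟩ := T.exists_winding_total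
  refine ⟨fun R => ((W R).negOnePow : ℤ), fun R => ?_, fun r hr => ?_⟩
  · rcases Int.units_eq_one_or (W R).negOnePow with h | h <;> simp [h]
  · simp only
    rw [hW r hr, Int.negOnePow_succ]
    simp

/-- The total winding number separates the two sides of the curve. -/
lemma adjacent_ne (c : ι) : T.pp c ≠ T.pm c ∧ T.mp c ≠ T.mm c ∧ T.mp c ≠ T.pp c ∧
    T.mm c ≠ T.pm c := by
  obtain ⟨W, hW⟩ := T.exists_winding_total
  refine T.corners_of_sides (q := fun A B => A ≠ B) (fun r hr h => ?_) c
  have := hW r hr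
  rw [h] at this
  omega

variable {T}

/-- Neighbouring corners have opposite colours, so multiplication by `s` turns the plain corner sum
into the alternating one. -/
lemma cornerSum_coloring_mul {s : 𝓡 → ℤ} (hs : ∀ r ∈ T.simple, s (T.left r) = -s (T.right r))
    (W : 𝓡 → ℤ) (d : ι) :
    T.cornerSum (fun R => s R * W R) d = s (T.pp d) * T.alt W d := by
  obtain ⟨h1, h2, h3, h4⟩ := T.corners_of_sides (q := fun A B => s A = -s B) hs d
  have h5 : s (T.pm d) = -s (T.pp d) := by omega
  have h6 : s (T.mm d) = s (T.pp d) := by omega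
  simp only [cornerSum, LinearMap.coe_mk, AddHom.coe_mk, alt]
  rw [h3, h5, h6]
  ring

variable (T)

open Classical in
/-- A winding function of a loop with alternating signs solves the double counting problem for one
crossing. -/
lemma exists_cornerSum_eq_single {c : ι} {W : 𝓡 → ℤ} (hW : T.IsWinding c W) :
    ∃ u, T.cornerSum u = Pi.single c 1 ∧ ∀ R, W R = 0 → u R = 0 := by
  obtain ⟨s, hs1, hs⟩ := T.exists_coloring
  have he : (s (T.pp c) * T.alt W c) * (s (T.pp c) * T.alt W c) = 1 := by
    rcases hs1 (T.pp c) with h | h <;> rcases hW.alt_self with h' | h' <;> rw [h, h'] <;> norm_num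
  -- The coefficient is the sign of the corner sum at `c`, which is its own inverse.
  refine ⟨(s (T.pp c) * T.alt W c) • fun R => s R * W R, ?_, fun R hR => ?_⟩
  · ext d
    rw [map_smul, Pi.smul_apply, cornerSum_coloring_mul hs, smul_eq_mul]
    by_cases hdc : d = c
    · subst hdc
      rw [he, Pi.single_eq_same]
    · rw [hW.alt_eq_zero hdc, Pi.single_eq_of_ne hdc, mul_zero, mul_zero]
  · simp [hR]

theorem cornerSum_surjective [Finite ι] : Function.Surjective T.cornerSum := by
  classical
  rw [← LinearMap.range_eq_top, eq_top_iff]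
  intro f _
  refine Submodule.mem_of_single_mem fun d _ => ?_
  obtain ⟨W, hW⟩ := T.exists_isWinding d
  obtain ⟨u, hu, -⟩ := T.exists_cornerSum_eq_single hW
  exact ⟨u, hu⟩

lemma doubledSum_eq_zero_of_not_doubled {d : ι} (hd : ¬ T.Doubled d) (u : 𝓡 → ℤ) :
    T.doubledSum u d = 0 := by
  simp only [Doubled, not_or] at hd
  simp only [doubledSum, LinearMap.coe_mk, AddHom.coe_mk]
  rw [if_neg hd.1, if_neg hd.2, add_zero]

/-- A solution of the double counting problem for a doubled crossing, whose values at the regions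
that touch other crossings twice vanish unless the other crossing is nested in the first one. -/
lemma exists_cornerSum_eq_single_of_doubled [DecidableEq ι] {c : ι} (hc : T.Doubled c) :
    ∃ u, T.cornerSum u = Pi.single c 1 ∧ ∀ d, T.doubledSum u d ≠ 0 →
      T.Doubled d ∧ T.hi d - T.lo d < T.hi c - T.lo c := by
  classical
  obtain ⟨W, hW, hW0⟩ := hc.exists_isWinding
  obtain ⟨u, hu, hu0⟩ := T.exists_cornerSum_eq_single hW
  refine ⟨u, by convert hu, fun d hd => ?_⟩
  have hdd : T.Doubled d := by
    by_contra h
    exact hd (T.doubledSum_eq_zero_of_not_doubled h u)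
  refine ⟨hdd, ?_⟩
  have key : ∀ {l : Filter ℝ} [l.NeBot] {A B : 𝓡},
      (∀ᶠ a in l, a ∈ T.simple ∧ T.left a = A ∧ T.right a = B) →
      (∀ᶠ a in l, a ∈ T.outside c) → u A = 0 ∧ u B = 0 := by
    intro l _ A B hl ho
    obtain ⟨a, ⟨h1, h2, h3⟩, h4⟩ := (hl.and ho).exists
    obtain ⟨h5, h6⟩ := hW0 a h1 h4
    rw [h2] at h5
    rw [h3] at h6
    exact ⟨hu0 _ h5, hu0 _ h6⟩
  have hsum : ∀ {e : ι}, (T.pp e = T.mm e → u (T.pp e) = 0) → (T.pm e = T.mp e → u (T.pm e) = 0) →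
      T.doubledSum u e = 0 := by
    intro e h1 h2
    simp only [doubledSum, LinearMap.coe_mk, AddHom.coe_mk]
    split_ifs with h3 h4 h4
    · rw [h1 h3, h2 h4, add_zero]
    · rw [h1 h3, add_zero]
    · rw [h2 h4, add_zero]
    · rw [add_zero]
  -- A region doubled at `c` borders the strand just before `T.lo c`, which is off the loop, so `u`
  -- vanishes there and `c` itself has no error.
  by_cases hdc : d = c
  · subst hdc
    refine absurd (hsum (fun h => ?_) (fun h => ?_)) hd
    · rcases T.lo_hi d with ⟨h1, h2⟩ | ⟨h1, h2⟩
      · have := T.eventually_outside_lo d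
        rw [h1] at this
        rw [h]
        exact (key (T.fst_left d) this).2
      · have := T.eventually_outside_lo d
        rw [h1] at this
        rw [h]
        exact (key (T.snd_left d) this).1
    · rcases T.lo_hi d with ⟨h1, h2⟩ | ⟨h1, h2⟩
      · have := T.eventually_outside_lo d
        rw [h1] at this
        rw [h]
        exact (key (T.fst_left d) this).1
      · have := T.eventually_outside_lo d
        rw [h1] at this
        exact (key (T.snd_left d) this).2
  · rcases mem_Ioo_or_notMem_Icc (T.fst_ne hdc).1 (T.fst_ne hdc).2 with h | h
    -- Both passages through `d` lie strictly inside the loop, so the loop at `d` is shorter.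
    · have h' := (hc.fst_mem_iff hdc).1 h
      rcases T.lo_hi d with ⟨h1, h2⟩ | ⟨h1, h2⟩ <;> rw [h1, h2] <;>
        linarith [h.1, h.2, h'.1, h'.2]
    · have ho := T.eventually_outside (T.fst_mem d) h
      have h1 := key (T.fst_right d) (ho.filter_mono nhdsWithin_le_nhds)
      exact absurd (hsum (fun _ => h1.1) (fun _ => h1.2)) hd

/-- Doubled crossings come first, by well-founded induction on the loop length; the others follow
because their errors sit at doubled crossings. -/
theorem cornerSum_sub_doubledSum_surjective [Finite ι] :
    Function.Surjective (T.cornerSum - T.doubledSum) := by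
  classical
  set p := LinearMap.range (T.cornerSum - T.doubledSum) with hp
  have hstep : ∀ c u, T.cornerSum u = Pi.single c 1 →
      (∀ d, T.doubledSum u d ≠ 0 → Pi.single d 1 ∈ p) → Pi.single c 1 ∈ p := by
    intro c u hu h
    have h1 : Pi.single c 1 = (T.cornerSum - T.doubledSum) u + T.doubledSum u := by
      rw [LinearMap.sub_apply, hu, sub_add_cancel]
    rw [h1]
    exact p.add_mem ⟨u, rfl⟩ (Submodule.mem_of_single_mem h)
  have hdoubled : ∀ c, T.Doubled c → Pi.single c 1 ∈ p := by
    let r : ι → ι → Prop := fun d c => T.hi d - T.lo d < T.hi c - T.lo c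
    have : IsTrans ι r := ⟨fun _ _ _ h1 h2 => lt_trans (show _ < _ from h1) h2⟩
    have : Std.Irrefl r := ⟨fun _ h => lt_irrefl _ (show _ < _ from h)⟩
    intro c
    induction c using (Finite.wellFounded_of_trans_of_irrefl r).induction with
    | _ c ih =>
      intro hc
      obtain ⟨u, hu, hu'⟩ := T.exists_cornerSum_eq_single_of_doubled hc
      exact hstep c u hu fun d hd => ih d (hu' d hd).2 (hu' d hd).1
  rw [← LinearMap.range_eq_top, eq_top_iff]
  intro f _
  refine Submodule.mem_of_single_mem fun c _ => ?_
  obtain ⟨W, hW⟩ := T.exists_isWinding c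
  obtain ⟨u, hu, -⟩ := T.exists_cornerSum_eq_single hW
  refine hstep c u hu fun d hd => hdoubled d ?_
  by_contra h
  exact hd (T.doubledSum_eq_zero_of_not_doubled h u)

/-! ### Counting the regions by linear algebra. -/

/-- The alternating corner sums, the jump across the curve at `r` and the value to its left. -/
def evaluation (r : ℝ) : (𝓡 → ℚ) →ₗ[ℚ] (ι → ℚ) × ℚ × ℚ where
  toFun F := (T.alt F, F (T.left r) - F (T.right r), F (T.left r))
  map_add' F G := by
    refine Prod.ext (funext fun d => ?_) (Prod.ext ?_ rfl)
    · simp only [alt, Pi.add_apply, Prod.fst_add]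
      ring
    · simp only [Pi.add_apply, Prod.snd_add, Prod.fst_add]
      ring
  map_smul' k F := by
    refine Prod.ext (funext fun d => ?_) (Prod.ext ?_ rfl)
    · simp only [alt, Pi.smul_apply, Prod.smul_fst, smul_eq_mul, RingHom.id_apply]
      ring
    · simp only [Pi.smul_apply, Prod.smul_snd, Prod.smul_fst, smul_eq_mul, RingHom.id_apply]
      ring

/-- Vanishing alternating sums keep the jump constant through every crossing. As it is zero at `r`,
it is zero everywhere, so `F` is constant and equal to its value zero at `T.left r`. -/
lemma evaluation_injective {r : ℝ} (hr : r ∈ T.simple) : Function.Injective (T.evaluation r) := by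
  rw [injective_iff_map_eq_zero]
  intro F hF
  have halt : ∀ d, F (T.pp d) - F (T.pm d) + F (T.mm d) - F (T.mp d) = 0 := fun d =>
    congrFun (congrArg Prod.fst hF) d
  have hjump : F (T.left r) - F (T.right r) = 0 := congrArg (fun x => x.2.1) hF
  have hval : F (T.left r) = 0 := congrArg (fun x => x.2.2) hF
  have h1 : ∀ t ∈ T.simple, F (T.left t) = F (T.right t) := by
    intro t ht
    have := T.eq_of_eq_through_crossings (fun A B => F A - F B) isPreconnected_univ isOpen_univ
      (fun c _ => by linarith [halt c]) (fun c _ => by linarith [halt c]) ⟨trivial, ht⟩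
      ⟨trivial, hr⟩
    linarith
  ext R
  rw [T.const F h1 R (T.left r), hval]
  rfl

/-- Triangular elimination: constants give the last coordinate, the total winding number the jump,
and the loop winding numbers the unit vectors up to sign. -/
lemma evaluation_surjective [Finite ι] {r : ℝ} (hr : r ∈ T.simple) :
    Function.Surjective (T.evaluation r) := by
  classical
  have := Fintype.ofFinite ι
  set p := LinearMap.range (T.evaluation r) with hp
  have hconst : ((0, 0, 1) : (ι → ℚ) × ℚ × ℚ) ∈ p :=
    ⟨fun _ => 1, by simp [evaluation, alt, funext_iff]⟩
  have htotal : ((0, 1, 0) : (ι → ℚ) × ℚ × ℚ) ∈ p := by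
    obtain ⟨W, hW⟩ := T.exists_winding_total
    have h1 : T.evaluation r (fun R => (W R : ℚ)) = (0, 1, (W (T.left r) : ℚ)) := by
      refine Prod.ext (funext fun d => ?_) (Prod.ext ?_ rfl)
      · obtain ⟨h1, h2, h3, h4⟩ := T.corners_of_sides (q := fun A B => W A = W B + 1) hW d
        simp only [evaluation, LinearMap.coe_mk, AddHom.coe_mk, alt, Pi.zero_apply]
        rw [h1, h2]
        push_cast
        have : (W (T.pm d) : ℚ) + 1 = W (T.mm d) := by exact_mod_cast h4.symm
        linarith
      · simp only [evaluation, LinearMap.coe_mk, AddHom.coe_mk]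
        rw [hW r hr]
        push_cast
        ring
    have h2 : ((0, 1, 0) : (ι → ℚ) × ℚ × ℚ) =
        T.evaluation r (fun R => (W R : ℚ)) - (W (T.left r) : ℚ) • (0, 0, 1) := by
      rw [h1]
      simp
    rw [h2]
    exact p.sub_mem ⟨_, rfl⟩ (p.smul_mem _ hconst)
  have hsnd : ∀ y : ℚ × ℚ, ((0, y) : (ι → ℚ) × ℚ × ℚ) ∈ p := by
    rintro ⟨y, z⟩
    have h1 : ((0, y, z) : (ι → ℚ) × ℚ × ℚ) = y • (0, 1, 0) + z • (0, 0, 1) := by simp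
    rw [h1]
    exact p.add_mem (p.smul_mem _ htotal) (p.smul_mem _ hconst)
  have hsingle : ∀ c : ι, ((Pi.single c 1, 0) : (ι → ℚ) × ℚ × ℚ) ∈ p := by
    intro c
    obtain ⟨W, hW⟩ := T.exists_isWinding c
    have h1 : (T.evaluation r (fun R => (W R : ℚ))).1 = ((T.alt W c : ℤ) : ℚ) • Pi.single c 1 := by
      ext d
      have h2 : (T.evaluation r (fun R => (W R : ℚ))).1 d = ((T.alt W d : ℤ) : ℚ) := by
        simp [evaluation, alt]
      rw [h2, Pi.smul_apply, smul_eq_mul]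
      by_cases hdc : d = c
      · subst hdc
        rw [Pi.single_eq_same, mul_one]
      · rw [hW.alt_eq_zero hdc, Pi.single_eq_of_ne hdc]
        simp
    have h3 : ((Pi.single c 1, 0) : (ι → ℚ) × ℚ × ℚ) = ((T.alt W c : ℤ) : ℚ) •
        (T.evaluation r (fun R => (W R : ℚ)) - (0, (T.evaluation r (fun R => (W R : ℚ))).2)) := by
      refine Prod.ext ?_ ?_
      · rw [Prod.smul_fst, Prod.fst_sub, h1, sub_zero, smul_smul]
        rcases hW.alt_self with h | h <;> rw [h] <;> simp
      · simp
    rw [h3]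
    exact p.smul_mem _ (p.sub_mem ⟨_, rfl⟩ (hsnd _))
  rw [← LinearMap.range_eq_top, eq_top_iff]
  rintro ⟨f, y⟩ -
  have h1 : ((f, y) : (ι → ℚ) × ℚ × ℚ) = (f, 0) + (0, y) := by simp
  rw [h1]
  refine p.add_mem ?_ (hsnd y)
  have h2 : f ∈ p.comap (LinearMap.inl ℚ (ι → ℚ) (ℚ × ℚ)) :=
    Submodule.mem_of_single_mem fun d _ => hsingle d
  exact h2

include T in
theorem finite_region [Finite ι] : Finite 𝓡 := by
  classical
  obtain ⟨r, hr⟩ := T.dense_simple.nonempty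
  have := Module.Finite.of_injective (T.evaluation r) (T.evaluation_injective hr)
  exact (Pi.linearIndependent_single_one 𝓡 ℚ).finite

include T in
theorem card_region [Finite ι] : Nat.card 𝓡 = Nat.card ι + 2 := by
  have := Fintype.ofFinite ι
  have := T.finite_region
  have := Fintype.ofFinite 𝓡
  obtain ⟨r, hr⟩ := T.dense_simple.nonempty
  have h := (LinearEquiv.ofBijective (T.evaluation r)
    ⟨T.evaluation_injective hr, T.evaluation_surjective hr⟩).finrank_eq
  rw [Module.finrank_fintype_fun_eq_card, Module.finrank_prod, Module.finrank_prod,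
    Module.finrank_fintype_fun_eq_card, Module.finrank_self] at h
  rw [Nat.card_eq_fintype_card, Nat.card_eq_fintype_card, h]

end RegionSystem

/-! ### Tangent directions, corners and the entries of the matrices. -/

lemma eq_of_eq_add_int {s t : ℝ} (hs : s ∈ Set.Ico (0 : ℝ) 1) (ht : t ∈ Set.Ico (0 : ℝ) 1) {k : ℤ}
    (h : s = t + k) : s = t := by
  have h1 : Int.fract s = Int.fract t := by rw [h, Int.fract_add_intCast]
  rwa [Int.fract_eq_self.2 hs, Int.fract_eq_self.2 ht] at h1

namespace DiagramSurface

/-- The vector `v` is tangent to the surface at `x`. -/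
def IsTangent (S : DiagramSurface) (x v : EuclideanSpace ℝ (Fin 3)) : Prop :=
  match S with
  | plane => v 2 = 0
  | sphere => inner ℝ x v = 0

lemma IsTangent.add {S : DiagramSurface} {x v w : EuclideanSpace ℝ (Fin 3)}
    (hv : S.IsTangent x v) (hw : S.IsTangent x w) : S.IsTangent x (v + w) := by
  cases S
  · change (v + w) 2 = 0
    rw [PiLp.add_apply, show v 2 = 0 from hv, show w 2 = 0 from hw, add_zero]
  · change inner ℝ x (v + w) = 0
    rw [inner_add_right, show inner ℝ x v = 0 from hv, show inner ℝ x w = 0 from hw, add_zero]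

lemma IsTangent.neg {S : DiagramSurface} {x v : EuclideanSpace ℝ (Fin 3)}
    (hv : S.IsTangent x v) : S.IsTangent x (-v) := by
  cases S
  · change (-v) 2 = 0
    rw [PiLp.neg_apply, show v 2 = 0 from hv, neg_zero]
  · change inner ℝ x (-v) = 0
    rw [inner_neg_right, show inner ℝ x v = 0 from hv, neg_zero]

lemma push_eq_self {S : DiagramSurface} {x : EuclideanSpace ℝ (Fin 3)} (hx : x ∈ S.carrier) :
    S.push x = x := by
  cases S
  · rfl
  · have : ‖x‖ = 1 := mem_sphere_zero_iff_norm.1 hx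
    simp [push, this]

/-- On the sphere the norm has derivative zero in a tangent direction, so the radial projection has
no first-order effect. -/
lemma hasDerivAt_push {S : DiagramSurface} {x v : EuclideanSpace ℝ (Fin 3)} (hx : x ∈ S.carrier)
    (hv : S.IsTangent x v) : HasDerivAt (fun ε : ℝ => S.push (x + ε • v)) v 0 := by
  have hline : HasDerivAt (fun ε : ℝ => x + ε • v) v 0 := by
    simpa using ((hasDerivAt_id (0 : ℝ)).smul_const v).const_add x
  cases S
  · exact hline
  · have hx1 : ‖x‖ = 1 := mem_sphere_zero_iff_norm.1 hx
    have hv0 : inner ℝ x v = 0 := hv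
    have h1 : HasDerivAt (fun ε : ℝ => √(‖x + ε • v‖ ^ 2)) 0 0 := by
      have := hline.norm_sq.sqrt (by simp [hx1])
      simpa [hv0] using this
    simp only [Real.sqrt_sq (norm_nonneg _)] at h1
    have h2 := (h1.inv (by simp [hx1])).smul hline
    exact (h2.congr_deriv (by simp [hx1])).congr_of_eventuallyEq
      (Eventually.of_forall fun ε => rfl)

lemma eventually_push_mem {S : DiagramSurface} {x v : EuclideanSpace ℝ (Fin 3)}
    (hx : x ∈ S.carrier) (hv : S.IsTangent x v) :
    ∀ᶠ ε : ℝ in 𝓝 0, S.push (x + ε • v) ∈ S.carrier := by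
  cases S
  · refine Eventually.of_forall fun ε => ?_
    change (x + ε • v) 2 = 0
    rw [PiLp.add_apply, PiLp.smul_apply, show x 2 = 0 from hx, show v 2 = 0 from hv]
    simp
  · have hx1 : ‖x‖ = 1 := mem_sphere_zero_iff_norm.1 hx
    have hc : Continuous (fun ε : ℝ => x + ε • v) := by fun_prop
    have hne : ∀ᶠ ε : ℝ in 𝓝 0, x + ε • v ≠ 0 := by
      refine (hc.tendsto 0).eventually_ne ?_
      intro h
      simp only [zero_smul, add_zero] at h
      simp [h] at hx1
    filter_upwards [hne] with ε hε
    refine mem_sphere_zero_iff_norm.2 ?_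
    change ‖‖x + ε • v‖⁻¹ • (x + ε • v)‖ = 1
    rw [norm_smul, norm_inv, norm_norm, inv_mul_cancel₀ (norm_ne_zero_iff.2 hε)]

end DiagramSurface

lemma KnotProjection.isTangent_deriv {S : DiagramSurface} (P : KnotProjection S) (t : ℝ) :
    S.IsTangent (P.curve t) (deriv P.curve t) := by
  have h1 : HasDerivAt P.curve (deriv P.curve t) t :=
    (P.contDiff.differentiable one_ne_zero t).hasDerivAt
  cases S
  · change deriv P.curve t 2 = 0
    have h2 := (EuclideanSpace.proj (2 : Fin 3) : EuclideanSpace ℝ (Fin 3) →L[ℝ] ℝ).hasFDerivAt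
      |>.comp_hasDerivAt t h1
    have h3 : (⇑(EuclideanSpace.proj (2 : Fin 3) : EuclideanSpace ℝ (Fin 3) →L[ℝ] ℝ) ∘ P.curve) =
        fun _ => (0 : ℝ) := funext fun t => P.curve_mem t
    rw [h3] at h2
    exact h2.unique (hasDerivAt_const t 0)
  · change inner ℝ (P.curve t) (deriv P.curve t) = 0
    have h2 := h1.norm_sq
    have h3 : (fun t => ‖P.curve t‖ ^ 2) = fun _ => (1 : ℝ) := funext fun t => by
      rw [mem_sphere_zero_iff_norm.1 (P.curve_mem t), one_pow]
    rw [h3] at h2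
    have := h2.unique (hasDerivAt_const t 1)
    linarith

namespace KnotChart

variable {S : DiagramSurface} {P : KnotProjection S} (C : KnotChart P)

/-- The combinatorial data of a knot projection. -/
noncomputable def regionSystem : RegionSystem P.Crossing P.Region where
  simple := C.loop.simpleParams
  left := C.left
  right := C.right
  fst := C.fst
  snd := C.snd
  pp := C.cornerPP
  pm := C.cornerPM
  mp := C.cornerMP
  mm := C.cornerMM
  fst_mem := C.fst_mem
  snd_mem := C.snd_mem
  fst_ne_snd := fun c d h => by
    obtain rfl : c = d := eq_of_curve_eq (C.curve_fst c) (C.curve_snd d) h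
    exact C.fst_ne_snd_add c 0 (by rw [Int.cast_zero, add_zero, h])
  fst_injective := fun c d h => eq_of_curve_eq (C.curve_fst c) (C.curve_fst d) h
  snd_injective := fun c d h => eq_of_curve_eq (C.curve_snd c) (C.curve_snd d) h
  simple_add_int := fun _ ht k => C.simpleParams_add_int ht k
  left_add_int := C.left_add_int
  right_add_int := C.right_add_int
  eventually_simple := fun _ ht => (C.eventually_sides ht).1
  simple_or_crossing := C.simple_or_crossing
  fst_right := fun c => (C.corners_spec c).1
  fst_left := fun c => (C.corners_spec c).2.1
  snd_right := fun c => (C.corners_spec c).2.2.1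
  snd_left := fun c => (C.corners_spec c).2.2.2.1
  const := fun _ hF => C.const_of_left_eq_right hF
  winding := fun c => by
    have hne : C.fst c ≠ C.snd c := fun h =>
      C.fst_ne_snd_add c 0 (by rw [Int.cast_zero, add_zero, h])
    refine C.exists_region_winding (min_lt_max.2 hne) ?_ ?_
    · have h1 : 0 ≤ min (C.fst c) (C.snd c) := le_min (C.fst_mem c).1 (C.snd_mem c).1
      have h2 : max (C.fst c) (C.snd c) < 1 := max_lt (C.fst_mem c).2 (C.snd_mem c).2
      linarith
    · rcases le_total (C.fst c) (C.snd c) with h | h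
      · rw [min_eq_left h, max_eq_right h, C.γ_fst_eq_γ_snd]
      · rw [min_eq_right h, max_eq_left h, C.γ_fst_eq_γ_snd]
  winding_total := by
    obtain ⟨W, hW, -⟩ := C.exists_region_winding (s := 0) (t := 1) one_pos (by norm_num)
      (by simpa using (C.loop.periodic 0).symm)
    exact ⟨W, hW⟩

lemma mem_boundary_iff (x : P.Crossing) (R : P.Region) : x.1 ∈ P.boundary R ↔
    C.cornerPP x = R ∨ C.cornerPM x = R ∨ C.cornerMP x = R ∨ C.cornerMM x = R := by
  obtain ⟨-, -, -, -, g1, g2, g3, g4, h⟩ := C.corners_spec x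
  have hψ : C.ψ (C.loop.γ (C.fst x)) = x.1 := (C.ψ_φ_curve _).trans (C.curve_fst x)
  constructor
  · rintro ⟨hx, -⟩
    have hxr : x.1 ∈ Set.range C.ψ := ⟨_, hψ⟩
    have h1 : ∀ᶠ y in 𝓝 x.1, y ∈ S.carrier → y ∈ Set.range C.ψ := by
      have := C.eventually_mem (C.loop.γ (C.fst x))
      rwa [hψ] at this
    have h2 : Tendsto C.φ (𝓝 x.1) (𝓝 (C.loop.γ (C.fst x))) := by
      have := (C.φ_contDiffAt' hxr).continuousAt.tendsto
      rwa [← hψ, C.φ_ψ, hψ] at this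
    obtain ⟨y, hy, hy1, hy2⟩ := ((mem_closure_iff_frequently.1 hx).and_eventually
      (h1.and (h2.eventually h))).exists
    have hyX := region_subset R hy
    have hψφ := C.ψ_φ (hy1 hyX.1)
    rw [← hψφ] at hy hyX
    have hK := C.ψ_mem_compl_iff.1 hyX
    have h3 := (C.ψ_mem_region_iff hK).1 hy
    rw [h3] at hy2
    rcases hy2 hK with h4 | h4 | h4 | h4 <;> simp [← h4]
  · intro hR
    have key : ∀ v, HasGerm C.loop.image C.regionAt (C.loop.γ (C.fst x)) v R →
        x.1 ∈ P.boundary R := by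
      intro v hv
      refine ⟨?_, fun hxR => (region_subset R hxR).2 ⟨_, C.curve_fst x⟩⟩
      have h1 : Tendsto (fun ε : ℝ => C.ψ (C.loop.γ (C.fst x) + ε • v)) (𝓝[>] 0) (𝓝 x.1) := by
        rw [← hψ]
        have h2 := (hasDerivAt_line (C.loop.γ (C.fst x)) v).continuousAt.tendsto
        simp only [zero_smul, add_zero] at h2
        exact (C.ψ_contDiff.continuous.tendsto _).comp (h2.mono_left nhdsWithin_le_nhds)
      exact mem_closure_of_tendsto h1
        (hv.line.mono fun ε hε => (C.ψ_mem_region_iff hε.1).2 hε.2)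
    rcases hR with rfl | rfl | rfl | rfl
    exacts [key _ g1, key _ g2, key _ g3, key _ g4]

/-- In the chart the pushed segment is a curve with initial velocity `w`, so the germ decides in
which region it starts. -/
lemma eventually_push_mem_iff {x : P.Crossing} {v : EuclideanSpace ℝ (Fin 3)} {w : ℂ}
    (hv : S.IsTangent x.1 v) (hw : fderiv ℝ C.φ x.1 v = w) {Q R : P.Region}
    (hQ : HasGerm C.loop.image C.regionAt (C.loop.γ (C.fst x)) w Q) :
    (∀ᶠ ε : ℝ in 𝓝[>] 0, S.push (x.1 + ε • v) ∈ R.1) ↔ Q = R := by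
  have hxS : x.1 ∈ S.carrier := by
    rw [← C.curve_fst x]
    exact P.curve_mem _
  have hxr : x.1 ∈ Set.range C.ψ := by
    rw [← C.curve_fst x]
    exact C.curve_mem _
  have hγ : C.loop.γ (C.fst x) = C.φ x.1 := congrArg C.φ (C.curve_fst x)
  have hpush0 : S.push (x.1 + (0 : ℝ) • v) = x.1 := by
    rw [zero_smul, add_zero, DiagramSurface.push_eq_self hxS]
  have hd := DiagramSurface.hasDerivAt_push hxS hv
  have hφd : HasFDerivAt C.φ (fderiv ℝ C.φ x.1) (S.push (x.1 + (0 : ℝ) • v)) := by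
    rw [hpush0]
    exact ((C.φ_contDiffAt' hxr).differentiableAt one_ne_zero).hasFDerivAt
  have hc := hφd.comp_hasDerivAt 0 hd
  rw [hw] at hc
  have hgerm := hQ _ (by simp only [Function.comp_apply]; rw [hpush0, hγ]) hc
  have hψ : ∀ᶠ ε : ℝ in 𝓝[>] 0,
      C.ψ (C.φ (S.push (x.1 + ε • v))) = S.push (x.1 + ε • v) := by
    have h1 : ∀ᶠ y in 𝓝 (S.push (x.1 + (0 : ℝ) • v)), y ∈ S.carrier → y ∈ Set.range C.ψ := by
      rw [hpush0, ← C.ψ_φ hxr]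
      exact C.eventually_mem _
    have h2 := (hd.continuousAt.eventually h1).and (DiagramSurface.eventually_push_mem hxS hv)
    filter_upwards [h2.filter_mono nhdsWithin_le_nhds] with ε hε
    exact C.ψ_φ (hε.1 hε.2)
  have hiff : ∀ᶠ ε : ℝ in 𝓝[>] 0, (S.push (x.1 + ε • v) ∈ R.1 ↔ Q = R) := by
    filter_upwards [hgerm, hψ] with ε h1 h2
    have h3 := (C.ψ_mem_region_iff h1.1 (R := R)).trans (Eq.congr_left h1.2)
    rwa [Function.comp_apply, h2] at h3
  constructor
  · intro h
    obtain ⟨ε, h1, h2⟩ := (h.and hiff).exists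
    exact h2.1 h1
  · intro h
    filter_upwards [hiff] with ε hε
    exact hε.2 h

lemma linearIndependent_deriv (x : P.Crossing) :
    LinearIndependent ℝ ![deriv P.curve (C.fst x), deriv P.curve (C.snd x)] :=
  P.transverse _ (C.fst_mem x) _ (C.snd_mem x)
    (fun h => C.fst_ne_snd_add x 0 (by rw [Int.cast_zero, add_zero, h]))
    ((C.curve_fst x).trans (C.curve_snd x).symm)

lemma eq_fst_or_eq_snd {x : P.Crossing} {s : ℝ} (hs : s ∈ Set.Ico (0 : ℝ) 1)
    (hsx : P.curve s = x.1) : s = C.fst x ∨ s = C.snd x := by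
  have h1 : C.loop.γ s = C.loop.γ (C.fst x) :=
    C.φ_curve_eq_iff.2 (hsx.trans (C.curve_fst x).symm)
  rcases C.loop.atMostDouble s _ _ h1 (C.γ_fst_eq_γ_snd x) with ⟨k, hk⟩ | ⟨k, hk⟩ | ⟨k, hk⟩
  · exact Or.inl (eq_of_eq_add_int hs (C.fst_mem x) hk)
  · exact absurd hk (C.fst_ne_snd_add x k)
  · exact Or.inr (eq_of_eq_add_int hs (C.snd_mem x) hk)

lemma mem_cornerDirections_iff (x : P.Crossing) (v : EuclideanSpace ℝ (Fin 3)) :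
    v ∈ P.cornerDirections x ↔
      v = deriv P.curve (C.fst x) + deriv P.curve (C.snd x) ∨
      v = deriv P.curve (C.fst x) - deriv P.curve (C.snd x) ∨
      v = -deriv P.curve (C.fst x) + deriv P.curve (C.snd x) ∨
      v = -deriv P.curve (C.fst x) - deriv P.curve (C.snd x) := by
  constructor
  · rintro ⟨s, hs, t, ht, hst, hsx, htx, σ, hσ, τ, hτ, rfl⟩
    simp only [Set.mem_insert_iff, Set.mem_singleton_iff] at hσ hτ
    rcases C.eq_fst_or_eq_snd hs hsx with h1 | h1 <;>
      rcases C.eq_fst_or_eq_snd ht htx with h2 | h2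
    · exact absurd (h1.trans h2.symm) hst
    · rw [h1, h2]
      rcases hσ with rfl | rfl <;> rcases hτ with rfl | rfl <;> simp [sub_eq_add_neg]
    · rw [h1, h2]
      rcases hσ with rfl | rfl <;> rcases hτ with rfl | rfl <;> simp [sub_eq_add_neg, add_comm]
    · exact absurd (h1.trans h2.symm) hst
  · have key : ∀ σ ∈ ({1, -1} : Set ℝ), ∀ τ ∈ ({1, -1} : Set ℝ),
        σ • deriv P.curve (C.fst x) + τ • deriv P.curve (C.snd x) ∈ P.cornerDirections x :=
      fun σ hσ τ hτ => ⟨_, C.fst_mem x, _, C.snd_mem x,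
        fun h => C.fst_ne_snd_add x 0 (by rw [Int.cast_zero, add_zero, h]),
        C.curve_fst x, C.curve_snd x, σ, hσ, τ, hτ, rfl⟩
    rintro (rfl | rfl | rfl | rfl)
    · simpa using key 1 (by simp) 1 (by simp)
    · simpa [sub_eq_add_neg] using key 1 (by simp) (-1) (by simp)
    · simpa using key (-1) (by simp) 1 (by simp)
    · simpa [sub_eq_add_neg] using key (-1) (by simp) (-1) (by simp)

lemma mem_cornersIn_iff (x : P.Crossing) (R : P.Region) (v : EuclideanSpace ℝ (Fin 3)) :
    v ∈ P.cornersIn x R ↔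
      (v = deriv P.curve (C.fst x) + deriv P.curve (C.snd x) ∧ C.cornerPP x = R) ∨
      (v = deriv P.curve (C.fst x) - deriv P.curve (C.snd x) ∧ C.cornerPM x = R) ∨
      (v = -deriv P.curve (C.fst x) + deriv P.curve (C.snd x) ∧ C.cornerMP x = R) ∨
      (v = -deriv P.curve (C.fst x) - deriv P.curve (C.snd x) ∧ C.cornerMM x = R) := by
  obtain ⟨-, -, -, -, g1, g2, g3, g4, -⟩ := C.corners_spec x
  have ta : S.IsTangent x.1 (deriv P.curve (C.fst x)) := by
    have := P.isTangent_deriv (C.fst x)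
    rwa [C.curve_fst] at this
  have tb : S.IsTangent x.1 (deriv P.curve (C.snd x)) := by
    have := P.isTangent_deriv (C.snd x)
    rwa [C.curve_snd] at this
  have da : fderiv ℝ C.φ x.1 (deriv P.curve (C.fst x)) = deriv C.loop.γ (C.fst x) := by
    have := C.deriv_φ_curve (C.fst x)
    rw [C.curve_fst] at this
    exact this.symm
  have db : fderiv ℝ C.φ x.1 (deriv P.curve (C.snd x)) = deriv C.loop.γ (C.snd x) := by
    have := C.deriv_φ_curve (C.snd x)
    rw [C.curve_snd] at this
    exact this.symm
  have e1 := C.eventually_push_mem_iff (R := R) (ta.add tb) (by rw [map_add, da, db]) g1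
  have e2 := C.eventually_push_mem_iff (R := R) (ta.add tb.neg)
    (by rw [map_add, map_neg, da, db, ← sub_eq_add_neg]) g2
  have e3 := C.eventually_push_mem_iff (R := R) (ta.neg.add tb)
    (by rw [map_add, map_neg, da, db]) g3
  have e4 := C.eventually_push_mem_iff (R := R) (ta.neg.add tb.neg)
    (by rw [map_add, map_neg, map_neg, da, db, ← sub_eq_add_neg]) g4
  rw [← sub_eq_add_neg] at e2 e4
  rw [KnotProjection.cornersIn, Set.mem_sep_iff, C.mem_cornerDirections_iff]
  constructor
  · rintro ⟨rfl | rfl | rfl | rfl, h⟩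
    · exact Or.inl ⟨rfl, e1.1 h⟩
    · exact Or.inr (Or.inl ⟨rfl, e2.1 h⟩)
    · exact Or.inr (Or.inr (Or.inl ⟨rfl, e3.1 h⟩))
    · exact Or.inr (Or.inr (Or.inr ⟨rfl, e4.1 h⟩))
  · rintro (⟨rfl, h⟩ | ⟨rfl, h⟩ | ⟨rfl, h⟩ | ⟨rfl, h⟩)
    · exact ⟨Or.inl rfl, e1.2 h⟩
    · exact ⟨Or.inr (Or.inl rfl), e2.2 h⟩
    · exact ⟨Or.inr (Or.inr (Or.inl rfl)), e3.2 h⟩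
    · exact ⟨Or.inr (Or.inr (Or.inr rfl)), e4.2 h⟩

/-- Neighbouring corners belong to different regions, so two corners in one region are opposite;
independence of the velocities makes the two directions distinct. -/
lemma touchesTwice_iff (x : P.Crossing) (R : P.Region) : P.TouchesTwice R x ↔
    (C.cornerPP x = R ∧ C.cornerMM x = R) ∨ (C.cornerPM x = R ∧ C.cornerMP x = R) := by
  set a := deriv P.curve (C.fst x) with ha
  set b := deriv P.curve (C.snd x) with hb
  have hli := LinearIndependent.pair_iff.1 (C.linearIndependent_deriv x)
  rw [← ha, ← hb] at hli
  have hab : a + b ≠ -a - b := by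
    intro h
    have h1 : (2 : ℝ) • a + (2 : ℝ) • b = 0 := by
      rw [show (2 : ℝ) • a + (2 : ℝ) • b = (a + b) - (-a - b) by module, h, sub_self]
    exact two_ne_zero (hli _ _ h1).1
  have hab' : a - b ≠ -a + b := by
    intro h
    have h1 : (2 : ℝ) • a + (-2 : ℝ) • b = 0 := by
      rw [show (2 : ℝ) • a + (-2 : ℝ) • b = (a - b) - (-a + b) by module, h, sub_self]
    exact two_ne_zero (hli _ _ h1).1
  obtain ⟨n1, n2, n3, n4⟩ : C.cornerPP x ≠ C.cornerPM x ∧ C.cornerMP x ≠ C.cornerMM x ∧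
    C.cornerMP x ≠ C.cornerPP x ∧ C.cornerMM x ≠ C.cornerPM x := C.regionSystem.adjacent_ne x
  have hmem := C.mem_cornersIn_iff x R
  rw [← ha, ← hb] at hmem
  have hpair : ∀ {p q : Prop} {u w : EuclideanSpace ℝ (Fin 3)}, u ≠ w →
      (∀ v, v ∈ P.cornersIn x R ↔ (v = u ∧ p) ∨ (v = w ∧ q)) → (P.TouchesTwice R x ↔ p ∧ q) := by
    intro p q u w huw h
    unfold KnotProjection.TouchesTwice
    by_cases hp : p <;> by_cases hq : q
    · have : P.cornersIn x R = {u, w} := by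
        ext v
        simp [h, hp, hq]
      simp [this, Set.ncard_pair huw, hp, hq]
    · have : P.cornersIn x R = {u} := by
        ext v
        simp [h, hp, hq]
      simp [this, hq]
    · have : P.cornersIn x R = {w} := by
        ext v
        simp [h, hp, hq]
      simp [this, hp]
    · have : P.cornersIn x R = ∅ := by
        ext v
        simp [h, hp, hq]
      simp [this, hp]
  by_cases hR : C.cornerPP x = R ∨ C.cornerMM x = R
  · have h1 : C.cornerPM x ≠ R := by
      rintro rfl
      rcases hR with h | h
      exacts [n1 h, n4 h]
    have h2 : C.cornerMP x ≠ R := by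
      rintro rfl
      rcases hR with h | h
      exacts [n3 h.symm, n2 h.symm]
    rw [hpair (p := C.cornerPP x = R) (q := C.cornerMM x = R) hab fun v =>
      (hmem v).trans (by simp only [h1, h2, and_false, false_or])]
    simp [h1]
  · rw [not_or] at hR
    rw [hpair (p := C.cornerPM x = R) (q := C.cornerMP x = R) hab' fun v =>
      (hmem v).trans (by simp only [hR.1, hR.2, and_false, false_or,
      or_false])]
    simp [hR.1]

-- Each entry is the number of corners of the crossing in the region, which never exceeds two.
open Classical in
lemma matrixD2_apply {ι κ : Type*} (x : ι → P.Crossing) (R : κ → P.Region) (i : ι) (j : κ) :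
    P.matrixD2 x R i j = (if C.cornerPP (x i) = R j then 1 else 0) +
      (if C.cornerPM (x i) = R j then 1 else 0) + (if C.cornerMP (x i) = R j then 1 else 0) +
      (if C.cornerMM (x i) = R j then 1 else 0) := by
  obtain ⟨n1, n2, n3, n4⟩ : C.cornerPP (x i) ≠ C.cornerPM (x i) ∧
    C.cornerMP (x i) ≠ C.cornerMM (x i) ∧ C.cornerMP (x i) ≠ C.cornerPP (x i) ∧
    C.cornerMM (x i) ≠ C.cornerPM (x i) := C.regionSystem.adjacent_ne (x i)
  rw [KnotProjection.matrixD2, Matrix.of_apply, KnotProjection.matrixD1, Matrix.of_apply]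
  simp only [C.touchesTwice_iff, C.mem_boundary_iff]
  grind

-- One unit is removed exactly when opposite corners coincide; this is the matrix form of
-- `doubledSum`.
open Classical in
lemma matrixD1_apply {ι κ : Type*} (x : ι → P.Crossing) (R : κ → P.Region) (i : ι) (j : κ) :
    P.matrixD1 x R i j = P.matrixD2 x R i j -
      ((if C.cornerPP (x i) = C.cornerMM (x i) then
        if C.cornerPP (x i) = R j then 1 else 0 else 0) +
      (if C.cornerPM (x i) = C.cornerMP (x i) then
        if C.cornerPM (x i) = R j then 1 else 0 else 0)) := by
  obtain ⟨n1, n2, n3, n4⟩ : C.cornerPP (x i) ≠ C.cornerPM (x i) ∧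
    C.cornerMP (x i) ≠ C.cornerMM (x i) ∧ C.cornerMP (x i) ≠ C.cornerPP (x i) ∧
    C.cornerMM (x i) ≠ C.cornerPM (x i) := C.regionSystem.adjacent_ne (x i)
  rw [C.matrixD2_apply, KnotProjection.matrixD1, Matrix.of_apply]
  simp only [C.mem_boundary_iff]
  grind

open Classical in
lemma sum_ite_region {κ : Type*} [Fintype κ] (R : κ ≃ P.Region) (U : P.Region → ℤ)
    (Q : P.Region) : ∑ j, (if Q = R j then 1 else 0) * U (R j) = U Q := by
  rw [Finset.sum_eq_single (R.symm Q)]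
  · simp
  · intro j _ hj
    rw [if_neg, zero_mul]
    rintro rfl
    simp at hj
  · simp

lemma matrixD2_mulVec {ι κ : Type*} [Fintype κ] (x : ι → P.Crossing) (R : κ ≃ P.Region)
    (U : P.Region → ℤ) (i : ι) :
    (P.matrixD2 x R).mulVec (fun j => U (R j)) i = C.regionSystem.cornerSum U (x i) := by
  classical
  change ∑ j, P.matrixD2 x R i j * U (R j) = U (C.cornerPP (x i)) + U (C.cornerPM (x i)) +
    U (C.cornerMP (x i)) + U (C.cornerMM (x i))
  simp only [C.matrixD2_apply, add_mul, Finset.sum_add_distrib, sum_ite_region]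

lemma matrixD1_mulVec {ι κ : Type*} [Fintype κ] (x : ι → P.Crossing) (R : κ ≃ P.Region)
    (U : P.Region → ℤ) (i : ι) :
    (P.matrixD1 x R).mulVec (fun j => U (R j)) i =
      (C.regionSystem.cornerSum - C.regionSystem.doubledSum) U (x i) := by
  classical
  rw [LinearMap.sub_apply, Pi.sub_apply, ← C.matrixD2_mulVec x R]
  change ∑ j, P.matrixD1 x R i j * U (R j) = ∑ j, P.matrixD2 x R i j * U (R j) -
    ((if C.cornerPP (x i) = C.cornerMM (x i) then U (C.cornerPP (x i)) else 0) +
    (if C.cornerPM (x i) = C.cornerMP (x i) then U (C.cornerPM (x i)) else 0))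
  simp only [C.matrixD1_apply, sub_mul, add_mul, Finset.sum_add_distrib, Finset.sum_sub_distrib]
  congr 2
  · split_ifs
    · exact sum_ite_region R U _
    · simp
  · split_ifs
    · exact sum_ite_region R U _
    · simp

end KnotChart

/-! ### Conclusion for projections and diagrams. -/

theorem mainTheorem11 (S : DiagramSurface) (D : KnotProjection S ⊕ KnotDiagram S)
    (n : ℕ) (hn : 1 ≤ n) (x : Fin n ≃ (underlyingProjection D).Crossing) :
    Nonempty (Fin (n + 2) ≃ (underlyingProjection D).Region) ∧
    ∀ R : Fin (n + 2) ≃ (underlyingProjection D).Region,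
      (∀ c : Fin n → ℤ, ∃ u : Fin (n + 2) → ℤ,
        ((underlyingProjection D).matrixD1 x R).mulVec u + c = 0) ∧
      (∀ c : Fin n → ℤ, ∃ u : Fin (n + 2) → ℤ,
        ((underlyingProjection D).matrixD2 x R).mulVec u + c = 0) := by
  obtain ⟨C⟩ := (underlyingProjection D).nonempty_chart
  have : Finite (underlyingProjection D).Crossing := Finite.of_equiv _ x
  refine ⟨?_, fun R => ⟨fun c => ?_, fun c => ?_⟩⟩
  · have h1 := C.regionSystem.card_region
    rw [← Nat.card_congr x, Nat.card_fin] at h1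
    have := C.regionSystem.finite_region
    exact ⟨(Finite.equivFinOfCardEq h1).symm⟩
  · obtain ⟨U, hU⟩ := C.regionSystem.cornerSum_sub_doubledSum_surjective fun y => -c (x.symm y)
    refine ⟨fun j => U (R j), ?_⟩
    ext i
    rw [Pi.add_apply, C.matrixD1_mulVec, hU]
    simp
  · obtain ⟨U, hU⟩ := C.regionSystem.cornerSum_surjective fun y => -c (x.symm y)
    refine ⟨fun j => U (R j), ?_⟩
    ext i
    rw [Pi.add_apply, C.matrixD2_mulVec, hU]
    simp
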